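/- Let $n\ge 1$, write points of $\mathbb R\times\mathbb R^n$ as $(t,x)$, let $\nabla=(\partial_t,\partial_{x_1},\dots,\partial_{x_n})$ be the space-time gradient, and put $A_j=\mathbb R\times\{2^j\le|x|\le2^{j+1}\}$, $A_{<j}=\mathbb R\times\{|x|\le 2^j\}$ for $j\in\mathbb Z$. Fix a smooth $s_0:\mathbb R^n\to\mathbb R$ with $\operatorname{supp}s_0\subset\{1/2<|\xi|<2\}$ and $\sum_{k\in\mathbb Z}s_0(2^{-k}\xi)=1$ for $\xi\neq0$, and let $S_k=s_0(2^{-k}D_x)$ be the corresponding frequency projections in the spatial variable. Define $$\|u\|_{X_k}=2^{k/2}\|u\|_{L^2(A_{<-k})}+\sup_{j\ge-k}\||x|^{-1/2}u\|_{L^2(A_j)},\qquad \|f\|_{X_k'}=\sup_{\|w\|_{X_k}\le1}\int|fw|\,dx\,dt,$$ $$\|u\|_{X^s}^2=\sum_{k\in\mathbb Z}2^{2sk}\|S_ku\|_{X_k}^2,\qquad \|f\|_{Y^s}^2=\sum_{k\in\mathbb Z}2^{2sk}\|S_kf\|_{X_k'}^2,\qquad \|u\|_{\tilde X^s}^2=\|u\|_{X^s}^2+\||x|^{-\frac12-s}u\|_{L^2}^2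 .$$ Consider, for $\epsilon>0$, the following conditions on coefficients $b=(b^0,\dots,b^n)$ (complex valued, locally Lipschitz on $\{x\ne0\}$) and $c$ (complex valued, measurable): $$\text{(B)}\ \sum_{j\in\mathbb Z}\sup_{A_j}\big(|x|^2|\nabla b|+|x||b|\big)\le\epsilon,\qquad \text{(C)}\ \sup|x|^2|c|\le\epsilon,\qquad \text{(CC)}\ \sum_{j\in\mathbb Z}\sup_{A_j}|x|^4|c|^2\le\epsilon .$$ Write $b\nabla u=\sum_{\alpha=0}^n b^\alpha\partial_\alpha u$. Then there is a constant $C$, depending only on $n$, $s$ and $s_0$, such that for all $\epsilon>0$: a) if $|s|\le1$, $|s|<\frac{n-1}2$ and $b$ satisfies (B), then $\|b\nabla u\|_{Y^s}\le C\epsilon\|\nabla u\|_{X^s}$ for all $u\in\mathcal S(\mathbb R\times\mathbb R^n)$; b) if $n\ge3$, $-1<s<0$ and $c$ satisfies (C), then $\|cu\|_{Y^s}\le C\epsilon\|\nabla u\|_{X^s}$ for all $u\in\mathcal S(\mathbb R\times\mathbb R^n)$; c) if $n\ge4$, $s\in\{-1,0\}$ and $c$ satisfies (CC), then $\|cu\|_{Y^s}\le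 C\epsilon^{1/2}\|\nabla u\|_{X^s}$ for all $u\in\mathcal S(\mathbb R\times\mathbb R^n)$; d) if $n=3$ and $c$ satisfies (CC), then $\|cu\|_{Y^0}\le C\epsilon^{1/2}\|u\|_{\tilde X^1}$ for all measurable $u$ on $\mathbb R\times\mathbb R^3$ (the bound being trivial when $\|u\|_{\tilde X^1}=\infty$). (The space $X^s$ is the completion of $\mathcal S(\mathbb R\times\mathbb R^n)$ in its norm, so a)-c) extend by density.) -/

import Mathlib

open MeasureTheory SchwartzMap
open scoped ENNReal ContDiff FourierTransform

noncomputable section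

namespace LocEnergy

/-- Space `ℝⁿ` with the Euclidean norm. -/
abbrev Space (n : ℕ) := EuclideanSpace ℝ (Fin n)

/-- Space-time `ℝ × ℝⁿ`; a point is `z = (t, x)` with `t = z.1`, `x = z.2`. -/
abbrev SpaceTime (n : ℕ) := ℝ × Space n

/-- Vectors `(v₀, …, vₙ)` with complex entries, with the Euclidean norm. -/
abbrev Vec (n : ℕ) := EuclideanSpace ℂ (Fin (n + 1))

/-- The coordinate directions of space-time: index `0` is time, index `i + 1` is `x_i`. -/
def dir (n : ℕ) : Fin (n + 1) → SpaceTime n :=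
  Fin.cases (1, 0) (fun i => (0, EuclideanSpace.single i 1))

/-- The space-time gradient `∇u = (∂₀u, …, ∂ₙu)` of a scalar function. -/
def grad {n : ℕ} (u : SpaceTime n → ℂ) (z : SpaceTime n) : Vec n :=
  WithLp.toLp 2 (fun α => fderiv ℝ u z (dir n α))

/-- `|∇b|`, the Euclidean norm of all the entries `∂_α b^β` of the space-time gradient. -/
def gradAbs {n : ℕ} (b : SpaceTime n → Vec n) (z : SpaceTime n) : ℝ :=
  Real.sqrt (∑ α, ‖fderiv ℝ b z (dir n α)‖ ^ 2)

/-- The first order term `b∇u = ∑_α b^α ∂_α u`. -/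
def bGrad {n : ℕ} (b : SpaceTime n → Vec n) (u : SpaceTime n → ℂ) (z : SpaceTime n) : ℂ :=
  ∑ α, b z α * grad u z α

/-- `A_j = ℝ × {2^j ≤ |x| ≤ 2^(j+1)}`. -/
def ann (n : ℕ) (j : ℤ) : Set (SpaceTime n) :=
  {z | (2 : ℝ) ^ j ≤ ‖z.2‖ ∧ ‖z.2‖ ≤ (2 : ℝ) ^ (j + 1)}

/-- `A_{<j} = ℝ × {|x| ≤ 2^j}`. -/
def cyl (n : ℕ) (j : ℤ) : Set (SpaceTime n) :=
  {z | ‖z.2‖ ≤ (2 : ℝ) ^ j}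

/-- A smooth dyadic partition of unity in the spatial frequency,
`1 = ∑_k s(2^{-k} ξ)` for `ξ ≠ 0`, with `supp s ⊂ {1/2 < |ξ| < 2}`. -/
structure LittlewoodPaley (n : ℕ) where
  /-- the symbol `s = s₀` of `S₀` -/
  symbol : Space n → ℝ
  smooth : ContDiff ℝ ∞ symbol
  supp : tsupport symbol ⊆ {ξ | 1 / 2 < ‖ξ‖ ∧ ‖ξ‖ < 2}
  sum_eq_one : ∀ ξ : Space n, ξ ≠ 0 → ∑' k : ℤ, symbol ((2 : ℝ) ^ (-k) • ξ) = 1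

variable {n : ℕ}

/-- The convolution kernel of `S_k(D_x)`, `D_x = -i ∂_x`, that is
`y ↦ (2π)^{-n} ∫ e^{i y·ξ} s(2^{-k} ξ) dξ`. The dilation by `2π` accounts for the factor `2π` in
the exponent of Mathlib's Fourier transform. -/
def LittlewoodPaley.kernel (S : LittlewoodPaley n) (k : ℤ) : Space n → ℂ :=
  𝓕⁻ (fun ξ : Space n => ((S.symbol ((2 : ℝ) ^ (-k) • (2 * Real.pi) • ξ) : ℝ) : ℂ))

/-- The frequency projection `S_k(D_x) f`, acting in the spatial variable only. -/
def LittlewoodPaley.proj {F : Type*} [NormedAddCommGroup F] [NormedSpace ℂ F]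
    (S : LittlewoodPaley n) (k : ℤ) (f : SpaceTime n → F) (z : SpaceTime n) : F :=
  ∫ y : Space n, S.kernel k y • f (z.1, z.2 - y)

/-- The weighted norm `‖ |x|^a u ‖_{L²(A)}` over a region `A` of space-time. -/
def weightedL2 {F : Type*} [NormedAddCommGroup F] (a : ℝ) (A : Set (SpaceTime n))
    (u : SpaceTime n → F) : ℝ≥0∞ :=
  eLpNorm (fun z => ‖z.2‖ ^ a * ‖u z‖) 2 (volume.restrict A)

/-- `‖u‖_{X_k} = 2^{k/2} ‖u‖_{L²(A_{<-k})} + sup_{j ≥ -k} ‖ |x|^{-1/2} u ‖_{L²(A_j)}`. -/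
def xkNorm {F : Type*} [NormedAddCommGroup F] (k : ℤ) (u : SpaceTime n → F) : ℝ≥0∞ :=
  (2 : ℝ≥0∞) ^ ((k : ℝ) / 2) * eLpNorm u 2 (volume.restrict (cyl n (-k))) +
    ⨆ (j : ℤ) (_ : -k ≤ j), weightedL2 (-(1 / 2)) (ann n j) u

/-- The norm of the dual `X_k'` for the pairing `∫ f w`. As `w` may be multiplied by any
unimodular function, the supremum of `|∫ f w|` is that of `∫ |f| |w|`. -/
def xkDualNorm (k : ℤ) (f : SpaceTime n → ℂ) : ℝ≥0∞ :=
  ⨆ (w : SpaceTime n → ℂ) (_ : AEStronglyMeasurable w volume) (_ : xkNorm k w ≤ 1),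
    ∫⁻ z, ‖f z‖ₑ * ‖w z‖ₑ

/-- `‖u‖_{X^s} = (∑_k 2^{2sk} ‖S_k u‖_{X_k}²)^{1/2}`. -/
def xNorm {F : Type*} [NormedAddCommGroup F] [NormedSpace ℂ F]
    (S : LittlewoodPaley n) (s : ℝ) (u : SpaceTime n → F) : ℝ≥0∞ :=
  (∑' k : ℤ, (2 : ℝ≥0∞) ^ (2 * s * (k : ℝ)) * xkNorm k (S.proj k u) ^ 2) ^ (1 / 2 : ℝ)

/-- `‖u‖_{X̃^s} = (‖u‖_{X^s}² + ‖ |x|^{-1/2-s} u ‖_{L²}²)^{1/2}` for `s > 0`. -/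
def xTildeNorm (S : LittlewoodPaley n) (s : ℝ) (u : SpaceTime n → ℂ) : ℝ≥0∞ :=
  (xNorm S s u ^ 2 + weightedL2 (-(1 / 2) - s) Set.univ u ^ 2) ^ (1 / 2 : ℝ)

/-- `‖f‖_{Y^s} = (∑_k 2^{2sk} ‖S_k f‖_{X_k'}²)^{1/2}`. -/
def yNorm (S : LittlewoodPaley n) (s : ℝ) (f : SpaceTime n → ℂ) : ℝ≥0∞ :=
  (∑' k : ℤ, (2 : ℝ≥0∞) ^ (2 * s * (k : ℝ)) * xkDualNorm k (S.proj k f) ^ 2) ^ (1 / 2 : ℝ)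

/-- `∑_j sup_{A_j} (|x|² |∇b| + |x| |b|) ≤ ε`, for `b` locally Lipschitz away from `x = 0`.
Such a `b` is differentiable almost everywhere; the supremum counts `∇b` at the points of
differentiability, which gives the essential supremum of the weak gradient. -/
structure CoeffB (ε : ℝ) (b : SpaceTime n → Vec n) : Prop where
  locallyLipschitz : LocallyLipschitzOn {z : SpaceTime n | z.2 ≠ 0} b
  bound : ∑' j : ℤ, ⨆ z ∈ ann n j,
    ENNReal.ofReal (‖z.2‖ ^ 2 * gradAbs b z + ‖z.2‖ * ‖b z‖) ≤ ENNReal.ofReal ε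

/-- `sup |x|² |c| ≤ ε`. -/
structure CoeffC (ε : ℝ) (c : SpaceTime n → ℂ) : Prop where
  measurable : AEStronglyMeasurable c volume
  bound : ∀ z : SpaceTime n, ‖z.2‖ ^ 2 * ‖c z‖ ≤ ε

/-- `∑_j sup_{A_j} |x|⁴ |c|² ≤ ε`. -/
structure CoeffCC (ε : ℝ) (c : SpaceTime n → ℂ) : Prop where
  measurable : AEStronglyMeasurable c volume
  bound : ∑' j : ℤ, ⨆ z ∈ ann n j,
    ENNReal.ofReal (‖z.2‖ ^ 4 * ‖c z‖ ^ 2) ≤ ENNReal.ofReal ε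

end LocEnergy

end

/-!
All norms are handled one frequency at a time. A function of frequency `2^k` is reproduced by
convolution with a kernel which decays at the scale `2^{-k}`. On the ball `|x| ≤ 2^j` this bounds
the `L²` norm by `2^{j/2}` times the norm in `X_k`, with an additional gain `2^{(n-1)(j+k)/2}` from
Bernstein's inequality when `2^j` is below the wavelength `2^{-k}` (`exists_pconv_cyl_le`; the gain
is the factor `al n (j + k)`). Kernels being symmetric, the dual norms of the frequency pieces of a
function supported in `|x| ≤ 2^j` satisfy the dual bounds (`exists_xkDualNorm_cyl_le`). Summation
over the frequencies costs nothing in either bound: the pieces are almost orthogonal in `L²`, and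
decay rapidly away from the ball (`exists_dual_bound`, `exists_tsum_xkDualNorm_le`, and
`exists_eLpNorm_cyl_sum_le` by duality).

For a potential `c` of size `|x|^{-2}`, the product `c u` is cut into dyadic annuli. The input
frequency `2^l` reaches the annulus `|x| ≈ 2^J` with a factor that depends on `J + l` only, the
output frequency `2^k` leaves it with one that depends on `k + J` only, and both factors are summable
for exponents strictly between `-1` and `0`, so that Schur's test applies twice
(`exists_potential_le`). At `s = 0` and `s = -1` one of the two factors fails to be summable; there
the bound by almost orthogonality replaces it, and the annuli are summed by means of the square
summability of the size of `c` (`exists_potential_zero_le`, `exists_potential_neg_one_le`). If the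
weighted `L²` norm of `u` itself is available, no bound on the input is needed
(`exists_potential_tilde_le`).

For the first order term, `b` is cut by a Lipschitz partition of unity into pieces that live at one
dyadic scale `2^j` (`scaledCoeff_locCoeff`); as the sizes of the pieces are summable, it suffices to
multiply by one of them. For `|s| < 1` the interaction of an input frequency `2^l` with an output
frequency `2^k` decays exponentially in `|k - l|`: if the larger frequency exceeds `2^{-j}`, one
derivative is integrated by parts from it to the other factors (`exists_output_le`,
`exists_input_le`), and otherwise the Bernstein factors suffice because `|s| < (n-1)/2`
(`pw_mul_le_of_interaction`, `exists_mul_le`). For `s = ±1`, which forces `n ≥ 4`, the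
derivative is moved in the whole product rather than in each interaction. It falls on the other
function, where the bounds by almost orthogonality apply, or on the coefficient, where a Hardy
inequality or its dual makes up for the lost power of `|x|` (`exists_mul_one_le`,
`exists_mul_neg_one_le`).
-/

open MeasureTheory SchwartzMap Filter
open scoped ENNReal NNReal ContDiff FourierTransform Topology

noncomputable section

namespace LocEnergy

open LineDeriv

variable {n : ℕ}

/-! ### Powers of two, and inequalities in `ℓ²` with values in `[0, ∞]` -/

/-- The power `2 ^ a`, with values in `[0, ∞]`. -/
def pw (a : ℝ) : ℝ≥0∞ := (2 : ℝ≥0∞) ^ a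

lemma pw_add (a b : ℝ) : pw (a + b) = pw a * pw b :=
  ENNReal.rpow_add _ _ (by norm_num) (by norm_num)

@[simp] lemma pw_zero : pw 0 = 1 := by simp [pw]

lemma pw_pos (a : ℝ) : 0 < pw a := ENNReal.rpow_pos (by norm_num) (by norm_num)

lemma pw_ne_zero (a : ℝ) : pw a ≠ 0 := (pw_pos a).ne'

lemma pw_ne_top (a : ℝ) : pw a ≠ ⊤ :=
  ENNReal.rpow_ne_top_of_ne_zero (by norm_num) (by norm_num)

lemma pw_le_pw {a b : ℝ} (h : a ≤ b) : pw a ≤ pw b :=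
  ENNReal.rpow_le_rpow_of_exponent_le (by norm_num) h

lemma pw_le_one {a : ℝ} (h : a ≤ 0) : pw a ≤ 1 := pw_zero ▸ pw_le_pw h

lemma pw_mul_neg (a : ℝ) : pw a * pw (-a) = 1 := by rw [← pw_add]; simp

lemma pw_sq (a : ℝ) : pw a ^ 2 = pw (2 * a) := by rw [sq, ← pw_add]; ring_nf

lemma pw_eq_ofReal (a : ℝ) : pw a = ENNReal.ofReal ((2 : ℝ) ^ a) := by
  rw [pw, ← ENNReal.ofReal_rpow_of_pos (by norm_num)]; simp

lemma pw_int (k : ℤ) : pw k = ENNReal.ofReal ((2 : ℝ) ^ k) := by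
  rw [pw_eq_ofReal, Real.rpow_intCast]

lemma pw_one : pw 1 = 2 := by simp [pw]

lemma tsum_pw_abs_ne_top {δ : ℝ} (hδ : 0 < δ) : ∑' m : ℤ, pw (-(δ * |(m : ℝ)|)) ≠ ⊤ := by
  have h1 : ∀ m : ℤ, pw (-(δ * |(m : ℝ)|)) = ENNReal.ofReal (((2 : ℝ) ^ (-δ)) ^ m.natAbs) := by
    intro m
    rw [pw_eq_ofReal, ← Real.rpow_natCast, ← Real.rpow_mul (by norm_num)]
    congr 2
    rw [Nat.cast_natAbs]; push_cast; ring
  simp_rw [h1]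
  have hr : (2 : ℝ) ^ (-δ) < 1 := Real.rpow_lt_one_of_one_lt_of_neg (by norm_num) (by linarith)
  have hr0 : (0 : ℝ) ≤ (2 : ℝ) ^ (-δ) := by positivity
  have hs : Summable fun m : ℤ => ((2 : ℝ) ^ (-δ)) ^ m.natAbs := by
    apply Summable.of_nat_of_neg
    · simpa using summable_geometric_of_lt_one hr0 hr
    · simpa using summable_geometric_of_lt_one hr0 hr
  exact hs.tsum_ofReal_ne_top

/-- Cauchy–Schwarz. -/
lemma lintegral_mul_sq_le {α : Type*} [MeasurableSpace α] {μ : Measure α} {f g : α → ℝ≥0∞}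
    (hf : AEMeasurable f μ) (hg : AEMeasurable g μ) :
    (∫⁻ a, f a * g a ∂μ) ^ 2 ≤ (∫⁻ a, f a ^ 2 ∂μ) * ∫⁻ a, g a ^ 2 ∂μ := by
  have h := ENNReal.lintegral_mul_le_Lp_mul_Lq μ Real.HolderConjugate.two_two hf hg
  have h2 := pow_le_pow_left' h 2
  rw [mul_pow, ← ENNReal.rpow_mul_natCast, ← ENNReal.rpow_mul_natCast] at h2
  simpa using h2

/-- Cauchy–Schwarz with respect to a weight `κ`. -/
lemma lintegral_weight_mul_sq_le {α : Type*} [MeasurableSpace α] {μ : Measure α}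
    {κ g : α → ℝ≥0∞} (hκ : AEMeasurable κ μ) (hg : AEMeasurable g μ) :
    (∫⁻ a, κ a * g a ∂μ) ^ 2 ≤ (∫⁻ a, κ a ∂μ) * ∫⁻ a, κ a * g a ^ 2 ∂μ := by
  have h := lintegral_mul_sq_le (μ := μ) (f := fun a => κ a ^ (1 / 2 : ℝ))
    (g := fun a => κ a ^ (1 / 2 : ℝ) * g a) (hκ.pow_const _) ((hκ.pow_const _).mul hg)
  have e : ∀ x : ℝ≥0∞, x ^ (1 / 2 : ℝ) * x ^ (1 / 2 : ℝ) = x := fun x => by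
    rw [← ENNReal.rpow_add_of_nonneg _ _ (by norm_num) (by norm_num)]; norm_num
  simpa only [← mul_assoc, e, mul_pow, sq (_ ^ (1 / 2 : ℝ))] using h

lemma tsum_mul_sq_le {ι : Type*} [Countable ι] (f g : ι → ℝ≥0∞) :
    (∑' i, f i * g i) ^ 2 ≤ (∑' i, f i ^ 2) * ∑' i, g i ^ 2 := by
  let _ : MeasurableSpace ι := ⊤
  simpa [lintegral_count] using
    lintegral_mul_sq_le (μ := Measure.count) (f := f) (g := g)
      measurable_from_top.aemeasurable measurable_from_top.aemeasurable

lemma tsum_weight_mul_sq_le {ι : Type*} [Countable ι] (κ g : ι → ℝ≥0∞) :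
    (∑' i, κ i * g i) ^ 2 ≤ (∑' i, κ i) * ∑' i, κ i * g i ^ 2 := by
  let _ : MeasurableSpace ι := ⊤
  simpa [lintegral_count] using
    lintegral_weight_mul_sq_le (μ := Measure.count) (κ := κ) (g := g)
      measurable_from_top.aemeasurable measurable_from_top.aemeasurable

/-- Schur's test for matrices with nonnegative entries. -/
lemma schur_test {ι κ : Type*} [Countable ι] [Countable κ] (K : ι → κ → ℝ≥0∞) {D : ℝ≥0∞}
    (h1 : ∀ i, ∑' j, K i j ≤ D) (h2 : ∀ j, ∑' i, K i j ≤ D) (a : κ → ℝ≥0∞) :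
    ∑' i, (∑' j, K i j * a j) ^ 2 ≤ D ^ 2 * ∑' j, a j ^ 2 := by
  calc ∑' i, (∑' j, K i j * a j) ^ 2
      ≤ ∑' i, D * ∑' j, K i j * a j ^ 2 := by
        gcongr with i
        exact (tsum_weight_mul_sq_le _ _).trans (by gcongr; exact h1 i)
    _ = D * ∑' j, (∑' i, K i j) * a j ^ 2 := by
        rw [ENNReal.tsum_mul_left, ENNReal.tsum_comm]
        simp_rw [ENNReal.tsum_mul_right]
    _ ≤ D * ∑' j, D * a j ^ 2 := by gcongr with j; exact h2 j
    _ = D ^ 2 * ∑' j, a j ^ 2 := by rw [ENNReal.tsum_mul_left, sq, mul_assoc]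

lemma schur_test_sub (A a : ℤ → ℝ≥0∞) :
    ∑' k, (∑' l, A (k - l) * a l) ^ 2 ≤ (∑' m, A m) ^ 2 * ∑' l, a l ^ 2 := by
  refine schur_test (fun k l => A (k - l)) (fun k => ?_) (fun l => ?_) a
  · exact ((Equiv.subLeft k).tsum_eq A).le
  · exact ((Equiv.subRight l).tsum_eq A).le

lemma schur_test_add (A a : ℤ → ℝ≥0∞) :
    ∑' k, (∑' l, A (k + l) * a l) ^ 2 ≤ (∑' m, A m) ^ 2 * ∑' l, a l ^ 2 := by
  refine schur_test (fun k l => A (k + l)) (fun k => ?_) (fun l => ?_) a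
  · exact ((Equiv.addLeft k).tsum_eq A).le
  · exact ((Equiv.addRight l).tsum_eq A).le

lemma sqrt_sq (x : ℝ≥0∞) : (x ^ (1 / 2 : ℝ)) ^ 2 = x := by
  rw [← ENNReal.rpow_mul_natCast]; norm_num

lemma sq_sqrt (x : ℝ≥0∞) : (x ^ 2) ^ (1 / 2 : ℝ) = x := by
  rw [← ENNReal.rpow_natCast_mul]; norm_num

lemma sqrt_le_of_le_sq {x y : ℝ≥0∞} (h : x ≤ y ^ 2) : x ^ (1 / 2 : ℝ) ≤ y := by
  have := ENNReal.rpow_le_rpow h (show (0 : ℝ) ≤ 1 / 2 by norm_num)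
  rwa [sq_sqrt] at this

lemma le_of_sq_le_sq {x y : ℝ≥0∞} (h : x ^ 2 ≤ y ^ 2) : x ≤ y := by
  have := sqrt_le_of_le_sq h
  rwa [sq_sqrt] at this

lemma add_sq_le (a b : ℝ≥0∞) : (a + b) ^ 2 ≤ 2 * (a ^ 2 + b ^ 2) := by
  have := ENNReal.rpow_add_le_mul_rpow_add_rpow a b (p := 2) (by norm_num)
  norm_num at this
  exact_mod_cast this

/-- Minkowski's inequality in `ℓ²`. -/
lemma l2_tsum_le {ι κ : Type*} [Countable ι] [Countable κ] (x : ι → κ → ℝ≥0∞) :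
    (∑' k, (∑' i, x i k) ^ 2) ^ (1 / 2 : ℝ) ≤ ∑' i, (∑' k, x i k ^ 2) ^ (1 / 2 : ℝ) := by
  apply sqrt_le_of_le_sq
  have e : ∀ k, (∑' i, x i k) ^ 2 = ∑' i, ∑' j, x i k * x j k := fun k => by
    rw [sq, ← ENNReal.tsum_mul_right]
    simp_rw [ENNReal.tsum_mul_left]
  simp_rw [e]
  rw [ENNReal.tsum_comm, sq, ← ENNReal.tsum_mul_right]
  refine ENNReal.tsum_le_tsum fun i => ?_
  rw [ENNReal.tsum_comm, ← ENNReal.tsum_mul_left]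
  refine ENNReal.tsum_le_tsum fun j => ?_
  apply le_of_sq_le_sq
  rw [mul_pow, sqrt_sq, sqrt_sq]
  exact tsum_mul_sq_le _ _

lemma eLpNorm_two_sq {α F : Type*} [MeasurableSpace α] [NormedAddCommGroup F] {μ : Measure α}
    (f : α → F) : eLpNorm f 2 μ ^ 2 = ∫⁻ a, ‖f a‖ₑ ^ 2 ∂μ := by
  rw [eLpNorm_eq_lintegral_rpow_enorm_toReal (by norm_num) (by norm_num)]
  simp only [ENNReal.toReal_ofNat, ENNReal.rpow_ofNat]
  exact sqrt_sq _

/-! ### Model kernels and Bernstein's inequality in the spaces `X_k` -/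

/-- The model kernel `2^{kn} (1 + 2^k |y|)^{-m}` at frequency `2^k`, with values in `[0, ∞]`. -/
def kap (n m : ℕ) (k : ℤ) (y : Space n) : ℝ≥0∞ :=
  ENNReal.ofReal (((2 : ℝ) ^ k) ^ n * ((1 + (2 : ℝ) ^ k * ‖y‖) ^ m)⁻¹)

lemma measurable_kap (n m : ℕ) (k : ℤ) : Measurable (kap n m k) := by
  unfold kap; fun_prop

lemma kap_neg (m : ℕ) (k : ℤ) (y : Space n) : kap n m k (-y) = kap n m k y := by
  simp [kap]

lemma kap_anti {m m' : ℕ} (h : m ≤ m') (k : ℤ) (y : Space n) : kap n m' k y ≤ kap n m k y := by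
  unfold kap
  gcongr
  have : 0 ≤ (2 : ℝ) ^ k * ‖y‖ := by positivity
  linarith

lemma exists_lintegral_kap_le (n : ℕ) : ∃ C : ℝ≥0, ∀ k : ℤ, ∫⁻ y, kap n (n + 1) k y ≤ C := by
  have hI : Integrable (fun y : Space n => ((1 + ‖y‖) ^ (n + 1))⁻¹) := by
    have := integrable_one_add_norm (E := Space n) (μ := volume) (r := (n : ℝ) + 1)
      (by simp)
    refine this.congr (Eventually.of_forall fun y => ?_)
    have : 0 < 1 + ‖y‖ := by positivity
    simp only []
    rw [Real.rpow_neg this.le]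
    norm_cast
  refine ⟨(∫ y : Space n, ((1 + ‖y‖) ^ (n + 1))⁻¹).toNNReal, fun k => ?_⟩
  have h2 : (2 : ℝ) ^ k ≠ 0 := by positivity
  have hI2 := (hI.comp_smul h2).const_mul (((2 : ℝ) ^ k) ^ n)
  have e : ∀ y : Space n, ‖(2 : ℝ) ^ k • y‖ = (2 : ℝ) ^ k * ‖y‖ := fun y => by
    rw [norm_smul, Real.norm_of_nonneg (by positivity)]
  simp only [e] at hI2
  unfold kap
  rw [← ofReal_integral_eq_lintegral_ofReal hI2 (Eventually.of_forall fun y => by positivity),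
    integral_const_mul]
  have := Measure.integral_comp_smul (volume : Measure (Space n))
    (fun y => ((1 + ‖y‖) ^ (n + 1))⁻¹) ((2 : ℝ) ^ k)
  simp only [e] at this
  rw [this, finrank_euclideanSpace_fin, abs_of_nonneg (by positivity), smul_eq_mul, ← mul_assoc,
    mul_inv_cancel₀ (by positivity), one_mul]
  exact le_rfl

/-- The weight `(1 + 2^μ |y|)^{-2}`. -/
def wgt (n : ℕ) (μ : ℤ) (y : Space n) : ℝ≥0∞ :=
  ENNReal.ofReal (((1 + (2 : ℝ) ^ μ * ‖y‖) ^ 2)⁻¹)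

/-- For `|x| ≤ 2^j`, two powers of decay of the kernel are traded for a weight centred at the origin.
The remaining `n + 1` powers keep the kernel integrable, hence the exponent `n + 3`. -/
lemma kap_sub_le {j k : ℤ} {x y : Space n} (hx : ‖x‖ ≤ (2 : ℝ) ^ j) :
    kap n (n + 3) k (x - y) ≤ 4 * wgt n (min k (-j)) y * kap n (n + 1) k (x - y) := by
  have e4 : (4 : ℝ≥0∞) = ENNReal.ofReal 4 := by simp
  unfold kap wgt
  rw [e4, ← ENNReal.ofReal_mul (by norm_num), ← ENNReal.ofReal_mul (by positivity)]
  apply ENNReal.ofReal_le_ofReal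
  set μ := min k (-j)
  have h1 : (2 : ℝ) ^ μ * ‖x‖ ≤ 1 := by
    calc (2 : ℝ) ^ μ * ‖x‖ ≤ (2 : ℝ) ^ (-j) * (2 : ℝ) ^ j := by
          gcongr
          · norm_num
          · exact min_le_right _ _
      _ = 1 := by rw [← zpow_add₀ (by norm_num)]; simp
  have h2 : (2 : ℝ) ^ μ * ‖x - y‖ ≤ (2 : ℝ) ^ k * ‖x - y‖ := by
    gcongr
    · norm_num
    · exact min_le_left _ _
  have h3 : ‖y‖ ≤ ‖x‖ + ‖x - y‖ := by
    have := norm_sub_le x (x - y); simpa using this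
  have h4 : 1 + (2 : ℝ) ^ μ * ‖y‖ ≤ 2 * (1 + (2 : ℝ) ^ k * ‖x - y‖) := by
    have : (2 : ℝ) ^ μ * ‖y‖ ≤ (2 : ℝ) ^ μ * (‖x‖ + ‖x - y‖) := by gcongr
    have h5 : 0 ≤ (2 : ℝ) ^ k * ‖x - y‖ := by positivity
    linarith
  set A := 1 + (2 : ℝ) ^ k * ‖x - y‖
  set B := 1 + (2 : ℝ) ^ μ * ‖y‖
  have hA : 0 < A := by positivity
  have hB : 0 < B := by positivity
  have h6 : (A ^ 2)⁻¹ ≤ 4 * (B ^ 2)⁻¹ := by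
    rw [← div_eq_mul_inv, inv_le_comm₀ (by positivity) (by positivity), inv_div, div_le_iff₀ (by norm_num)]
    nlinarith
  calc ((2 : ℝ) ^ k) ^ n * (A ^ (n + 3))⁻¹
      = ((2 : ℝ) ^ k) ^ n * ((A ^ 2)⁻¹ * (A ^ (n + 1))⁻¹) := by
        rw [← mul_inv, ← pow_add]; congr 3; ring
    _ ≤ ((2 : ℝ) ^ k) ^ n * (4 * (B ^ 2)⁻¹ * (A ^ (n + 1))⁻¹) := by gcongr
    _ = _ := by ring

lemma lintegral_kap_sub_left (m : ℕ) (k : ℤ) (x : Space n) :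
    ∫⁻ y, kap n m k (x - y) = ∫⁻ y, kap n m k y :=
  lintegral_sub_left_eq_self _ x

lemma lintegral_kap_sub_right (m : ℕ) (k : ℤ) (y : Space n) :
    ∫⁻ x, kap n m k (x - y) = ∫⁻ y, kap n m k y :=
  lintegral_sub_right_eq_self _ y

/-- The part of the mass of the kernel that falls into a ball. The factor `2^{n min(j+k, 0)}`
is the gain of Bernstein's inequality. -/
lemma exists_lintegral_ball_kap_le (n : ℕ) : ∃ C : ℝ≥0, ∀ (j k : ℤ) (y : Space n),
    ∫⁻ x in Metric.closedBall 0 ((2 : ℝ) ^ j), kap n (n + 3) k (x - y) ≤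
      C * pw (n * (min (j + k) 0 : ℤ)) * wgt n (min k (-j)) y := by
  obtain ⟨C, hC⟩ := exists_lintegral_kap_le n
  set V := (volume (Metric.closedBall (0 : Space n) 1)).toNNReal
  have hV : volume (Metric.closedBall (0 : Space n) 1) = V :=
    (ENNReal.coe_toNNReal measure_closedBall_lt_top.ne).symm
  refine ⟨4 * (C + V), fun j k y => ?_⟩
  have h1 : ∫⁻ x in Metric.closedBall (0 : Space n) ((2 : ℝ) ^ j), kap n (n + 1) k (x - y) ≤ C :=
    (setLIntegral_le_lintegral _ _).trans ((lintegral_kap_sub_right _ _ _).trans_le (hC k))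
  have h2 : ∫⁻ x in Metric.closedBall (0 : Space n) ((2 : ℝ) ^ j), kap n (n + 1) k (x - y) ≤
      pw (n * (j + k : ℤ)) * V := by
    have hk : ∀ z : Space n, kap n (n + 1) k z ≤ ENNReal.ofReal (((2 : ℝ) ^ k) ^ n) := fun z => by
      unfold kap
      apply ENNReal.ofReal_le_ofReal
      apply mul_le_of_le_one_right (by positivity)
      apply inv_le_one_of_one_le₀
      apply one_le_pow₀
      have : 0 ≤ (2 : ℝ) ^ k * ‖z‖ := by positivity
      linarith
    refine (lintegral_mono fun x => hk (x - y)).trans ?_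
    rw [setLIntegral_const, Measure.addHaar_closedBall' _ _ (by positivity), hV,
      finrank_euclideanSpace_fin, ← mul_assoc, ← ENNReal.ofReal_mul (by positivity),
      ← mul_pow, ← zpow_add₀ (by norm_num), pw_eq_ofReal, add_comm k j, mul_comm (n : ℝ),
      Real.rpow_mul (by norm_num), Real.rpow_intCast, Real.rpow_natCast]
  have h3 : ∫⁻ x in Metric.closedBall (0 : Space n) ((2 : ℝ) ^ j), kap n (n + 1) k (x - y) ≤
      (C + V) * pw (n * (min (j + k) 0 : ℤ)) := by
    rcases le_total (j + k) 0 with h | h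
    · rw [min_eq_left h, mul_comm]
      exact h2.trans (by gcongr; exact le_add_self)
    · rw [min_eq_right h]
      simpa using h1.trans le_self_add
  calc ∫⁻ x in Metric.closedBall 0 ((2 : ℝ) ^ j), kap n (n + 3) k (x - y)
      ≤ ∫⁻ x in Metric.closedBall 0 ((2 : ℝ) ^ j),
          4 * wgt n (min k (-j)) y * kap n (n + 1) k (x - y) := by
        apply setLIntegral_mono' measurableSet_closedBall
        intro x hx
        exact kap_sub_le (by simpa using hx)
    _ = 4 * wgt n (min k (-j)) y *
          ∫⁻ x in Metric.closedBall 0 ((2 : ℝ) ^ j), kap n (n + 1) k (x - y) := by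
        rw [lintegral_const_mul]
        exact (measurable_kap _ _ _).comp (measurable_id.sub_const y)
    _ ≤ 4 * wgt n (min k (-j)) y * ((C + V) * pw (n * (min (j + k) 0 : ℤ))) := by gcongr
    _ = _ := by push_cast; ring

/-- Convolution in `x` of a nonnegative function with the model kernel. -/
def pconv (m : ℕ) (k : ℤ) (g : SpaceTime n → ℝ≥0∞) (z : SpaceTime n) : ℝ≥0∞ :=
  ∫⁻ y, kap n m k (z.2 - y) * g (z.1, y)

lemma measurable_pconv (m : ℕ) (k : ℤ) {g : SpaceTime n → ℝ≥0∞} (hg : Measurable g) :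
    Measurable (pconv m k g) := by
  have : Measurable fun p : SpaceTime n × Space n => kap n m k (p.1.2 - p.2) * g (p.1.1, p.2) := by
    have := measurable_kap n m k
    fun_prop
  exact this.lintegral_prod_right'

lemma ae_slice {P : SpaceTime n → Prop} (h : ∀ᵐ z : SpaceTime n, P z) :
    ∀ᵐ t : ℝ, ∀ᵐ x : Space n, P (t, x) := by
  rw [Measure.volume_eq_prod] at h
  exact Measure.ae_ae_of_ae_prod h

lemma ae_of_ae_time {P : ℝ → Prop} (h : ∀ᵐ t : ℝ, P t) : ∀ᵐ z : SpaceTime n, P z.1 := by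
  rw [Measure.volume_eq_prod]
  exact Measure.quasiMeasurePreserving_fst.ae h

lemma pconv_congr_ae (m : ℕ) (k : ℤ) {g h : SpaceTime n → ℝ≥0∞} (hgh : g =ᵐ[volume] h) :
    pconv m k g =ᵐ[volume] pconv m k h := by
  filter_upwards [ae_of_ae_time (ae_slice hgh)] with z hz
  apply lintegral_congr_ae
  filter_upwards [hz] with y hy
  rw [hy]

lemma lintegral_spacetime {f : SpaceTime n → ℝ≥0∞} (hf : AEMeasurable f) :
    ∫⁻ z, f z = ∫⁻ t, ∫⁻ x, f (t, x) := by
  rw [Measure.volume_eq_prod] at *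
  exact lintegral_prod _ hf

lemma measurableSet_cyl (n : ℕ) (j : ℤ) : MeasurableSet (cyl n j) :=
  measurableSet_le (by fun_prop) (by fun_prop)

lemma measurableSet_ann (n : ℕ) (j : ℤ) : MeasurableSet (ann n j) :=
  MeasurableSet.inter
    (measurableSet_le (f := fun _ : SpaceTime n => (2 : ℝ) ^ j) (g := fun z => ‖z.2‖)
      (by fun_prop) (by fun_prop))
    (measurableSet_le (f := fun z : SpaceTime n => ‖z.2‖) (g := fun _ => (2 : ℝ) ^ (j + 1))
      (by fun_prop) (by fun_prop))

/-- The operators with model kernels are symmetric. -/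
lemma lintegral_pconv_mul (m : ℕ) (k : ℤ) {f g : SpaceTime n → ℝ≥0∞} (hf : AEMeasurable f)
    (hg : AEMeasurable g) : ∫⁻ z, pconv m k f z * g z = ∫⁻ z, f z * pconv m k g z := by
  wlog h : Measurable f ∧ Measurable g generalizing f g
  · have h1 : f =ᵐ[volume] hf.mk := hf.ae_eq_mk
    have h2 : g =ᵐ[volume] hg.mk := hg.ae_eq_mk
    have := this hf.measurable_mk.aemeasurable hg.measurable_mk.aemeasurable
      ⟨hf.measurable_mk, hg.measurable_mk⟩
    exact (lintegral_congr_ae ((pconv_congr_ae m k h1).mul h2)).trans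
      (this.trans (lintegral_congr_ae (h1.mul (pconv_congr_ae m k h2))).symm)
  obtain ⟨hf, hg⟩ := h
  have hκ := measurable_kap n m k
  have hpf := measurable_pconv m k hf
  have hpg := measurable_pconv m k hg
  rw [lintegral_spacetime (f := fun z => pconv m k f z * g z) (by fun_prop),
    lintegral_spacetime (f := fun z => f z * pconv m k g z) (by fun_prop)]
  congr 1 with t
  simp only [pconv]
  have e1 : ∀ x, (∫⁻ y, kap n m k (x - y) * f (t, y)) * g (t, x) =
      ∫⁻ y, kap n m k (x - y) * f (t, y) * g (t, x) := fun x =>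
    (lintegral_mul_const _ (by fun_prop)).symm
  have e2 : ∀ x, f (t, x) * (∫⁻ y, kap n m k (x - y) * g (t, y)) =
      ∫⁻ y, f (t, x) * (kap n m k (x - y) * g (t, y)) := fun x =>
    (lintegral_const_mul _ (by fun_prop)).symm
  simp_rw [e1, e2]
  rw [lintegral_lintegral_swap]
  · congr 1 with x
    congr 1 with y
    rw [← kap_neg, neg_sub]
    ring
  · apply Measurable.aemeasurable
    simp only [Function.uncurry_def]
    fun_prop

lemma xkNorm_cyl_le {F : Type*} [NormedAddCommGroup F] (k : ℤ) (w : SpaceTime n → F) :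
    ∫⁻ z in cyl n (-k), ‖w z‖ₑ ^ 2 ≤ pw (-k) * xkNorm k w ^ 2 := by
  have h : pw ((k : ℝ) / 2) * eLpNorm w 2 (volume.restrict (cyl n (-k))) ≤ xkNorm k w :=
    le_self_add
  have h2 := pow_le_pow_left' h 2
  rw [mul_pow, eLpNorm_two_sq, pw_sq] at h2
  calc ∫⁻ z in cyl n (-k), ‖w z‖ₑ ^ 2
      = pw (-k) * (pw (2 * ((k : ℝ) / 2)) * ∫⁻ z in cyl n (-k), ‖w z‖ₑ ^ 2) := by
        rw [← mul_assoc, ← pw_add]; ring_nf; simp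
    _ ≤ _ := by gcongr

lemma xkNorm_ann_le {F : Type*} [NormedAddCommGroup F] {i k : ℤ} (hi : -k ≤ i)
    (w : SpaceTime n → F) :
    ∫⁻ z in ann n i, ‖w z‖ₑ ^ 2 ≤ pw (i + 1) * xkNorm k w ^ 2 := by
  have h : weightedL2 (-(1 / 2)) (ann n i) w ≤ xkNorm k w :=
    (le_iSup₂_of_le (f := fun (j : ℤ) (_ : -k ≤ j) => weightedL2 (-(1 / 2)) (ann n j) w) i hi
      le_rfl).trans le_add_self
  have h2 := pow_le_pow_left' h 2
  rw [weightedL2, eLpNorm_two_sq] at h2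
  calc ∫⁻ z in ann n i, ‖w z‖ₑ ^ 2
      ≤ ∫⁻ z in ann n i, pw (i + 1) * ‖‖z.2‖ ^ (-(1 / 2) : ℝ) * ‖w z‖‖ₑ ^ 2 := by
        apply setLIntegral_mono' (measurableSet_ann n i)
        intro z hz
        have hz0 : 0 < ‖z.2‖ := lt_of_lt_of_le (by positivity) hz.1
        rw [enorm_mul, mul_pow, enorm_norm, ← mul_assoc]
        apply le_mul_of_one_le_left zero_le
        have e : (((i : ℝ) + 1)) = ((i + 1 : ℤ) : ℝ) := by push_cast; ring
        rw [e, pw_int, Real.enorm_of_nonneg (by positivity),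
          ← ENNReal.ofReal_pow (by positivity), ← ENNReal.ofReal_mul (by positivity),
          ENNReal.one_le_ofReal, ← Real.rpow_mul_natCast hz0.le]
        have e2 : ‖z.2‖ ^ (-(1 / 2) * ((2 : ℕ) : ℝ)) = ‖z.2‖⁻¹ := by
          rw [← Real.rpow_neg_one]; norm_num
        rw [e2, ← div_eq_mul_inv, one_le_div hz0]
        exact hz.2
    _ = pw (i + 1) * ∫⁻ z in ann n i, ‖‖z.2‖ ^ (-(1 / 2) : ℝ) * ‖w z‖‖ₑ ^ 2 :=
        lintegral_const_mul' _ _ (pw_ne_top _)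
    _ ≤ _ := by gcongr

lemma exists_mem_ann {z : SpaceTime n} (hz : z.2 ≠ 0) : ∃ i : ℤ, z ∈ ann n i := by
  obtain ⟨i, hi⟩ := exists_mem_Ico_zpow (norm_pos_iff.2 hz) (by norm_num : (1 : ℝ) < 2)
  exact ⟨i, hi.1, hi.2.le⟩

lemma univ_subset_cyl_union_ann (k : ℤ) :
    (Set.univ : Set (SpaceTime n)) ⊆ cyl n (-k) ∪ ⋃ m : ℕ, ann n (-k + m) := by
  intro z _
  by_cases h : ‖z.2‖ ≤ (2 : ℝ) ^ (-k)
  · exact Or.inl h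
  · right
    push Not at h
    have h0 : z.2 ≠ 0 := by
      rw [← norm_pos_iff]; exact lt_trans (by positivity) h
    obtain ⟨i, hi⟩ := exists_mem_ann h0
    have : -k < i + 1 := by
      have := h.trans_le hi.2
      exact (zpow_lt_zpow_iff_right₀ (by norm_num)).1 this
    refine Set.mem_iUnion.2 ⟨(i + k).toNat, ?_⟩
    have e : -k + ((i + k).toNat : ℤ) = i := by omega
    rwa [e]

/-- `X_k` controls `L²` with a weight that is summable against `|x|` beyond the scale
`2^{-μ} ≥ 2^{-k}`. -/
lemma exists_lintegral_wgt_le (n : ℕ) : ∃ C : ℝ≥0, ∀ (k μ : ℤ), μ ≤ k →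
    ∀ w : SpaceTime n → ℂ,
      ∫⁻ z, ‖w z‖ₑ ^ 2 * wgt n μ z.2 ≤ C * pw (-μ) * xkNorm k w ^ 2 := by
  have hS := tsum_pw_abs_ne_top one_pos
  set S := ∑' m : ℤ, pw (-(1 * |(m : ℝ)|)) with hSdef
  refine ⟨1 + 2 * S.toNNReal, fun k μ hμ w => ?_⟩
  have hw1 : ∀ y : Space n, wgt n μ y ≤ 1 := fun y => by
    unfold wgt
    rw [ENNReal.ofReal_le_one]
    apply inv_le_one_of_one_le₀
    apply one_le_pow₀
    have : 0 ≤ (2 : ℝ) ^ μ * ‖y‖ := by positivity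
    linarith
  have hw2 : ∀ i : ℤ, ∀ z ∈ ann n i, wgt n μ z.2 ≤ pw (-(2 * ((μ : ℝ) + i))) := fun i z hz => by
    have e : (-(2 * ((μ : ℝ) + i))) = ((-(2 * (μ + i)) : ℤ) : ℝ) := by push_cast; ring
    rw [e, pw_int]
    apply ENNReal.ofReal_le_ofReal
    rw [zpow_neg]
    apply inv_anti₀ (by positivity)
    rw [mul_comm (2 : ℤ), zpow_mul, zpow_ofNat, zpow_add₀ (by norm_num)]
    gcongr
    have : (2 : ℝ) ^ μ * (2 : ℝ) ^ i ≤ (2 : ℝ) ^ μ * ‖z.2‖ := by gcongr; exact hz.1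
    linarith
  set X := xkNorm k w ^ 2
  have hA : ∫⁻ z in cyl n (-k), ‖w z‖ₑ ^ 2 * wgt n μ z.2 ≤ pw (-μ) * X :=
    calc _ ≤ ∫⁻ z in cyl n (-k), ‖w z‖ₑ ^ 2 :=
          lintegral_mono fun z => mul_le_of_le_one_right zero_le (hw1 _)
      _ ≤ pw (-k) * X := xkNorm_cyl_le k w
      _ ≤ _ := by
        gcongr
        apply pw_le_pw
        have : (μ : ℝ) ≤ k := by exact_mod_cast hμ
        linarith
  have hB : ∀ m : ℕ, ∫⁻ z in ann n (-k + m), ‖w z‖ₑ ^ 2 * wgt n μ z.2 ≤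
      2 * pw (-μ) * X * pw (-(1 * |((-k + m + μ : ℤ) : ℝ)|)) := fun m => by
    set i : ℤ := -k + m
    have hm : min 1 (pw (-(2 * ((μ : ℝ) + i)))) * pw (i + 1) ≤
        2 * pw (-μ) * pw (-(1 * |((i + μ : ℤ) : ℝ)|)) := by
      rw [← pw_one, ← pw_add, ← pw_add]
      rcases le_total 0 (i + μ) with h | h
      · have h' : (0 : ℝ) ≤ ((i + μ : ℤ) : ℝ) := by exact_mod_cast h
        refine (mul_le_mul_left (min_le_right _ _) _).trans ?_
        rw [← pw_add, abs_of_nonneg h']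
        apply pw_le_pw
        push_cast at h' ⊢
        linarith
      · have h' : ((i + μ : ℤ) : ℝ) ≤ 0 := by exact_mod_cast h
        refine (mul_le_mul_left (min_le_left _ _) _).trans ?_
        rw [one_mul, abs_of_nonpos h']
        apply pw_le_pw
        push_cast at h' ⊢
        linarith
    calc ∫⁻ z in ann n i, ‖w z‖ₑ ^ 2 * wgt n μ z.2
        ≤ ∫⁻ z in ann n i, min 1 (pw (-(2 * ((μ : ℝ) + i)))) * ‖w z‖ₑ ^ 2 := by
          apply setLIntegral_mono' (measurableSet_ann n i)
          intro z hz
          rw [mul_comm]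
          gcongr
          exact le_min (hw1 _) (hw2 i z hz)
      _ = min 1 (pw (-(2 * ((μ : ℝ) + i)))) * ∫⁻ z in ann n i, ‖w z‖ₑ ^ 2 :=
          lintegral_const_mul' _ _ (ne_top_of_le_ne_top ENNReal.one_ne_top (min_le_left _ _))
      _ ≤ min 1 (pw (-(2 * ((μ : ℝ) + i)))) * (pw (i + 1) * X) := by
          gcongr; exact xkNorm_ann_le (by omega) w
      _ = min 1 (pw (-(2 * ((μ : ℝ) + i)))) * pw (i + 1) * X := by ring
      _ ≤ 2 * pw (-μ) * pw (-(1 * |((i + μ : ℤ) : ℝ)|)) * X := by gcongr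
      _ = _ := by ring
  calc ∫⁻ z, ‖w z‖ₑ ^ 2 * wgt n μ z.2
      = ∫⁻ z in Set.univ, ‖w z‖ₑ ^ 2 * wgt n μ z.2 := by rw [setLIntegral_univ]
    _ ≤ ∫⁻ z in cyl n (-k) ∪ ⋃ m : ℕ, ann n (-k + m), ‖w z‖ₑ ^ 2 * wgt n μ z.2 :=
        lintegral_mono_set (univ_subset_cyl_union_ann k)
    _ ≤ (∫⁻ z in cyl n (-k), ‖w z‖ₑ ^ 2 * wgt n μ z.2) +
          ∫⁻ z in ⋃ m : ℕ, ann n (-k + m), ‖w z‖ₑ ^ 2 * wgt n μ z.2 := lintegral_union_le (fun z => ‖w z‖ₑ ^ 2 * wgt n μ z.2) _ _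
    _ ≤ pw (-μ) * X + ∑' m : ℕ, 2 * pw (-μ) * X * pw (-(1 * |((-k + m + μ : ℤ) : ℝ)|)) := by
        exact add_le_add hA ((lintegral_iUnion_le _ _).trans (ENNReal.tsum_le_tsum hB))
    _ ≤ pw (-μ) * X + 2 * pw (-μ) * X * S := by
        rw [ENNReal.tsum_mul_left]
        gcongr
        exact ENNReal.tsum_comp_le_tsum_of_injective
          (f := fun m : ℕ => (-k + m + μ : ℤ)) (fun a b h => by simpa using h)
          (fun m : ℤ => pw (-(1 * |(m : ℝ)|)))
    _ = _ := by
        push_cast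
        rw [ENNReal.coe_toNNReal hS]; ring

/-- The factor lost by restricting a function of frequency `2^k` to the ball `|x| ≤ 2^j`, beyond
`2^{j/2}`: it is `2^{(n-1)m/2}` for `m = j + k ≤ 0`, and `1` otherwise. -/
def al (n : ℕ) (m : ℤ) : ℝ≥0∞ := pw (((n : ℝ) - 1) / 2 * (min m 0 : ℤ))

/-- The Cauchy–Schwarz inequality with the kernel as weight, followed by an exchange of the integrals,
leaves the mass of the kernel in the set `B`. -/
lemma exists_lintegral_pconv_sq_le (n : ℕ) : ∃ C : ℝ≥0, ∀ (k : ℤ) (g : SpaceTime n → ℝ≥0∞),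
    Measurable g → ∀ B : Set (Space n), MeasurableSet B →
      ∫⁻ z in Prod.snd ⁻¹' B, pconv (n + 3) k g z ^ 2 ≤
        C * ∫⁻ z, g z ^ 2 * ∫⁻ x in B, kap n (n + 3) k (x - z.2) := by
  obtain ⟨C₀, h₀⟩ := exists_lintegral_kap_le n
  refine ⟨C₀, fun k g hg B hB => ?_⟩
  have hκ := measurable_kap n (n + 3) k
  have hp := measurable_pconv (n + 3) k hg
  have hB' : MeasurableSet (Prod.snd ⁻¹' B : Set (SpaceTime n)) := measurable_snd hB
  have hω : Measurable fun z : SpaceTime n => ∫⁻ x in B, kap n (n + 3) k (x - z.2) :=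
    Measurable.lintegral_prod_right' (f := fun p : SpaceTime n × Space n =>
      kap n (n + 3) k (p.2 - p.1.2)) (by fun_prop)
  rw [← lintegral_indicator hB', lintegral_spacetime ((hp.pow_const 2).indicator hB').aemeasurable,
    lintegral_spacetime (f := fun z => g z ^ 2 * ∫⁻ x in B, kap n (n + 3) k (x - z.2))
      (Measurable.aemeasurable (by fun_prop)),
    ← lintegral_const_mul' _ _ (by finiteness)]
  refine lintegral_mono fun t => ?_
  calc ∫⁻ x, (Prod.snd ⁻¹' B).indicator (fun z => pconv (n + 3) k g z ^ 2) (t, x)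
      = ∫⁻ x in B, pconv (n + 3) k g (t, x) ^ 2 := by
        rw [← lintegral_indicator hB]
        rfl
    _ ≤ ∫⁻ x in B, C₀ * ∫⁻ y, kap n (n + 3) k (x - y) * g (t, y) ^ 2 := by
        refine lintegral_mono fun x => ?_
        refine (lintegral_weight_mul_sq_le (Measurable.aemeasurable (by fun_prop))
          (Measurable.aemeasurable (by fun_prop))).trans ?_
        gcongr
        rw [lintegral_kap_sub_left]
        exact (lintegral_mono fun y => kap_anti (by omega) k y).trans (h₀ k)
    _ = C₀ * ∫⁻ y, (∫⁻ x in B, kap n (n + 3) k (x - y)) * g (t, y) ^ 2 := by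
        rw [lintegral_const_mul' _ _ (by finiteness), lintegral_lintegral_swap]
        · congr 1
          exact lintegral_congr fun y => lintegral_mul_const _ (by fun_prop)
        · apply Measurable.aemeasurable
          simp only [Function.uncurry_def]
          fun_prop
    _ = _ := by simp_rw [mul_comm]

lemma lintegral_pconv_congr {m : ℕ} {k : ℤ} {g h : SpaceTime n → ℝ≥0∞} (e : g =ᵐ[volume] h)
    (A : Set (SpaceTime n)) :
    ∫⁻ z in A, pconv m k g z ^ 2 = ∫⁻ z in A, pconv m k h z ^ 2 := by
  apply lintegral_congr_ae
  filter_upwards [ae_restrict_of_ae (pconv_congr_ae m k e)] with z hz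
  rw [hz]

/-- Functions of frequency `2^k`, restricted to balls: for `2^j ≥ 2^{-k}` this is the definition of
`X_k`, and for smaller balls it is Bernstein's inequality, from the ball `|x| ≤ 2^{-k}`. -/
lemma exists_pconv_cyl_le (n : ℕ) : ∃ C : ℝ≥0, ∀ (j k : ℤ) (w : SpaceTime n → ℂ),
    AEStronglyMeasurable w volume →
      ∫⁻ z in cyl n j, pconv (n + 3) k (fun z => ‖w z‖ₑ) z ^ 2 ≤
        (C * (pw (j / 2) * al n (j + k) * xkNorm k w)) ^ 2 := by
  obtain ⟨C₀, h₀⟩ := exists_lintegral_pconv_sq_le n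
  obtain ⟨C₁, h₁⟩ := exists_lintegral_ball_kap_le n
  obtain ⟨C₂, h₂⟩ := exists_lintegral_wgt_le n
  -- adding `1` makes the constant at most its own square
  refine ⟨C₀ * C₁ * C₂ + 1, fun j k w hw => ?_⟩
  have he : (fun z => ‖w z‖ₑ) =ᵐ[volume] fun z => ‖hw.mk w z‖ₑ := by
    filter_upwards [hw.ae_eq_mk] with z hz; rw [hz]
  have hB : cyl n j = Prod.snd ⁻¹' (Metric.closedBall (0 : Space n) ((2 : ℝ) ^ j)) := by
    ext z; simp [cyl]
  rw [lintegral_pconv_congr he, hB]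
  refine (h₀ k _ hw.stronglyMeasurable_mk.enorm _ measurableSet_closedBall).trans ?_
  calc C₀ * ∫⁻ z, ‖hw.mk w z‖ₑ ^ 2 *
        ∫⁻ x in Metric.closedBall (0 : Space n) ((2 : ℝ) ^ j), kap n (n + 3) k (x - z.2)
      ≤ C₀ * ∫⁻ z, C₁ * pw (n * (min (j + k) 0 : ℤ)) * (‖w z‖ₑ ^ 2 * wgt n (min k (-j)) z.2) := by
        refine mul_le_mul' le_rfl ?_
        apply lintegral_mono_ae
        filter_upwards [he] with z hz
        rw [← hz, mul_left_comm]
        gcongr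
        exact h₁ j k z.2
    _ = C₀ * (C₁ * pw (n * (min (j + k) 0 : ℤ)) * ∫⁻ z, ‖w z‖ₑ ^ 2 * wgt n (min k (-j)) z.2) := by
        rw [lintegral_const_mul' _ _ (ENNReal.mul_ne_top (by finiteness) (pw_ne_top _))]
    _ ≤ C₀ * (C₁ * pw (n * (min (j + k) 0 : ℤ)) *
        (C₂ * pw (-(min k (-j) : ℤ)) * xkNorm k w ^ 2)) := by
        gcongr; exact h₂ k _ (min_le_left _ _) w
    _ = C₀ * C₁ * C₂ * (pw (n * (min (j + k) 0 : ℤ)) * pw (-(min k (-j) : ℤ))) *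
          xkNorm k w ^ 2 := by ring
    _ = C₀ * C₁ * C₂ * (pw (2 * (j / 2)) * pw (2 * (((n : ℝ) - 1) / 2 * (min (j + k) 0 : ℤ)))) *
          xkNorm k w ^ 2 := by
        rw [← pw_add, ← pw_add]
        congr 3
        have : (min k (-j) : ℤ) = min (j + k) 0 - j := by omega
        rw [this]; push_cast; ring
    _ = C₀ * C₁ * C₂ * (pw (j / 2) * al n (j + k) * xkNorm k w) ^ 2 := by
        rw [← pw_sq, ← pw_sq]; unfold al; ring
    _ ≤ (((C₀ * C₁ * C₂ + 1 : ℝ≥0) : ℝ≥0∞) * (pw (j / 2) * al n (j + k) * xkNorm k w)) ^ 2 := by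
        rw [mul_pow _ (pw (j / 2) * al n (j + k) * xkNorm k w)]
        refine mul_le_mul' ?_ le_rfl
        exact_mod_cast show C₀ * C₁ * C₂ ≤ (C₀ * C₁ * C₂ + 1) ^ 2 by
          have : 0 ≤ C₀ * C₁ * C₂ := zero_le
          nlinarith

/-- Young's inequality. -/
lemma exists_lintegral_pconv_le (n : ℕ) : ∃ C : ℝ≥0, ∀ (k : ℤ) (g : SpaceTime n → ℝ≥0∞),
    AEMeasurable g → ∫⁻ z, pconv (n + 3) k g z ^ 2 ≤ C * ∫⁻ z, g z ^ 2 := by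
  obtain ⟨C₀, h₀⟩ := exists_lintegral_pconv_sq_le n
  obtain ⟨C₁, h₁⟩ := exists_lintegral_kap_le n
  refine ⟨C₀ * C₁, fun k g hg => ?_⟩
  have h := h₀ k _ hg.measurable_mk _ MeasurableSet.univ
  rw [← lintegral_pconv_congr hg.ae_eq_mk] at h
  simp only [Set.preimage_univ, Measure.restrict_univ] at h
  refine h.trans ?_
  rw [ENNReal.coe_mul, mul_assoc, ← lintegral_const_mul' (C₁ : ℝ≥0∞) _ (by finiteness)]
  refine mul_le_mul' le_rfl (lintegral_mono_ae ?_)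
  filter_upwards [hg.ae_eq_mk] with z hz
  rw [← hz, mul_comm]
  refine mul_le_mul' ?_ le_rfl
  rw [lintegral_kap_sub_right]
  exact (lintegral_mono fun y => kap_anti (by omega) k y).trans (h₁ k)

/-! ### Convolution in the spatial variable -/

/-- Convolution in the spatial variable with a kernel `K`. -/
def cv (K : Space n → ℂ) (f : SpaceTime n → ℂ) (z : SpaceTime n) : ℂ :=
  ∫ y, K y * f (z.1, z.2 - y)

/-- The kernel `2^{kn} Φ(2^k y)` of the Fourier multiplier with symbol `Φ̂(2^{-k} ξ)`. -/
def sc (Φ : 𝓢(Space n, ℂ)) (k : ℤ) : 𝓢(Space n, ℂ) :=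
  (((2 : ℝ) ^ k) ^ n) • compCLMOfContinuousLinearEquiv ℝ
    (ContinuousLinearEquiv.smulLeft (Units.mk0 ((2 : ℝ) ^ k) (by positivity)) :
      Space n ≃L[ℝ] Space n) Φ

lemma sc_apply (Φ : 𝓢(Space n, ℂ)) (k : ℤ) (y : Space n) :
    sc Φ k y = (((2 : ℝ) ^ k) ^ n) • Φ ((2 : ℝ) ^ k • y) := by
  simp [sc, Units.smul_def]

/-- The class of functions to which all convolutions with Schwartz kernels apply: measurable, and
bounded on each time slice, with a bound that may depend on the time. -/
structure Tame (f : SpaceTime n → ℂ) : Prop where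
  meas : Measurable f
  bdd : ∀ t, ∃ M : ℝ, ∀ x, ‖f (t, x)‖ ≤ M

lemma Tame.aesm {f : SpaceTime n → ℂ} (hf : Tame f) : AEStronglyMeasurable f volume :=
  hf.meas.aestronglyMeasurable

lemma Tame.slice {f : SpaceTime n → ℂ} (hf : Tame f) (t : ℝ) : Measurable fun x => f (t, x) :=
  hf.meas.comp (by fun_prop)

lemma Tame.mul {f g : SpaceTime n → ℂ} (hf : Tame f) (hg : Tame g) : Tame fun z => f z * g z := by
  refine ⟨hf.meas.mul hg.meas, fun t => ?_⟩
  obtain ⟨M, hM⟩ := hf.bdd t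
  obtain ⟨N, hN⟩ := hg.bdd t
  refine ⟨M * N, fun x => ?_⟩
  rw [norm_mul]
  exact mul_le_mul (hM x) (hN x) (norm_nonneg _) ((norm_nonneg _).trans (hM x))

lemma Tame.add {f g : SpaceTime n → ℂ} (hf : Tame f) (hg : Tame g) : Tame fun z => f z + g z := by
  refine ⟨hf.meas.add hg.meas, fun t => ?_⟩
  obtain ⟨M, hM⟩ := hf.bdd t
  obtain ⟨N, hN⟩ := hg.bdd t
  exact ⟨M + N, fun x => (norm_add_le _ _).trans (add_le_add (hM x) (hN x))⟩

lemma Tame.zero : Tame fun _ : SpaceTime n => (0 : ℂ) :=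
  ⟨measurable_const, fun _ => ⟨0, fun _ => by simp⟩⟩

lemma Tame.const_mul {f : SpaceTime n → ℂ} (c : ℂ) (hf : Tame f) : Tame fun z => c * f z := by
  refine ⟨hf.meas.const_mul c, fun t => ?_⟩
  obtain ⟨M, hM⟩ := hf.bdd t
  exact ⟨‖c‖ * M, fun x => by rw [norm_mul]; gcongr; exact hM x⟩

lemma Tame.sum {ι : Type*} {F : Finset ι} {f : ι → SpaceTime n → ℂ} (hf : ∀ i ∈ F, Tame (f i)) :
    Tame fun z => ∑ i ∈ F, f i z := by
  classical
  induction F using Finset.induction_on with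
  | empty => simpa using Tame.zero
  | insert a s ha ih =>
    simp only [Finset.sum_insert ha]
    exact (hf a (by simp)).add (ih fun i hi => hf i (by simp [hi]))

lemma integrable_mul_slice {f : Space n → ℂ} (hf : Measurable f) {M : ℝ} (hM : ∀ x, ‖f x‖ ≤ M)
    {K : Space n → ℂ} (hK : Integrable K) (x : Space n) :
    Integrable fun y => K y * f (x - y) :=
  hK.mul_bdd (c := M) (hf.comp (by fun_prop)).aestronglyMeasurable
    (Eventually.of_forall fun y => hM _)

lemma Tame.integrable {f : SpaceTime n → ℂ} (hf : Tame f) {K : Space n → ℂ} (hK : Integrable K)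
    (z : SpaceTime n) : Integrable fun y => K y * f (z.1, z.2 - y) :=
  let ⟨_, hM⟩ := hf.bdd z.1
  integrable_mul_slice (hf.slice z.1) hM hK z.2

lemma cv_eq (K : Space n → ℂ) (f : SpaceTime n → ℂ) (z : SpaceTime n) :
    cv K f z = ∫ y, K (z.2 - y) * f (z.1, y) := by
  rw [cv, ← integral_sub_left_eq_self _ _ z.2]
  simp

lemma cv_congr_ae (K : Space n → ℂ) {f g : SpaceTime n → ℂ} (h : f =ᵐ[volume] g) :
    cv K f =ᵐ[volume] cv K g := by
  filter_upwards [ae_of_ae_time (ae_slice h)] with z hz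
  rw [cv_eq, cv_eq]
  apply integral_congr_ae
  filter_upwards [hz] with y hy
  rw [hy]

lemma measurable_cv {K : Space n → ℂ} (hK : Measurable K) {f : SpaceTime n → ℂ}
    (hf : Measurable f) : Measurable (cv K f) := by
  have : StronglyMeasurable fun p : SpaceTime n × Space n => K p.2 * f (p.1.1, p.1.2 - p.2) :=
    Measurable.stronglyMeasurable (by fun_prop)
  exact this.integral_prod_right'.measurable

lemma aestronglyMeasurable_cv {K : Space n → ℂ} (hK : Measurable K) {f : SpaceTime n → ℂ}
    (hf : AEStronglyMeasurable f volume) : AEStronglyMeasurable (cv K f) volume :=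
  ((measurable_cv hK hf.stronglyMeasurable_mk.measurable).aestronglyMeasurable).congr
    (cv_congr_ae K hf.ae_eq_mk.symm)

lemma tame_cv {K : Space n → ℂ} (hKm : Measurable K) (hK : Integrable K) {f : SpaceTime n → ℂ}
    (hf : Tame f) : Tame (cv K f) := by
  refine ⟨measurable_cv hKm hf.meas, fun t => ?_⟩
  obtain ⟨M, hM⟩ := hf.bdd t
  refine ⟨(∫ y, ‖K y‖) * M, fun x => ?_⟩
  rw [← integral_mul_const]
  refine norm_integral_le_of_norm_le (hK.norm.mul_const M) (Eventually.of_forall fun y => ?_)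
  rw [norm_mul]
  gcongr
  exact hM _

lemma Tame.cv {f : SpaceTime n → ℂ} (hf : Tame f) (K : 𝓢(Space n, ℂ)) : Tame (cv K f) :=
  tame_cv K.continuous.measurable K.integrable hf

lemma cv_add {f g : SpaceTime n → ℂ} (hf : Tame f) (hg : Tame g) (K : 𝓢(Space n, ℂ))
    (z : SpaceTime n) : cv K (fun z => f z + g z) z = cv K f z + cv K g z := by
  unfold LocEnergy.cv
  rw [← integral_add (hf.integrable K.integrable z) (hg.integrable K.integrable z)]
  simp_rw [mul_add]

lemma cv_const_mul (c : ℂ) (f : SpaceTime n → ℂ) (K : Space n → ℂ)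
    (z : SpaceTime n) : cv K (fun z => c * f z) z = c * cv K f z := by
  unfold cv
  rw [← integral_const_mul]
  congr 1 with y
  ring

lemma cv_sum {ι : Type*} {F : Finset ι} {f : ι → SpaceTime n → ℂ} (hf : ∀ i ∈ F, Tame (f i))
    (K : 𝓢(Space n, ℂ)) (z : SpaceTime n) :
    cv K (fun z => ∑ i ∈ F, f i z) z = ∑ i ∈ F, cv K (f i) z := by
  unfold cv
  rw [← integral_finsetSum _ fun i hi => (hf i hi).integrable K.integrable z]
  simp_rw [Finset.mul_sum]

lemma cv_kernel_sum {ι : Type*} {F : Finset ι} {f : SpaceTime n → ℂ} (hf : Tame f)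
    (K : ι → 𝓢(Space n, ℂ)) (z : SpaceTime n) :
    cv (∑ i ∈ F, K i : 𝓢(Space n, ℂ)) f z = ∑ i ∈ F, cv (K i) f z := by
  unfold cv
  rw [← integral_finsetSum _ fun i _ => hf.integrable (K i).integrable z]
  simp_rw [sum_apply, Finset.sum_mul]

lemma cv_kernel_smul (c : ℝ) (f : SpaceTime n → ℂ) (K : 𝓢(Space n, ℂ)) (z : SpaceTime n) :
    cv (c • K : 𝓢(Space n, ℂ)) f z = c * cv K f z := by
  unfold cv
  rw [← integral_const_mul]
  congr 1 with y
  simp [mul_assoc]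

lemma cv_cv {K L M : 𝓢(Space n, ℂ)} (h : ∀ x, M x = ∫ y, K y * L (x - y)) {f : SpaceTime n → ℂ}
    (hf : Tame f) : cv K (cv L f) = cv M f := by
  ext z
  have e1 : ∀ y, cv L f (z.1, z.2 - y) = ∫ u, L (u - y) * f (z.1, z.2 - u) := fun y => by
    unfold cv
    rw [← integral_sub_right_eq_self _ y]
    simp
  have hI : Integrable (Function.uncurry fun u y : Space n => K y * L (u - y) * f (z.1, z.2 - u))
      (volume.prod volume) := by
    obtain ⟨c, hc⟩ := hf.bdd z.1
    have := K.integrable (μ := volume).convolution_integrand (ContinuousLinearMap.mul ℂ ℂ)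
      (L.integrable (μ := volume))
    refine Integrable.mul_bdd (c := c) this ?_ (Eventually.of_forall fun y => hc _)
    exact ((hf.slice z.1).comp (by fun_prop : Measurable fun p : Space n × Space n =>
      z.2 - p.1)).aestronglyMeasurable
  calc cv K (cv L f) z = ∫ y, ∫ u, K y * L (u - y) * f (z.1, z.2 - u) := by
        unfold cv at *
        congr 1 with y
        rw [e1, ← integral_const_mul]
        simp_rw [mul_assoc]
    _ = ∫ u, ∫ y, K y * L (u - y) * f (z.1, z.2 - u) := (integral_integral_swap hI).symm
    _ = _ := by
        unfold cv
        congr 1 with u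
        rw [integral_mul_const, h]

lemma schwartz_decay {F : Type*} [NormedAddCommGroup F] [NormedSpace ℝ F]
    (f : 𝓢(Space n, F)) (m : ℕ) : ∃ C : ℝ≥0, ∀ x, ‖f x‖ ≤ C * ((1 + ‖x‖) ^ m)⁻¹ := by
  have h := fun x => one_add_le_sup_seminorm_apply (𝕜 := ℝ) (m := (m, 0)) (k := m) (n := 0)
    le_rfl le_rfl f x
  simp only [norm_iteratedFDeriv_zero] at h
  refine ⟨⟨_, (by positivity : 0 ≤ 2 ^ m * ((Finset.Iic (m, 0)).sup fun m =>
    SchwartzMap.seminorm ℝ m.1 m.2) f)⟩, fun x => ?_⟩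
  have : 0 < (1 + ‖x‖) ^ m := by positivity
  rw [← div_eq_mul_inv, le_div_iff₀ this, mul_comm]
  exact h x

lemma exists_enorm_sc_le (Φ : 𝓢(Space n, ℂ)) (m : ℕ) :
    ∃ C : ℝ≥0, ∀ k y, ‖sc Φ k y‖ₑ ≤ C * kap n m k y := by
  obtain ⟨C, hC⟩ := schwartz_decay Φ m
  refine ⟨C, fun k y => ?_⟩
  have h := hC ((2 : ℝ) ^ k • y)
  rw [norm_smul, Real.norm_of_nonneg (by positivity)] at h
  rw [← ofReal_norm, sc_apply, norm_smul, Real.norm_of_nonneg (by positivity), kap,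
    ← ENNReal.ofReal_coe_nnreal, ← ENNReal.ofReal_mul (by positivity)]
  apply ENNReal.ofReal_le_ofReal
  calc _ ≤ ((2 : ℝ) ^ k) ^ n * (C * ((1 + (2 : ℝ) ^ k * ‖y‖) ^ m)⁻¹) := by gcongr
    _ = _ := by ring

lemma exists_cv_sc_le (Φ : 𝓢(Space n, ℂ)) (m : ℕ) :
    ∃ C : ℝ≥0, ∀ k f z, ‖cv (sc Φ k) f z‖ₑ ≤ C * pconv m k (fun z => ‖f z‖ₑ) z := by
  obtain ⟨C, hC⟩ := exists_enorm_sc_le Φ m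
  refine ⟨C, fun k f z => ?_⟩
  rw [cv_eq, pconv, ← lintegral_const_mul' _ _ (by finiteness)]
  refine (enorm_integral_le_lintegral_enorm _).trans (lintegral_mono fun y => ?_)
  rw [enorm_mul, ← mul_assoc]
  gcongr
  exact hC _ _

/-! ### Spatial derivatives and integration by parts -/

/-- The derivative of `g` in the spatial direction `e`. -/
def dx (e : Space n) (g : SpaceTime n → ℂ) (z : SpaceTime n) : ℂ :=
  lineDeriv ℝ (fun x => g (z.1, x)) z.2 e

lemma dx_eq_lineDeriv (e : Space n) (g : SpaceTime n → ℂ) (z : SpaceTime n) :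
    dx e g z = lineDeriv ℝ g z (0, e) := by
  obtain ⟨t, x⟩ := z
  simp [dx, lineDeriv]

/-- The slices of `g` at fixed time are Lipschitz. -/
def LipSlices (g : SpaceTime n → ℂ) : Prop := ∀ t, ∃ C : ℝ≥0, LipschitzWith C fun x => g (t, x)

lemma tame_dx (e : Space n) {g : SpaceTime n → ℂ} (hg : Continuous g) (hL : LipSlices g) :
    Tame (dx e g) := by
  refine ⟨?_, fun t => ?_⟩
  · rw [funext (dx_eq_lineDeriv e g)]
    exact measurable_lineDeriv hg
  · obtain ⟨C, hC⟩ := hL t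
    exact ⟨C * ‖e‖, fun x => norm_lineDeriv_le_of_lipschitz ℝ hC⟩

lemma lipschitz_of_fderiv_bdd {f : Space n → ℂ} {C : ℝ} (hf : Differentiable ℝ f)
    (h : ∀ x, ‖fderiv ℝ f x‖ ≤ C) : LipschitzWith C.toNNReal f :=
  lipschitzWith_of_nnnorm_fderiv_le hf fun x => by
    rw [← norm_toNNReal]; exact Real.toNNReal_le_toNNReal (h x)

lemma schwartz_lipschitz (K : 𝓢(Space n, ℂ)) : ∃ C, LipschitzWith C K := by
  obtain ⟨C, hC⟩ := schwartz_decay (fderivCLM ℝ (Space n) ℂ K) 0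
  refine ⟨_, lipschitz_of_fderiv_bdd (C := C) K.differentiable fun x => ?_⟩
  simpa using hC x

/-- Derivatives of a convolution fall on the kernel. -/
lemma hasFDerivAt_cv (K : 𝓢(Space n, ℂ)) {f : SpaceTime n → ℂ} (hf : Tame f) (t : ℝ)
    (x₀ : Space n) : HasFDerivAt (fun x => cv K f (t, x))
      (∫ y, f (t, y) • fderiv ℝ K (x₀ - y)) x₀ := by
  obtain ⟨M, hM⟩ := hf.bdd t
  obtain ⟨C, hC⟩ := schwartz_decay (fderivCLM ℝ (Space n) ℂ K) (n + 1)
  have hM0 : 0 ≤ M := (norm_nonneg _).trans (hM 0)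
  simp only [fderivCLM_apply] at hC
  have hI : Integrable (fun y : Space n => ((1 + ‖y‖) ^ (n + 1))⁻¹) := by
    have := integrable_one_add_norm (E := Space n) (μ := volume) (r := (n : ℝ) + 1)
      (by simp)
    refine this.congr (Eventually.of_forall fun y => ?_)
    have : 0 < 1 + ‖y‖ := by positivity
    simp only []
    rw [Real.rpow_neg this.le]
    norm_cast
  have hsm := hf.slice t
  have hcf : Continuous (fun z : Space n => fderiv ℝ K z) :=
    (fderivCLM ℝ (Space n) ℂ K).continuous
  simp_rw [cv_eq]
  refine hasFDerivAt_integral_of_dominated_of_fderiv_le (F := fun x y => K (x - y) * f (t, y))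
    (F' := fun x y => f (t, y) • fderiv ℝ K (x - y)) (s := Metric.ball x₀ 1)
    (bound := fun y => M * (C * 2 ^ (n + 1)) * ((1 + ‖x₀ - y‖) ^ (n + 1))⁻¹)
    (Metric.ball_mem_nhds _ one_pos) ?_ ?_ ?_ ?_ ?_ ?_
  · refine Eventually.of_forall fun x => Measurable.aestronglyMeasurable ?_
    exact (K.continuous.comp (by fun_prop : Continuous fun y => x - y)).measurable.mul hsm
  · have := (hf.integrable K.integrable (t, x₀)).comp_sub_left x₀
    simpa using this
  · exact hsm.aestronglyMeasurable.smul
      (hcf.comp (by fun_prop : Continuous fun y => x₀ - y)).aestronglyMeasurable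
  · refine Eventually.of_forall fun y x hx => ?_
    rw [norm_smul, mul_assoc]
    gcongr
    · exact hM y
    · refine (hC _).trans ?_
      rw [mul_assoc]
      gcongr
      rw [← div_eq_mul_inv, inv_eq_one_div, div_le_div_iff₀ (by positivity) (by positivity),
        one_mul, ← mul_pow]
      gcongr
      have h1 : ‖x₀ - y‖ ≤ ‖x₀ - x‖ + ‖x - y‖ := norm_sub_le_norm_sub_add_norm_sub _ _ _
      have h2 : ‖x₀ - x‖ < 1 := by rw [norm_sub_rev, ← dist_eq_norm]; exact hx
      have h3 := norm_nonneg (x - y)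
      linarith
  · exact (hI.comp_sub_left x₀).const_mul _
  · refine Eventually.of_forall fun y x _ => ?_
    have h1 : HasFDerivAt (fun x => K (x - y)) (fderiv ℝ K (x - y)) x := by
      exact (K.hasFDerivAt (x - y)).comp x ((hasFDerivAt_id x).sub_const y)
    exact h1.mul_const (f (t, y))

lemma integrable_smul_fderiv (K : 𝓢(Space n, ℂ)) {f : SpaceTime n → ℂ} (hf : Tame f) (t : ℝ)
    (x : Space n) : Integrable fun y => f (t, y) • fderiv ℝ K (x - y) := by
  obtain ⟨M, hM⟩ := hf.bdd t
  have h := ((fderivCLM ℝ (Space n) ℂ K).integrable (μ := volume)).comp_sub_left x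
  simp only [fderivCLM_apply] at h
  exact h.bdd_smul M (hf.slice t).aestronglyMeasurable (Eventually.of_forall hM)

lemma dx_cv (K : 𝓢(Space n, ℂ)) {f : SpaceTime n → ℂ} (hf : Tame f) (e : Space n) :
    dx e (cv K f) = cv (∂_{e} K : 𝓢(Space n, ℂ)) f := by
  ext ⟨t, x⟩
  rw [dx, ((hasFDerivAt_cv K hf t x).hasLineDerivAt e).lineDeriv, cv_eq,
    ContinuousLinearMap.integral_apply (integrable_smul_fderiv K hf t x)]
  congr 1 with y
  rw [lineDerivOp_apply_eq_fderiv]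
  simp [mul_comm]

lemma lipSlices_cv (K : 𝓢(Space n, ℂ)) {f : SpaceTime n → ℂ} (hf : Tame f) :
    LipSlices (cv K f) := by
  intro t
  obtain ⟨M, hM⟩ := hf.bdd t
  refine ⟨_, lipschitz_of_fderiv_bdd (C := M * ∫ y, ‖fderiv ℝ K y‖)
    (fun x => (hasFDerivAt_cv K hf t x).differentiableAt) fun x => ?_⟩
  rw [(hasFDerivAt_cv K hf t x).fderiv, ← integral_const_mul,
    ← integral_sub_left_eq_self (fun y => M * ‖fderiv ℝ K y‖) volume x]
  have h := ((fderivCLM ℝ (Space n) ℂ K).integrable (μ := volume)).comp_sub_left x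
  simp only [fderivCLM_apply] at h
  refine norm_integral_le_of_norm_le (h.norm.const_mul M) (Eventually.of_forall fun y => ?_)
  rw [norm_smul]
  gcongr
  exact hM y

/-- The derivative of a compactly supported Lipschitz function has integral zero. -/
lemma integral_lineDeriv_eq_zero {h : Space n → ℂ} {C : ℝ≥0} (hh : LipschitzWith C h)
    (hc : HasCompactSupport h) (e : Space n) : ∫ y, lineDeriv ℝ h y e = 0 := by
  have key : ∀ L : ℂ →L[ℝ] ℝ, L (∫ y, lineDeriv ℝ h y e) = 0 := by
    intro L
    have hI : Integrable fun y => lineDeriv ℝ h y e := by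
      have hb : IsCompact (tsupport h) := hc
      have h0 : ∀ y ∉ tsupport h, lineDeriv ℝ h y e = 0 := by
        intro y hy
        have : h =ᶠ[𝓝 y] fun _ => 0 := notMem_tsupport_iff_eventuallyEq.1 hy
        rw [this.lineDeriv_eq]
        simp [lineDeriv]
      rw [← integrableOn_iff_integrable_of_support_subset (s := tsupport h)]
      · refine Measure.integrableOn_of_bounded (M := C * ‖e‖) hb.measure_lt_top.ne ?_ ?_
        · exact (measurable_lineDeriv hh.continuous).aestronglyMeasurable
        · exact Eventually.of_forall fun y => norm_lineDeriv_le_of_lipschitz ℝ hh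
      · intro y hy
        by_contra hy'
        exact hy (h0 y hy')
    rw [← ContinuousLinearMap.integral_comp_comm L hI]
    have hL : LipschitzWith (‖L‖₊ * C) (L ∘ h) := L.lipschitz.comp hh
    have hcL : HasCompactSupport (L ∘ h) := hc.comp_left (map_zero L)
    have h1 := LipschitzWith.integral_lineDeriv_mul_eq (μ := volume)
      (LipschitzWith.const (α := Space n) (1 : ℝ)) hL hcL (-e)
    simp only [mul_one, neg_neg] at h1
    have h2 : ∫ y, L (lineDeriv ℝ h y e) = ∫ y, lineDeriv ℝ (L ∘ h) y e := ?_
    · rw [h2, ← h1]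
      simp [lineDeriv]
    apply integral_congr_ae
    filter_upwards [hh.ae_differentiableAt (μ := volume)] with y hy
    exact (((L.hasFDerivAt.comp y hy.hasFDerivAt).hasLineDerivAt e).lineDeriv.trans (by
      rw [(hy.hasFDerivAt.hasLineDerivAt e).lineDeriv]; rfl)).symm
  apply Complex.ext
  · exact key Complex.reCLM
  · exact key Complex.imCLM

lemma lipschitz_mul {f g : Space n → ℂ} {A B : ℝ≥0} {M N : ℝ} (hf : LipschitzWith A f)
    (hg : LipschitzWith B g) (hM : ∀ x, ‖f x‖ ≤ M) (hN : ∀ x, ‖g x‖ ≤ N) :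
    ∃ C, LipschitzWith C fun x => f x * g x := by
  refine ⟨(M * B + A * N).toNNReal, LipschitzWith.of_dist_le' fun x y => ?_⟩
  have hM0 : 0 ≤ M := (norm_nonneg _).trans (hM 0)
  rw [dist_eq_norm]
  calc ‖f x * g x - f y * g y‖ = ‖f x * (g x - g y) + (f x - f y) * g y‖ := by ring_nf
    _ ≤ ‖f x‖ * ‖g x - g y‖ + ‖f x - f y‖ * ‖g y‖ := by
        refine (norm_add_le _ _).trans ?_
        rw [norm_mul, norm_mul]
    _ ≤ M * (B * dist x y) + (A * dist x y) * N := by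
        rw [← dist_eq_norm, ← dist_eq_norm]
        gcongr
        · exact hM x
        · exact hg.dist_le_mul x y
        · exact hf.dist_le_mul x y
        · exact hN y
    _ = _ := by ring

lemma bdd_of_lipschitz_compact {g : Space n → ℂ} {A : ℝ≥0} (hg : LipschitzWith A g)
    (hc : HasCompactSupport g) : ∃ N, ∀ x, ‖g x‖ ≤ N :=
  hg.continuous.bounded_above_of_compact_support hc

/-- Integration by parts for functions that are Lipschitz with compact support in `x`. -/
lemma cv_dx (K : 𝓢(Space n, ℂ)) (e : Space n) {g : SpaceTime n → ℂ}
    (hL : LipSlices g) (hc : ∀ t, HasCompactSupport fun x => g (t, x)) :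
    cv K (dx e g) = cv (∂_{e} K : 𝓢(Space n, ℂ)) g := by
  ext z
  obtain ⟨t, x⟩ := z
  obtain ⟨A, hA⟩ := hL t
  obtain ⟨N, hN⟩ := bdd_of_lipschitz_compact hA (hc t)
  obtain ⟨B, hB⟩ := schwartz_lipschitz K
  obtain ⟨M, hM⟩ := schwartz_decay K 0
  have hgl : LipschitzWith A fun y => g (t, x - y) :=
    LipschitzWith.of_dist_le_mul fun a b => by
      have := hA.dist_le_mul (x - a) (x - b)
      rwa [dist_sub_left] at this
  have hgc : HasCompactSupport fun y => g (t, x - y) :=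
    (hc t).comp_homeomorph (Homeomorph.subLeft x)
  obtain ⟨C, hC⟩ := lipschitz_mul hB hgl (fun y => by simpa using hM y) (fun y => hN _)
  have h0 := integral_lineDeriv_eq_zero hC (hgc.mul_left) e
  have hd : ∀ᵐ y : Space n, DifferentiableAt ℝ (fun y => g (t, y)) (x - y) :=
    (Measure.measurePreserving_sub_left volume x).quasiMeasurePreserving.ae hA.ae_differentiableAt
  have h1 : ∀ᵐ y : Space n, lineDeriv ℝ (fun y => K y * g (t, x - y)) y e =
      (∂_{e} K : 𝓢(Space n, ℂ)) y * g (t, x - y) - K y * dx e g (t, x - y) := by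
    filter_upwards [hd] with y hy
    have e1 : HasFDerivAt (fun y => g (t, x - y)) (-(fderiv ℝ (fun y => g (t, y)) (x - y))) y := by
      have := hy.hasFDerivAt.comp y ((hasFDerivAt_id y).const_sub x)
      refine this.congr_fderiv ?_
      ext v; simp
    rw [(((K.hasFDerivAt y).fun_mul e1).hasLineDerivAt e).lineDeriv, dx,
      (hy.hasFDerivAt.hasLineDerivAt e).lineDeriv, lineDerivOp_apply_eq_fderiv]
    simp
    ring
  rw [integral_congr_ae h1, integral_sub
    (integrable_mul_slice hA.continuous.measurable hN (∂_{e} K : 𝓢(Space n, ℂ)).integrable x)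
    (integrable_mul_slice (f := fun x => dx e g (t, x)) (measurable_lineDeriv hA.continuous)
      (fun x => norm_lineDeriv_le_of_lipschitz ℝ hA) K.integrable x), sub_eq_zero] at h0
  exact h0.symm

/-- The product rule, under a convolution. -/
lemma cv_dx_mul (K : 𝓢(Space n, ℂ)) (e : Space n) {β w : SpaceTime n → ℂ}
    (hβL : LipSlices β) (hβT : Tame β) (hβd : Tame (dx e β)) (hwL : LipSlices w) (hwT : Tame w)
    (hwd : Tame (dx e w)) (z : SpaceTime n) :
    cv K (dx e fun z => β z * w z) z =
      cv K (fun z => dx e β z * w z) z + cv K (fun z => β z * dx e w z) z := by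
  rw [← cv_add (hβd.mul hwT) (hβT.mul hwd), cv_eq, cv_eq]
  obtain ⟨A, hA⟩ := hβL z.1
  obtain ⟨B, hB⟩ := hwL z.1
  apply integral_congr_ae
  filter_upwards [hA.ae_differentiableAt (μ := volume), hB.ae_differentiableAt (μ := volume)] with
    y h1 h2
  simp only [dx]
  rw [((h1.hasFDerivAt.fun_mul h2.hasFDerivAt).hasLineDerivAt e).lineDeriv,
    (h1.hasFDerivAt.hasLineDerivAt e).lineDeriv, (h2.hasFDerivAt.hasLineDerivAt e).lineDeriv]
  simp
  left
  ring

/-! ### Bounds in `L²` and duality for frequency localized functions -/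

lemma lintegral_mul_le_eLpNorm {A : Set (SpaceTime n)} {f g : SpaceTime n → ℂ}
    (hf : AEStronglyMeasurable f volume) (hg : AEStronglyMeasurable g volume) :
    ∫⁻ z in A, ‖f z‖ₑ * ‖g z‖ₑ ≤
      eLpNorm f 2 (volume.restrict A) * eLpNorm g 2 (volume.restrict A) := by
  apply le_of_sq_le_sq
  rw [mul_pow, eLpNorm_two_sq, eLpNorm_two_sq]
  exact lintegral_mul_sq_le hf.restrict.enorm hg.restrict.enorm

/-- Bernstein's inequality in the spaces `X_k`, see `exists_pconv_cyl_le`. -/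
lemma exists_eLpNorm_cyl_cv_le (Φ : 𝓢(Space n, ℂ)) : ∃ C : ℝ≥0, ∀ (j k : ℤ)
    (w : SpaceTime n → ℂ), AEStronglyMeasurable w volume →
      eLpNorm (cv (sc Φ k) w) 2 (volume.restrict (cyl n j)) ≤
        C * (pw (j / 2) * al n (j + k) * xkNorm k w) := by
  obtain ⟨C₀, h₀⟩ := exists_cv_sc_le Φ (n + 3)
  obtain ⟨C₁, h₁⟩ := exists_pconv_cyl_le n
  refine ⟨C₀ * C₁, fun j k w hw => ?_⟩
  apply le_of_sq_le_sq
  rw [eLpNorm_two_sq]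
  calc ∫⁻ z in cyl n j, ‖cv (sc Φ k) w z‖ₑ ^ 2
      ≤ ∫⁻ z in cyl n j, C₀ ^ 2 * pconv (n + 3) k (fun z => ‖w z‖ₑ) z ^ 2 := by
        refine lintegral_mono fun z => ?_
        rw [← mul_pow]
        gcongr
        exact h₀ k w z
    _ = C₀ ^ 2 * ∫⁻ z in cyl n j, pconv (n + 3) k (fun z => ‖w z‖ₑ) z ^ 2 :=
        lintegral_const_mul' _ _ (by finiteness)
    _ ≤ C₀ ^ 2 * (C₁ * (pw (j / 2) * al n (j + k) * xkNorm k w)) ^ 2 := by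
        gcongr; exact h₁ j k w hw
    _ = _ := by push_cast; ring

lemma exists_eLpNorm_cv_le (Φ : 𝓢(Space n, ℂ)) : ∃ C : ℝ≥0, ∀ (k : ℤ)
    (f : SpaceTime n → ℂ), AEStronglyMeasurable f volume →
      eLpNorm (cv (sc Φ k) f) 2 volume ≤ C * eLpNorm f 2 volume := by
  obtain ⟨C₀, h₀⟩ := exists_cv_sc_le Φ (n + 3)
  obtain ⟨C₁, h₁⟩ := exists_lintegral_pconv_le n
  refine ⟨C₀ * (C₁ + 1), fun k f hf => ?_⟩
  apply le_of_sq_le_sq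
  rw [mul_pow, eLpNorm_two_sq, eLpNorm_two_sq]
  calc ∫⁻ z, ‖cv (sc Φ k) f z‖ₑ ^ 2
      ≤ ∫⁻ z, C₀ ^ 2 * pconv (n + 3) k (fun z => ‖f z‖ₑ) z ^ 2 := by
        refine lintegral_mono fun z => ?_
        rw [← mul_pow]
        gcongr
        exact h₀ k f z
    _ = C₀ ^ 2 * ∫⁻ z, pconv (n + 3) k (fun z => ‖f z‖ₑ) z ^ 2 :=
        lintegral_const_mul' _ _ (by finiteness)
    _ ≤ C₀ ^ 2 * (C₁ * ∫⁻ z, ‖f z‖ₑ ^ 2) := by gcongr; exact h₁ k _ hf.enorm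
    _ ≤ C₀ ^ 2 * ((C₁ + 1) ^ 2 * ∫⁻ z, ‖f z‖ₑ ^ 2) := by
        refine mul_le_mul' le_rfl (mul_le_mul' ?_ le_rfl)
        exact_mod_cast show C₁ ≤ (C₁ + 1) ^ 2 by
          have : 0 ≤ C₁ := zero_le
          nlinarith
    _ = _ := by push_cast; ring

lemma memLp_cv (Φ : 𝓢(Space n, ℂ)) (k : ℤ) {f : SpaceTime n → ℂ} (hf : MemLp f 2 volume) :
    MemLp (cv (sc Φ k) f) 2 volume := by
  obtain ⟨C, hC⟩ := exists_eLpNorm_cv_le Φ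
  exact ⟨aestronglyMeasurable_cv (sc Φ k).continuous.measurable hf.1,
    (hC k f hf.1).trans_lt (ENNReal.mul_lt_top (by finiteness) hf.2)⟩

lemma lintegral_eq_of_support {A : Set (SpaceTime n)} (hA : MeasurableSet A)
    {F : SpaceTime n → ℝ≥0∞} (hF : ∀ z ∉ A, F z = 0) : ∫⁻ z, F z = ∫⁻ z in A, F z := by
  rw [← lintegral_indicator hA]
  congr 1 with z
  by_cases h : z ∈ A
  · rw [Set.indicator_of_mem h]
  · rw [Set.indicator_of_notMem h, hF z h]

/-- The dual form of `exists_eLpNorm_cyl_cv_le`: the convolution is moved to the second factor, where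
`g` is the model kernel applied to `|w|`. -/
lemma exists_lintegral_cv_mul_le (Φ : 𝓢(Space n, ℂ)) : ∃ C : ℝ≥0, ∀ (k : ℤ)
    (f w : SpaceTime n → ℂ), AEStronglyMeasurable f volume → AEStronglyMeasurable w volume →
      ∃ g : SpaceTime n → ℝ≥0∞, AEMeasurable g ∧
        ∫⁻ z, ‖cv (sc Φ k) f z‖ₑ * ‖w z‖ₑ ≤ ∫⁻ z, ‖f z‖ₑ * g z ∧
        ∀ j : ℤ, ∫⁻ z in cyl n j, g z ^ 2 ≤
          (C * (pw (j / 2) * al n (j + k) * xkNorm k w)) ^ 2 := by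
  obtain ⟨C₀, h₀⟩ := exists_cv_sc_le Φ (n + 3)
  obtain ⟨C₁, h₁⟩ := exists_pconv_cyl_le n
  refine ⟨C₀ * C₁, fun k f w hf hw =>
    ⟨fun z => C₀ * pconv (n + 3) k (fun z => ‖w z‖ₑ) z, ?_, ?_, fun j => ?_⟩⟩
  · have := (measurable_pconv (n + 3) k hw.stronglyMeasurable_mk.enorm).aemeasurable
      (μ := (volume : Measure (SpaceTime n)))
    refine (this.congr (pconv_congr_ae _ _ ?_)).const_mul _
    filter_upwards [hw.ae_eq_mk] with z hz
    rw [hz]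
  · calc ∫⁻ z, ‖cv (sc Φ k) f z‖ₑ * ‖w z‖ₑ
        ≤ ∫⁻ z, C₀ * (pconv (n + 3) k (fun z => ‖f z‖ₑ) z * ‖w z‖ₑ) := by
          refine lintegral_mono fun z => ?_
          rw [← mul_assoc]
          gcongr
          exact h₀ k f z
      _ = C₀ * ∫⁻ z, ‖f z‖ₑ * pconv (n + 3) k (fun z => ‖w z‖ₑ) z := by
          rw [lintegral_const_mul' _ _ (by finiteness), lintegral_pconv_mul _ _ hf.enorm hw.enorm]
      _ = _ := by
          rw [← lintegral_const_mul' _ _ (by finiteness)]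
          congr 1 with z
          ring
  · simp_rw [mul_pow (C₀ : ℝ≥0∞)]
    rw [lintegral_const_mul' _ _ (by finiteness)]
    calc _ ≤ (C₀ : ℝ≥0∞) ^ 2 * (C₁ * (pw (j / 2) * al n (j + k) * xkNorm k w)) ^ 2 := by
          gcongr; exact h₁ j k w hw
      _ = _ := by push_cast; ring

/-- The dual form of `exists_eLpNorm_cyl_cv_le`, for a function supported in a ball. -/
lemma exists_lintegral_cv_cyl_le (Φ : 𝓢(Space n, ℂ)) : ∃ C : ℝ≥0, ∀ (j k : ℤ)
    (f w : SpaceTime n → ℂ), AEStronglyMeasurable f volume → (∀ z ∉ cyl n j, f z = 0) →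
      AEStronglyMeasurable w volume →
      ∫⁻ z, ‖cv (sc Φ k) f z‖ₑ * ‖w z‖ₑ ≤
        C * (pw (j / 2) * al n (j + k) * eLpNorm f 2 volume) * xkNorm k w := by
  obtain ⟨C, hC⟩ := exists_lintegral_cv_mul_le Φ
  refine ⟨C, fun j k f w hf hs hw => ?_⟩
  obtain ⟨g, hgm, hg1, hg2⟩ := hC k f w hf hw
  refine hg1.trans ?_
  rw [lintegral_eq_of_support (measurableSet_cyl n j) (fun z hz => by simp [hs z hz])]
  apply le_of_sq_le_sq
  calc (∫⁻ z in cyl n j, ‖f z‖ₑ * g z) ^ 2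
      ≤ (∫⁻ z in cyl n j, ‖f z‖ₑ ^ 2) * ∫⁻ z in cyl n j, g z ^ 2 :=
        lintegral_mul_sq_le hf.restrict.enorm hgm.restrict
    _ ≤ eLpNorm f 2 volume ^ 2 * (C * (pw (j / 2) * al n (j + k) * xkNorm k w)) ^ 2 := by
        rw [eLpNorm_two_sq]
        exact mul_le_mul' (setLIntegral_le_lintegral _ _) (hg2 j)
    _ = _ := by ring

/-- The dual form of `exists_eLpNorm_cyl_cv_le`, after a decomposition into annuli. -/
lemma exists_lintegral_cv_ann_le (hn : n ≠ 0) (Φ : 𝓢(Space n, ℂ)) : ∃ C : ℝ≥0, ∀ (k : ℤ)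
    (f w : SpaceTime n → ℂ), AEStronglyMeasurable f volume → AEStronglyMeasurable w volume →
      ∫⁻ z, ‖cv (sc Φ k) f z‖ₑ * ‖w z‖ₑ ≤
        C * (∑' j : ℤ, pw ((j + 1 : ℤ) / 2) * al n (j + 1 + k) *
          eLpNorm f 2 (volume.restrict (ann n j))) * xkNorm k w := by
  obtain ⟨C, hC⟩ := exists_lintegral_cv_mul_le Φ
  refine ⟨C, fun k f w hf hw => ?_⟩
  obtain ⟨g, hgm, hg1, hg2⟩ := hC k f w hf hw
  refine hg1.trans ?_
  have h0 : ∀ᵐ z : SpaceTime n, z ∈ ⋃ j : ℤ, ann n j := by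
    have : Nonempty (Fin n) := ⟨⟨0, Nat.pos_of_ne_zero hn⟩⟩
    have h : ∀ᵐ x : Space n, x ≠ 0 := by simp [ae_iff]
    have h' : ∀ᵐ z : SpaceTime n, z.2 ≠ 0 := by
      rw [Measure.volume_eq_prod]
      exact Measure.quasiMeasurePreserving_snd.ae h
    filter_upwards [h'] with z hz
    obtain ⟨i, hi⟩ := exists_mem_ann hz
    exact Set.mem_iUnion.2 ⟨i, hi⟩
  have h1 : ∫⁻ z, ‖f z‖ₑ * g z = ∫⁻ z in ⋃ j : ℤ, ann n j, ‖f z‖ₑ * g z := by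
    rw [Measure.restrict_eq_self_of_ae_mem h0]
  rw [h1]
  refine (lintegral_iUnion_le _ _).trans ?_
  rw [← ENNReal.tsum_mul_left, ← ENNReal.tsum_mul_right]
  refine ENNReal.tsum_le_tsum fun j => ?_
  apply le_of_sq_le_sq
  calc (∫⁻ z in ann n j, ‖f z‖ₑ * g z) ^ 2
      ≤ (∫⁻ z in ann n j, ‖f z‖ₑ ^ 2) * ∫⁻ z in ann n j, g z ^ 2 :=
        lintegral_mul_sq_le hf.restrict.enorm hgm.restrict
    _ ≤ eLpNorm f 2 (volume.restrict (ann n j)) ^ 2 *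
          (C * (pw ((j + 1 : ℤ) / 2) * al n (j + 1 + k) * xkNorm k w)) ^ 2 := by
        rw [eLpNorm_two_sq]
        exact mul_le_mul' le_rfl ((lintegral_mono_set fun z hz => hz.2).trans (hg2 (j + 1)))
    _ = _ := by ring

lemma integrable_ae {f : SpaceTime n → ℂ} (hf : MemLp f 2 volume) (Φ : 𝓢(Space n, ℂ)) (k : ℤ) :
    ∀ᵐ z : SpaceTime n, Integrable fun y => sc Φ k y * f (z.1, z.2 - y) := by
  obtain ⟨C₀, h₀⟩ := exists_enorm_sc_le Φ (n + 3)
  obtain ⟨C₁, h₁⟩ := exists_lintegral_pconv_le n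
  have hfin : ∫⁻ z, pconv (n + 3) k (fun z => ‖f z‖ₑ) z ^ 2 ≠ ⊤ := by
    refine ne_top_of_le_ne_top ?_ (h₁ k _ hf.1.enorm)
    rw [← eLpNorm_two_sq]
    have := hf.2.ne
    finiteness
  have he : (fun z => ‖f z‖ₑ) =ᵐ[volume] fun z => ‖hf.1.mk f z‖ₑ := by
    filter_upwards [hf.1.ae_eq_mk] with z hz; rw [hz]
  have hm : AEMeasurable (fun z => pconv (n + 3) k (fun z => ‖f z‖ₑ) z ^ 2) volume :=
    (((measurable_pconv (n + 3) k hf.1.stronglyMeasurable_mk.enorm).aemeasurable).congr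
      (pconv_congr_ae _ _ he.symm)).pow_const 2
  filter_upwards [ae_lt_top' hm hfin, ae_of_ae_time (ae_slice hf.1.ae_eq_mk)] with z hz hz2
  have hma : AEStronglyMeasurable (fun y => f (z.1, y)) volume :=
    (hf.1.stronglyMeasurable_mk.comp_measurable
      (by fun_prop : Measurable fun y : Space n => (z.1, y))).aestronglyMeasurable.congr
      (by filter_upwards [hz2] with y hy; exact hy.symm)
  refine ⟨(sc Φ k).continuous.aestronglyMeasurable.mul
    (hma.comp_quasiMeasurePreserving
      (Measure.measurePreserving_sub_left volume z.2).quasiMeasurePreserving), ?_⟩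
  rw [hasFiniteIntegral_iff_enorm]
  have hz' : pconv (n + 3) k (fun z => ‖f z‖ₑ) z < ⊤ := by
    by_contra h
    rw [not_lt, top_le_iff] at h
    simp [h] at hz
  calc ∫⁻ y, ‖sc Φ k y * f (z.1, z.2 - y)‖ₑ
      ≤ ∫⁻ y, C₀ * (kap n (n + 3) k y * ‖f (z.1, z.2 - y)‖ₑ) := by
        refine lintegral_mono fun y => ?_
        rw [enorm_mul, ← mul_assoc]
        gcongr
        exact h₀ k y
    _ = C₀ * pconv (n + 3) k (fun z => ‖f z‖ₑ) z := by
        rw [lintegral_const_mul' _ _ (by finiteness), pconv,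
          ← lintegral_sub_left_eq_self (fun y => kap n (n + 3) k (z.2 - y) * ‖f (z.1, y)‖ₑ) z.2]
        simp
    _ < ⊤ := ENNReal.mul_lt_top (by finiteness) hz'

/-! ### Almost orthogonality -/

/-- The symbol of `Φ` is supported in an annulus. -/
def Annular (Φ : 𝓢(Space n, ℂ)) : Prop :=
  ∃ R : ℝ, 0 < R ∧ ∀ ξ, 𝓕 Φ ξ ≠ 0 → R⁻¹ ≤ ‖ξ‖ ∧ ‖ξ‖ ≤ R

lemma fourier_sc (Φ : 𝓢(Space n, ℂ)) (k : ℤ) (ξ : Space n) :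
    𝓕 (sc Φ k) ξ = 𝓕 Φ ((2 : ℝ) ^ (-k) • ξ) := by
  have h2 : (0 : ℝ) < (2 : ℝ) ^ k := by positivity
  rw [fourier_coe, fourier_coe, Real.fourier_eq, Real.fourier_eq]
  have h := Measure.integral_comp_smul (volume : Measure (Space n))
    (fun v => (Real.fourierChar (-inner ℝ v ((2 : ℝ) ^ (-k) • ξ))) • Φ v) ((2 : ℝ) ^ k)
  rw [finrank_euclideanSpace_fin, abs_of_nonneg (by positivity)] at h
  have h' := congrArg (fun a : ℂ => ((((2 : ℝ) ^ k) ^ n : ℝ)) • a) h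
  simp only [smul_smul] at h'
  rw [mul_inv_cancel₀ (by positivity), one_smul, ← integral_smul] at h'
  rw [← h']
  congr 1 with y
  rw [sc_apply, inner_smul_left, inner_smul_right, smul_comm]
  simp only [conj_trivial, ← mul_assoc]
  rw [← zpow_add₀ (by norm_num)]
  simp

/-- Each frequency lies in boundedly many of the dyadic dilates of an annulus. -/
lemma exists_card_le (R : ℝ) : ∃ N : ℕ, ∀ (F : Finset ℤ) (ξ : Space n),
    (∀ k ∈ F, R⁻¹ ≤ ‖(2 : ℝ) ^ (-k) • ξ‖ ∧ ‖(2 : ℝ) ^ (-k) • ξ‖ ≤ R) → 0 < R → F.card ≤ N := by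
  obtain ⟨L, hL⟩ := pow_unbounded_of_one_lt (R ^ 2) (by norm_num : (1 : ℝ) < 2)
  refine ⟨L + 1, fun F ξ hF hR => ?_⟩
  rcases F.eq_empty_or_nonempty with rfl | hne
  · simp
  have hsub : F ⊆ Finset.Icc (F.min' hne) (F.min' hne + L) := by
    intro k hk
    rw [Finset.mem_Icc]
    refine ⟨F.min'_le k hk, ?_⟩
    set k₁ := F.min' hne
    have h1 := (hF k₁ (F.min'_mem hne)).2
    have h2 := (hF k hk).1
    rw [norm_smul, Real.norm_of_nonneg (by positivity)] at h1 h2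
    by_contra hcon
    push Not at hcon
    have e : (2 : ℝ) ^ (k - k₁) * ((2 : ℝ) ^ (-k) * ‖ξ‖) = (2 : ℝ) ^ (-k₁) * ‖ξ‖ := by
      rw [← mul_assoc, ← zpow_add₀ (by norm_num)]
      congr 2; ring
    have h3 : (2 : ℝ) ^ (k - k₁) * R⁻¹ ≤ R := by
      calc _ ≤ (2 : ℝ) ^ (k - k₁) * ((2 : ℝ) ^ (-k) * ‖ξ‖) := by gcongr
        _ ≤ R := e ▸ h1
    have h4 : (2 : ℝ) ^ (k - k₁) ≤ R ^ 2 := by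
      rw [← div_eq_mul_inv, div_le_iff₀ hR] at h3
      linarith [sq R]
    have h5 : (2 : ℝ) ^ L ≤ (2 : ℝ) ^ (k - k₁) := by
      rw [← zpow_natCast]
      apply zpow_le_zpow_right₀ (by norm_num)
      omega
    linarith
  refine (Finset.card_le_card hsub).trans ?_
  rw [Int.card_Icc]
  omega

lemma exists_bound (f : 𝓢(Space n, ℂ)) : ∃ B : ℝ, 0 ≤ B ∧ ∀ x, ‖f x‖ ≤ B := by
  obtain ⟨C, hC⟩ := schwartz_decay f 0
  exact ⟨C, C.2, fun x => by simpa using hC x⟩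

/-- The symbols of the partial sums of a dyadic decomposition are uniformly bounded. -/
lemma exists_sum_norm_le {Φ : 𝓢(Space n, ℂ)} (hΦ : Annular Φ) : ∃ C : ℝ, 0 ≤ C ∧
    ∀ (F : Finset ℤ) (ξ : Space n), ∑ k ∈ F, ‖𝓕 Φ ((2 : ℝ) ^ (-k) • ξ)‖ ≤ C := by
  obtain ⟨R, hR, h⟩ := hΦ
  obtain ⟨N, hN⟩ := exists_card_le (n := n) R
  obtain ⟨B, hB0, hB⟩ := exists_bound (𝓕 Φ)
  refine ⟨N * B, by positivity, fun F ξ => ?_⟩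
  rw [← Finset.sum_filter_ne_zero]
  refine (Finset.sum_le_card_nsmul _ _ B fun k _ => hB _).trans ?_
  rw [nsmul_eq_mul]
  gcongr
  apply hN _ ξ _ hR
  intro k hk
  rw [Finset.mem_filter, norm_ne_zero_iff] at hk
  exact h _ hk.2

lemma temperate_slice (t : ℝ) :
    Function.HasTemperateGrowth (fun x : Space n => ((t, x) : SpaceTime n)) := by
  have h1 : Function.HasTemperateGrowth (fun _ : Space n => ((t, 0) : SpaceTime n)) :=
    Function.HasTemperateGrowth.const _
  have h2 : Function.HasTemperateGrowth
      (fun x : Space n => ContinuousLinearMap.inr ℝ ℝ (Space n) x) :=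
    ContinuousLinearMap.hasTemperateGrowth _
  have h3 := h1.add h2
  have e : ((fun _ : Space n => ((t, 0) : SpaceTime n)) +
      fun x : Space n => ContinuousLinearMap.inr ℝ ℝ (Space n) x) = fun x => (t, x) := by
    ext x <;> simp
  rwa [e] at h3

/-- The slice at time `t` of a Schwartz function. -/
def slice (t : ℝ) (u : 𝓢(SpaceTime n, ℂ)) : 𝓢(Space n, ℂ) :=
  compCLMOfAntilipschitz ℝ (K := 1) (temperate_slice t)
    (AntilipschitzWith.of_le_mul_dist fun x y => by simp [Prod.dist_eq]) u

@[simp] lemma slice_apply (t : ℝ) (u : 𝓢(SpaceTime n, ℂ)) (x : Space n) :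
    slice t u x = u (t, x) := rfl

lemma cv_schwartz (K : 𝓢(Space n, ℂ)) (u : 𝓢(SpaceTime n, ℂ)) (z : SpaceTime n) :
    cv K u z = convolution (ContinuousLinearMap.mul ℂ ℂ) K (slice z.1 u) z.2 := by
  rw [convolution_apply, convolution_def]
  rfl

lemma fourier_conv (K f : 𝓢(Space n, ℂ)) (ξ : Space n) :
    𝓕 (convolution (ContinuousLinearMap.mul ℂ ℂ) K f) ξ = 𝓕 K ξ * 𝓕 f ξ := by
  rw [fourier_convolution, pairing_apply_apply]
  rfl

lemma lintegral_enorm_sq_schwartz (f : 𝓢(Space n, ℂ)) :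
    ∫⁻ x, ‖f x‖ₑ ^ 2 = ENNReal.ofReal (∫ x, ‖f x‖ ^ 2) := by
  have hi : Integrable (fun x => ‖f x‖ ^ 2) := (f.memLp 2).integrable_norm_pow (by norm_num)
  rw [ofReal_integral_eq_lintegral_ofReal hi (ae_of_all _ fun x => by positivity)]
  congr 1 with x
  rw [ENNReal.ofReal_pow (norm_nonneg _), ofReal_norm]

lemma plancherel (f : 𝓢(Space n, ℂ)) : ∫⁻ ξ, ‖𝓕 f ξ‖ₑ ^ 2 = ∫⁻ x, ‖f x‖ₑ ^ 2 := by
  rw [lintegral_enorm_sq_schwartz, lintegral_enorm_sq_schwartz, integral_norm_sq_fourier]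

instance : (volume : Measure (SpaceTime n)).IsAddHaarMeasure := by
  rw [Measure.volume_eq_prod]; infer_instance

lemma exists_sum_lintegral_schwartz_le {Φ : 𝓢(Space n, ℂ)} (hΦ : Annular Φ) : ∃ C : ℝ≥0,
    ∀ (F : Finset ℤ) (u : 𝓢(SpaceTime n, ℂ)),
      ∑ k ∈ F, ∫⁻ z, ‖cv (sc Φ k) u z‖ₑ ^ 2 ≤ C * ∫⁻ z, ‖u z‖ₑ ^ 2 := by
  obtain ⟨C, hC0, hC⟩ := exists_sum_norm_le hΦ
  refine ⟨(C ^ 2).toNNReal, fun F u => ?_⟩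
  have hm : ∀ k, Measurable fun z => ‖cv (sc Φ k) u z‖ₑ ^ 2 := fun k =>
    (measurable_cv (sc Φ k).continuous.measurable u.continuous.measurable).enorm.pow_const 2
  rw [← lintegral_finsetSum _ fun k _ => hm k, lintegral_spacetime
    (f := fun z => ∑ k ∈ F, ‖cv (sc Φ k) u z‖ₑ ^ 2)
    (Finset.measurable_fun_sum _ fun k _ => hm k).aemeasurable,
    lintegral_spacetime (f := fun z => ‖u z‖ₑ ^ 2) (u.continuous.enorm.measurable.pow_const 2).aemeasurable,
    ← lintegral_const_mul' _ _ (by finiteness)]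
  refine lintegral_mono fun t => ?_
  have e : ∀ k, ∫⁻ x, ‖cv (sc Φ k) u (t, x)‖ₑ ^ 2 =
      ∫⁻ ξ, ‖𝓕 Φ ((2 : ℝ) ^ (-k) • ξ)‖ₑ ^ 2 * ‖𝓕 (slice t u) ξ‖ₑ ^ 2 := fun k => by
    simp_rw [cv_schwartz]
    rw [← plancherel]
    congr 1 with ξ
    rw [fourier_conv, enorm_mul, mul_pow, fourier_sc]
  have hm' : ∀ k : ℤ, Measurable fun ξ : Space n =>
      ‖𝓕 Φ ((2 : ℝ) ^ (-k) • ξ)‖ₑ ^ 2 * ‖𝓕 (slice t u) ξ‖ₑ ^ 2 := fun k => by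
    have h1 := (𝓕 Φ).continuous
    have h2 := (𝓕 (slice t u)).continuous
    exact ((h1.comp (continuous_const_smul ((2 : ℝ) ^ (-k)))).enorm.measurable.pow_const 2).mul
      (h2.enorm.measurable.pow_const 2)
  have hs : ∀ k, Measurable fun x : Space n => ‖cv (sc Φ k) u (t, x)‖ₑ ^ 2 := fun k =>
    (hm k).comp (by fun_prop : Measurable fun x : Space n => (t, x))
  rw [lintegral_finsetSum _ fun k _ => hs k]
  calc ∑ k ∈ F, ∫⁻ x, ‖cv (sc Φ k) u (t, x)‖ₑ ^ 2
      = ∫⁻ ξ, (∑ k ∈ F, ‖𝓕 Φ ((2 : ℝ) ^ (-k) • ξ)‖ₑ ^ 2) * ‖𝓕 (slice t u) ξ‖ₑ ^ 2 := by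
        simp_rw [Finset.sum_mul]
        rw [lintegral_finsetSum _ fun k _ => hm' k]
        exact Finset.sum_congr rfl fun k _ => e k
    _ ≤ ∫⁻ ξ, (C ^ 2).toNNReal * ‖𝓕 (slice t u) ξ‖ₑ ^ 2 := by
        refine lintegral_mono fun ξ => mul_le_mul' ?_ le_rfl
        have h1 := hC F ξ
        have h2 : ∑ k ∈ F, ‖𝓕 Φ ((2 : ℝ) ^ (-k) • ξ)‖ ^ 2 ≤ C ^ 2 :=
          (Finset.sum_sq_le_sq_sum_of_nonneg fun _ _ => norm_nonneg _).trans
            (pow_le_pow_left₀ (Finset.sum_nonneg fun _ _ => norm_nonneg _) h1 2)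
        simp_rw [← ofReal_norm, ← ENNReal.ofReal_pow (norm_nonneg _)]
        rw [← ENNReal.ofReal_sum_of_nonneg fun _ _ => by positivity]
        exact ENNReal.ofReal_le_ofReal h2
    _ = _ := by
        rw [lintegral_const_mul' _ _ (by finiteness), plancherel]
        rfl

/-- Almost orthogonality of frequency localizations in `L²`. -/
lemma exists_tsum_eLpNorm_cv_le {Φ : 𝓢(Space n, ℂ)} (hΦ : Annular Φ) : ∃ C : ℝ≥0,
    ∀ (f : SpaceTime n → ℂ), MemLp f 2 volume →
      ∑' k : ℤ, eLpNorm (cv (sc Φ k) f) 2 volume ^ 2 ≤ C * eLpNorm f 2 volume ^ 2 := by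
  obtain ⟨C, hC⟩ := exists_sum_lintegral_schwartz_le hΦ
  obtain ⟨B, hB⟩ := exists_eLpNorm_cv_le Φ
  refine ⟨4 * C, fun f hf => ?_⟩
  rw [ENNReal.tsum_eq_iSup_sum]
  refine iSup_le fun F => ?_
  -- For Schwartz functions this is Plancherel's theorem. In general, `f` is approximated to within
  -- `1 / m`; the error is multiplied by the cardinality of `F`, which stays fixed as `m → ∞`.
  have key : ∀ m : ℕ, ∑ k ∈ F, eLpNorm (cv (sc Φ k) f) 2 volume ^ 2 ≤
      (4 * C : ℝ≥0) * eLpNorm f 2 volume ^ 2 +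
        (4 * C + 2 * F.card * B ^ 2 : ℝ≥0) * ((m : ℝ≥0∞)⁻¹) ^ 2 := by
    intro m
    have hm : 0 < ((m : ℝ) + 1)⁻¹ := by positivity
    obtain ⟨u, hu⟩ := (denseRange_toLpCLM (E := SpaceTime n) (F := ℂ) (μ := volume) (p := 2)
      ENNReal.ofNat_ne_top).exists_dist_lt (hf.toLp f) hm
    rw [toLpCLM_apply] at hu
    have hd : eLpNorm (fun z => f z - u z) 2 volume ≤ (m : ℝ≥0∞)⁻¹ := by
      have h1 : edist (hf.toLp f) (u.toLp 2 volume) ≤ ENNReal.ofReal (((m : ℝ) + 1)⁻¹) := by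
        rw [edist_dist]; exact ENNReal.ofReal_le_ofReal hu.le
      rw [SchwartzMap.toLp, Lp.edist_toLp_toLp] at h1
      refine h1.trans ?_
      rw [ENNReal.ofReal_inv_of_pos (by positivity)]
      apply ENNReal.inv_le_inv.2
      rw [ENNReal.ofReal_add (by positivity) (by norm_num), ENNReal.ofReal_natCast]
      exact le_self_add
    have hum : MemLp u 2 volume := u.memLp 2
    have hdm : MemLp (fun z => f z - u z) 2 volume := hf.sub hum
    have h1 : ∀ k, eLpNorm (cv (sc Φ k) f) 2 volume ^ 2 ≤
        2 * (eLpNorm (cv (sc Φ k) u) 2 volume ^ 2 + (B * (m : ℝ≥0∞)⁻¹) ^ 2) := fun k => by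
      refine le_trans ?_ (add_sq_le _ _)
      gcongr
      have e : cv (sc Φ k) f =ᵐ[volume] fun z => cv (sc Φ k) u z +
          cv (sc Φ k) (fun z => f z - u z) z := by
        filter_upwards [integrable_ae hum Φ k, integrable_ae hdm Φ k] with z h1 h2
        unfold cv
        rw [← integral_add h1 h2]
        congr 1 with y
        ring
      rw [eLpNorm_congr_ae e]
      refine (eLpNorm_add_le (aestronglyMeasurable_cv (sc Φ k).continuous.measurable hum.1)
        (aestronglyMeasurable_cv (sc Φ k).continuous.measurable hdm.1) (by norm_num)).trans ?_
      gcongr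
      exact (hB k _ hdm.1).trans (by gcongr)
    have h2 : eLpNorm u 2 volume ^ 2 ≤ 2 * (eLpNorm f 2 volume ^ 2 + ((m : ℝ≥0∞)⁻¹) ^ 2) := by
      refine le_trans ?_ (add_sq_le _ _)
      gcongr
      have e : (u : SpaceTime n → ℂ) = f - fun z => f z - u z := by ext z; simp
      rw [e]
      exact (eLpNorm_sub_le hf.1 hdm.1 (by norm_num)).trans (by gcongr)
    calc ∑ k ∈ F, eLpNorm (cv (sc Φ k) f) 2 volume ^ 2
        ≤ ∑ k ∈ F, 2 * (eLpNorm (cv (sc Φ k) u) 2 volume ^ 2 + (B * (m : ℝ≥0∞)⁻¹) ^ 2) :=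
          Finset.sum_le_sum fun k _ => h1 k
      _ = 2 * (∑ k ∈ F, eLpNorm (cv (sc Φ k) u) 2 volume ^ 2 +
            F.card * (B * (m : ℝ≥0∞)⁻¹) ^ 2) := by
          rw [← Finset.mul_sum, Finset.sum_add_distrib]; simp
      _ ≤ 2 * (C * eLpNorm u 2 volume ^ 2 + F.card * (B * (m : ℝ≥0∞)⁻¹) ^ 2) := by
          gcongr
          simp_rw [eLpNorm_two_sq]
          exact hC F u
      _ ≤ 2 * (C * (2 * (eLpNorm f 2 volume ^ 2 + ((m : ℝ≥0∞)⁻¹) ^ 2)) +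
            F.card * (B * (m : ℝ≥0∞)⁻¹) ^ 2) := by gcongr
      _ = _ := by push_cast; ring
  have hlim : Tendsto (fun m : ℕ => (4 * C : ℝ≥0) * eLpNorm f 2 volume ^ 2 +
        (4 * C + 2 * F.card * B ^ 2 : ℝ≥0) * ((m : ℝ≥0∞)⁻¹) ^ 2) atTop
      (𝓝 ((4 * C : ℝ≥0) * eLpNorm f 2 volume ^ 2 + (4 * C + 2 * F.card * B ^ 2 : ℝ≥0) * 0 ^ 2)) := by
    refine tendsto_const_nhds.add (ENNReal.Tendsto.const_mul ?_ (Or.inr ENNReal.coe_ne_top))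
    exact (ENNReal.continuous_pow 2).continuousAt.tendsto.comp
      ENNReal.tendsto_inv_nat_nhds_zero
  simpa using ge_of_tendsto' hlim key

/-! ### Square functions of functions supported in a ball -/

lemma al_le_one (hn : 1 ≤ n) (m : ℤ) : al n m ≤ 1 := by
  apply pw_le_one
  have h1 : ((min m 0 : ℤ) : ℝ) ≤ 0 := by exact_mod_cast min_le_right m 0
  have h2 : (0 : ℝ) ≤ ((n : ℝ) - 1) / 2 := by
    have : (1 : ℝ) ≤ n := by exact_mod_cast hn
    linarith
  exact mul_nonpos_of_nonneg_of_nonpos h2 h1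

lemma wgt_ge {j : ℤ} {y : Space n} (hy : ‖y‖ ≤ (2 : ℝ) ^ j) : 1 ≤ 4 * wgt n (-j) y := by
  have h0 : (0 : ℝ) < (2 : ℝ) ^ j := by positivity
  have h1 : (2 : ℝ) ^ (-j) * ‖y‖ ≤ 1 := by
    rw [zpow_neg, inv_mul_le_iff₀ h0]; simpa using hy
  have h2 : 0 ≤ (2 : ℝ) ^ (-j) * ‖y‖ := by positivity
  rw [wgt, show (4 : ℝ≥0∞) = ENNReal.ofReal 4 by simp, ← ENNReal.ofReal_mul (by norm_num),
    ENNReal.one_le_ofReal, ← div_eq_mul_inv, le_div_iff₀ (by positivity)]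
  nlinarith

/-- The norm of `X_k` controls `L²` on the balls of radius at least `2^{-k}`. -/
lemma exists_eLpNorm_cyl_le_xkNorm (n : ℕ) : ∃ C : ℝ≥0, ∀ (j k : ℤ), -k ≤ j →
    ∀ w : SpaceTime n → ℂ, eLpNorm w 2 (volume.restrict (cyl n j)) ≤
      C * (pw (j / 2) * xkNorm k w) := by
  obtain ⟨C, hC⟩ := exists_lintegral_wgt_le n
  -- adding `1` makes the constant at most its own square
  refine ⟨4 * C + 1, fun j k hjk w => ?_⟩
  apply le_of_sq_le_sq
  rw [eLpNorm_two_sq]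
  calc ∫⁻ z in cyl n j, ‖w z‖ₑ ^ 2 ≤ ∫⁻ z in cyl n j, 4 * (‖w z‖ₑ ^ 2 * wgt n (-j) z.2) := by
        refine setLIntegral_mono' (measurableSet_cyl n j) fun z hz => ?_
        rw [mul_left_comm]
        exact le_mul_of_one_le_right' (wgt_ge hz)
    _ ≤ ∫⁻ z, 4 * (‖w z‖ₑ ^ 2 * wgt n (-j) z.2) := setLIntegral_le_lintegral _ _
    _ = 4 * ∫⁻ z, ‖w z‖ₑ ^ 2 * wgt n (-j) z.2 := lintegral_const_mul' _ _ (by finiteness)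
    _ ≤ 4 * (C * pw (-((-j : ℤ) : ℝ)) * xkNorm k w ^ 2) := by
        gcongr; exact hC k (-j) (by omega) w
    _ = (4 * C : ℝ≥0) * (pw j * xkNorm k w ^ 2) := by push_cast; rw [neg_neg]; ring
    _ ≤ ((4 * C + 1 : ℝ≥0)) ^ 2 * (pw j * xkNorm k w ^ 2) := by
        refine mul_le_mul' ?_ le_rfl
        exact_mod_cast show 4 * C ≤ (4 * C + 1) ^ 2 by
          have : 0 ≤ C := zero_le
          nlinarith
    _ = _ := by rw [mul_pow, mul_pow, pw_sq]; congr 3; ring_nf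

/-- One power of decay of the kernel gains `2^{-(j+k)}` at distance `2^j`. -/
lemma kap_far {j k : ℤ} {y : Space n} (m : ℕ) (hy : (2 : ℝ) ^ j ≤ ‖y‖) :
    kap n (m + 1) k y ≤ pw (-((j + k : ℤ) : ℝ)) * kap n m k y := by
  rw [show -((j + k : ℤ) : ℝ) = ((-(j + k) : ℤ) : ℝ) by push_cast; ring, pw_int, kap, kap,
    ← ENNReal.ofReal_mul (by positivity)]
  apply ENNReal.ofReal_le_ofReal
  rw [mul_left_comm]
  refine mul_le_mul_of_nonneg_left ?_ (by positivity)
  rw [pow_succ, mul_inv, mul_comm]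
  refine mul_le_mul_of_nonneg_right ?_ (by positivity)
  rw [zpow_neg]
  apply inv_anti₀ (by positivity)
  rw [zpow_add₀ (by norm_num), mul_comm]
  have : (2 : ℝ) ^ k * (2 : ℝ) ^ j ≤ (2 : ℝ) ^ k * ‖y‖ := by gcongr
  linarith

/-- Away from the support of a function, one power of decay of the kernel gains `2^{-(j+k)}`. -/
lemma pconv_far {j k : ℤ} (m : ℕ) {f : SpaceTime n → ℝ≥0∞} (hf : ∀ z ∉ cyl n j, f z = 0)
    {z : SpaceTime n} (hz : z ∉ cyl n (j + 1)) :
    pconv (m + 1) k f z ≤ pw (-((j + k : ℤ) : ℝ)) * pconv m k f z := by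
  unfold pconv
  rw [← lintegral_const_mul' _ _ (pw_ne_top _)]
  refine lintegral_mono fun y => ?_
  by_cases hy : (z.1, y) ∈ cyl n j
  · simp only [← mul_assoc]
    refine mul_le_mul' (kap_far m ?_) le_rfl
    have h1 : ‖y‖ ≤ (2 : ℝ) ^ j := hy
    have h2 : (2 : ℝ) ^ (j + 1) < ‖z.2‖ := not_le.1 hz
    rw [zpow_add₀ (by norm_num), zpow_one] at h2
    have h3 := norm_sub_norm_le z.2 y
    linarith
  · simp [hf _ hy]

/-- For `f` supported in `|x| ≤ 2^j`, the square function of the dual norms of the dyadic pieces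
of `f` is controlled by `2^{j/2} ‖f‖_{L²}`. Pieces of frequency below `2^{-j}` are
handled by Bernstein's inequality; those of higher frequency are orthogonal to each other near
the support, and small away from it. -/
lemma exists_dual_bound (hn : 2 ≤ n) {Φ : 𝓢(Space n, ℂ)} (hΦ : Annular Φ) : ∃ C : ℝ≥0, ∀ (j : ℤ)
    (f : SpaceTime n → ℂ), MemLp f 2 volume → (∀ z ∉ cyl n j, f z = 0) →
      ∃ D : ℤ → ℝ≥0∞,
        (∀ (k : ℤ) (w : SpaceTime n → ℂ), AEStronglyMeasurable w volume →
          ∫⁻ z, ‖cv (sc Φ k) f z‖ₑ * ‖w z‖ₑ ≤ D k * xkNorm k w) ∧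
        ∑' k, D k ^ 2 ≤ (C * (pw (j / 2) * eLpNorm f 2 volume)) ^ 2 := by
  obtain ⟨C₁, h₁⟩ := exists_lintegral_cv_cyl_le Φ
  obtain ⟨C₂, h₂⟩ := exists_eLpNorm_cyl_le_xkNorm n
  obtain ⟨C₃, h₃⟩ := exists_cv_sc_le Φ (n + 4)
  obtain ⟨C₄, h₄⟩ := exists_pconv_cyl_le n
  obtain ⟨C₅, h₅⟩ := exists_tsum_eLpNorm_cv_le hΦ
  have hS := tsum_pw_abs_ne_top one_pos
  set S := ∑' m : ℤ, pw (-(1 * |(m : ℝ)|)) with hSdef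
  set B : ℝ≥0 := C₁ + 2 * C₂ + C₃ * C₄ with hB
  refine ⟨2 * B * (C₅ + S.toNNReal + 1), fun j f hf hs =>
    ⟨fun k => B * (pw (j / 2) * (eLpNorm (cv (sc Φ k) f) 2 volume +
      pw (-(|((j + k : ℤ) : ℝ)| / 2)) * eLpNorm f 2 volume)), fun k w hw => ?_, ?_⟩⟩
  · rcases lt_or_ge (j + k) 0 with hneg | hpos
    -- low frequencies: the factor `al n (j + k)` is at most `2^{(j+k)/2}` because `(n-1)/2 ≥ 1/2`
    · refine (h₁ j k f w hf.1 hs hw).trans (mul_le_mul' ?_ le_rfl)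
      rw [mul_assoc (pw _)]
      refine mul_le_mul' ?_ (mul_le_mul' le_rfl (le_add_left (mul_le_mul' ?_ le_rfl)))
      · exact_mod_cast show C₁ ≤ B by
          rw [hB, add_assoc]; exact le_self_add
      · apply pw_le_pw
        rw [min_eq_left hneg.le]
        have h1 : ((j + k : ℤ) : ℝ) ≤ 0 := by exact_mod_cast hneg.le
        have h2 : (2 : ℝ) ≤ n := by exact_mod_cast hn
        rw [abs_of_nonpos h1]
        nlinarith
    -- high frequencies, near the support and away from it
    · rw [← lintegral_add_compl _ (measurableSet_cyl n (j + 1))]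
      have near : ∫⁻ z in cyl n (j + 1), ‖cv (sc Φ k) f z‖ₑ * ‖w z‖ₑ ≤
          (2 * C₂ : ℝ≥0) * (pw (j / 2) * eLpNorm (cv (sc Φ k) f) 2 volume) * xkNorm k w := by
        have hc := aestronglyMeasurable_cv (sc Φ k).continuous.measurable hf.1
        calc _ ≤ eLpNorm (cv (sc Φ k) f) 2 (volume.restrict (cyl n (j + 1))) *
              eLpNorm w 2 (volume.restrict (cyl n (j + 1))) := lintegral_mul_le_eLpNorm hc hw
          _ ≤ eLpNorm (cv (sc Φ k) f) 2 volume * (C₂ * (pw ((j + 1 : ℤ) / 2) * xkNorm k w)) :=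
              mul_le_mul' (eLpNorm_mono_measure _ Measure.restrict_le_self)
                (h₂ (j + 1) k (by omega) w)
          _ ≤ eLpNorm (cv (sc Φ k) f) 2 volume * (C₂ * (pw (j / 2) * 2 * xkNorm k w)) := by
              gcongr
              rw [← pw_one, ← pw_add]
              apply pw_le_pw
              push_cast; linarith
          _ = _ := by push_cast; ring
      have far : ∫⁻ z in (cyl n (j + 1))ᶜ, ‖cv (sc Φ k) f z‖ₑ * ‖w z‖ₑ ≤
          (C₃ * C₄ : ℝ≥0) * (pw (j / 2) * (pw (-(|((j + k : ℤ) : ℝ)| / 2)) * eLpNorm f 2 volume)) *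
            xkNorm k w := by
        have hsym := lintegral_pconv_mul (n + 3) k hf.1.enorm hw.enorm
        have hp : AEMeasurable (pconv (n + 3) k fun z => ‖w z‖ₑ) volume :=
          ((measurable_pconv (n + 3) k hw.stronglyMeasurable_mk.enorm).aemeasurable).congr
            (pconv_congr_ae _ _ (by
              filter_upwards [hw.ae_eq_mk] with z hz
              rw [hz]))
        calc ∫⁻ z in (cyl n (j + 1))ᶜ, ‖cv (sc Φ k) f z‖ₑ * ‖w z‖ₑ
            ≤ ∫⁻ z in (cyl n (j + 1))ᶜ, C₃ * pw (-((j + k : ℤ) : ℝ)) *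
                (pconv (n + 3) k (fun z => ‖f z‖ₑ) z * ‖w z‖ₑ) := by
              refine setLIntegral_mono' (measurableSet_cyl n (j + 1)).compl fun z hz => ?_
              rw [← mul_assoc, mul_assoc (C₃ : ℝ≥0∞)]
              refine mul_le_mul' ((h₃ k f z).trans (mul_le_mul' le_rfl ?_)) le_rfl
              exact pconv_far (n + 3) (fun z hz => by simp [hs z hz]) hz
          _ ≤ C₃ * pw (-((j + k : ℤ) : ℝ)) *
                ∫⁻ z, pconv (n + 3) k (fun z => ‖f z‖ₑ) z * ‖w z‖ₑ := by
              rw [← lintegral_const_mul' _ _ (ENNReal.mul_ne_top (by finiteness) (pw_ne_top _))]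
              exact setLIntegral_le_lintegral _ _
          _ = C₃ * pw (-((j + k : ℤ) : ℝ)) *
                ∫⁻ z in cyl n j, ‖f z‖ₑ * pconv (n + 3) k (fun z => ‖w z‖ₑ) z := by
              rw [hsym]
              congr 1
              exact lintegral_eq_of_support (measurableSet_cyl n j) fun z hz => by simp [hs z hz]
          _ ≤ C₃ * pw (-((j + k : ℤ) : ℝ)) *
                (eLpNorm f 2 volume * (C₄ * (pw (j / 2) * al n (j + k) * xkNorm k w))) := by
              refine mul_le_mul' le_rfl (le_of_sq_le_sq ?_)
              rw [mul_pow]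
              refine (lintegral_mul_sq_le hf.1.enorm.restrict hp.restrict).trans
                (mul_le_mul' ?_ (h₄ j k w hw))
              rw [eLpNorm_two_sq]
              exact setLIntegral_le_lintegral _ _
          _ ≤ C₃ * pw (-(|((j + k : ℤ) : ℝ)| / 2)) *
                (eLpNorm f 2 volume * (C₄ * (pw (j / 2) * 1 * xkNorm k w))) := by
              gcongr
              · apply pw_le_pw
                have h1 : (0 : ℝ) ≤ ((j + k : ℤ) : ℝ) := by exact_mod_cast hpos
                rw [abs_of_nonneg h1]; linarith
              · exact al_le_one (by omega) _
          _ = _ := by push_cast; ring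
      refine (add_le_add near far).trans ?_
      rw [← add_mul]
      beta_reduce
      rw [mul_add (pw _), mul_add]
      refine mul_le_mul' (add_le_add (mul_le_mul' ?_ le_rfl) (mul_le_mul' ?_ le_rfl)) le_rfl
      · exact_mod_cast show 2 * C₂ ≤ B from (le_add_left le_rfl).trans le_self_add
      · exact_mod_cast show C₃ * C₄ ≤ B from le_add_left le_rfl
  · calc ∑' k : ℤ, (B * (pw (j / 2) * (eLpNorm (cv (sc Φ k) f) 2 volume +
          pw (-(|((j + k : ℤ) : ℝ)| / 2)) * eLpNorm f 2 volume))) ^ 2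
        ≤ ∑' k : ℤ, (B * pw (j / 2)) ^ 2 * (2 * (eLpNorm (cv (sc Φ k) f) 2 volume ^ 2 +
          pw (-(1 * |((j + k : ℤ) : ℝ)|)) * eLpNorm f 2 volume ^ 2)) := by
          refine ENNReal.tsum_le_tsum fun k => ?_
          rw [← mul_assoc (B : ℝ≥0∞), mul_pow]
          gcongr
          refine (add_sq_le _ _).trans_eq ?_
          rw [mul_pow (pw _), pw_sq]
          ring_nf
      _ = (B * pw (j / 2)) ^ 2 * (2 * (∑' k : ℤ, eLpNorm (cv (sc Φ k) f) 2 volume ^ 2 +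
          S * eLpNorm f 2 volume ^ 2)) := by
          rw [ENNReal.tsum_mul_left, ENNReal.tsum_mul_left, ENNReal.tsum_add,
            ENNReal.tsum_mul_right, hSdef, ← (Equiv.addLeft j).tsum_eq
              fun m : ℤ => pw (-(1 * |(m : ℝ)|))]
          rfl
      _ ≤ (B * pw (j / 2)) ^ 2 * (2 * (C₅ * eLpNorm f 2 volume ^ 2 +
          S * eLpNorm f 2 volume ^ 2)) := by gcongr; exact h₅ f hf
      _ = (2 * (C₅ + S)) * (B * (pw (j / 2) * eLpNorm f 2 volume)) ^ 2 := by ring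
      _ ≤ (2 * (C₅ + S + 1)) ^ 2 * (B * (pw (j / 2) * eLpNorm f 2 volume)) ^ 2 := by
          refine mul_le_mul' ?_ le_rfl
          rw [← ENNReal.coe_toNNReal hS]
          exact_mod_cast show 2 * (C₅ + S.toNNReal) ≤ (2 * (C₅ + S.toNNReal + 1)) ^ 2 by
            have : 0 ≤ C₅ + S.toNNReal := zero_le
            nlinarith
      _ = _ := by
          conv_lhs => rw [← ENNReal.coe_toNNReal hS]
          push_cast; ring

/-- The reflected profile `Φ(-y)`. -/
def reflect (Φ : 𝓢(Space n, ℂ)) : 𝓢(Space n, ℂ) :=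
  compCLMOfContinuousLinearEquiv ℝ (ContinuousLinearEquiv.neg ℝ : Space n ≃L[ℝ] Space n) Φ

@[simp] lemma reflect_apply (Φ : 𝓢(Space n, ℂ)) (y : Space n) : reflect Φ y = Φ (-y) := by
  simp [reflect]

lemma sc_reflect (Φ : 𝓢(Space n, ℂ)) (k : ℤ) (y : Space n) : sc (reflect Φ) k y = sc Φ k (-y) := by
  simp [sc_apply]

lemma Annular.reflect {Φ : 𝓢(Space n, ℂ)} (h : Annular Φ) : Annular (reflect Φ) := by
  obtain ⟨R, hR, h⟩ := h
  refine ⟨R, hR, fun ξ hξ => ?_⟩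
  have e : 𝓕 (LocEnergy.reflect Φ) ξ = 𝓕 Φ (-ξ) := by
    rw [fourier_coe, fourier_coe, Real.fourier_eq, Real.fourier_eq,
      ← integral_neg_eq_self]
    simp
  rw [e] at hξ
  simpa using h _ hξ

/-- Exchange of the two space variables in `((t, x), y)`. -/
lemma measurePreserving_swap : MeasurePreserving
    (fun p : SpaceTime n × Space n => (((p.1.1, p.2), p.1.2) : SpaceTime n × Space n))
      (volume.prod volume) (volume.prod volume) := by
  have h1 : MeasurePreserving (MeasurableEquiv.prodAssoc (α := ℝ) (β := Space n) (γ := Space n))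
      (volume.prod volume) (volume.prod (volume.prod volume)) :=
    measurePreserving_prodAssoc volume volume volume
  have h2 : MeasurePreserving (Prod.map id Prod.swap : ℝ × Space n × Space n → _)
      (volume.prod (volume.prod volume)) (volume.prod (volume.prod volume)) :=
    (MeasurePreserving.id _).prod Measure.measurePreserving_swap
  exact (h1.symm.comp h2).comp h1

/-- The adjoint of convolution with `Φ` is convolution with the reflected kernel. Measurability gives
access to Fubini's theorem; see `integral_cv_mul` for the general case. -/
lemma integral_cv_mul_of_measurable (Φ : 𝓢(Space n, ℂ)) (k : ℤ) {w f : SpaceTime n → ℂ}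
    (hw : Measurable w) (hf : Measurable f) (hw2 : MemLp w 2 volume) (hf2 : MemLp f 2 volume) :
    ∫ z, cv (sc Φ k) w z * f z = ∫ z, w z * cv (sc (reflect Φ) k) f z := by
  set G : SpaceTime n × Space n → ℂ := fun p =>
    sc Φ k (p.1.2 - p.2) * w (p.1.1, p.2) * f p.1 with hG
  have hKm := (sc Φ k).continuous.measurable
  have hGm : Measurable G := by fun_prop
  have hGi : Integrable G (volume.prod volume) := by
    refine ⟨hGm.aestronglyMeasurable, ?_⟩
    rw [hasFiniteIntegral_iff_enorm, lintegral_prod _ hGm.enorm.aemeasurable]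
    obtain ⟨C₀, h₀⟩ := exists_enorm_sc_le Φ (n + 3)
    obtain ⟨C₁, h₁⟩ := exists_lintegral_pconv_le n
    calc ∫⁻ z : SpaceTime n, ∫⁻ y, ‖G (z, y)‖ₑ
        ≤ ∫⁻ z : SpaceTime n, C₀ * (pconv (n + 3) k (fun z => ‖w z‖ₑ) z * ‖f z‖ₑ) := by
          refine lintegral_mono fun z => ?_
          unfold pconv
          rw [← mul_assoc, ← lintegral_const_mul' _ _ (by finiteness),
            ← lintegral_mul_const' _ _ (by finiteness)]
          refine lintegral_mono fun y => ?_
          rw [hG]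
          simp only [enorm_mul]
          rw [← mul_assoc]
          gcongr
          exact h₀ _ _
      _ = C₀ * ∫⁻ z : SpaceTime n, pconv (n + 3) k (fun z => ‖w z‖ₑ) z * ‖f z‖ₑ :=
          lintegral_const_mul' _ _ (by finiteness)
      _ < ⊤ := by
          refine ENNReal.mul_lt_top (by finiteness) ?_
          have hsq := lintegral_mul_sq_le (μ := volume)
            (measurable_pconv (n + 3) k hw.enorm).aemeasurable hf.enorm.aemeasurable
          have h2 : (∫⁻ z, pconv (n + 3) k (fun z => ‖w z‖ₑ) z ^ 2) * ∫⁻ z, ‖f z‖ₑ ^ 2 < ⊤ := by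
            refine ENNReal.mul_lt_top ((h₁ k _ hw2.1.enorm).trans_lt ?_) ?_
            · rw [← eLpNorm_two_sq]
              exact ENNReal.mul_lt_top (by finiteness) (ENNReal.pow_lt_top hw2.2)
            · rw [← eLpNorm_two_sq]; exact ENNReal.pow_lt_top hf2.2
          exact (ENNReal.pow_lt_top_iff.1 (hsq.trans_lt h2)).resolve_right (by norm_num)
  have hσ := measurePreserving_swap (n := n)
  have hσe : MeasurableEmbedding
      (fun p : SpaceTime n × Space n => (((p.1.1, p.2), p.1.2) : SpaceTime n × Space n)) :=
    MeasurableEquiv.measurableEmbedding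
      { toFun := fun p => ((p.1.1, p.2), p.1.2)
        invFun := fun p => ((p.1.1, p.2), p.1.2)
        left_inv := fun _ => rfl
        right_inv := fun _ => rfl
        measurable_toFun := by dsimp; fun_prop
        measurable_invFun := by dsimp; fun_prop }
  have e := hσ.integral_comp hσe G
  rw [integral_prod _ hGi, integral_prod (fun p : SpaceTime n × Space n =>
    G ((p.1.1, p.2), p.1.2)) (hσ.integrable_comp_of_integrable hGi)] at e
  calc ∫ z, cv (sc Φ k) w z * f z = ∫ z : SpaceTime n, ∫ y, G (z, y) := by
        congr 1 with z
        rw [cv_eq, ← integral_mul_const]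
    _ = _ := by
        rw [← e]
        congr 1 with z
        rw [cv_eq, ← integral_const_mul]
        congr 1 with y
        simp only [hG, sc_reflect, neg_sub]
        ring

lemma integral_cv_mul (Φ : 𝓢(Space n, ℂ)) (k : ℤ) {w f : SpaceTime n → ℂ}
    (hw : MemLp w 2 volume) (hf : MemLp f 2 volume) :
    ∫ z, cv (sc Φ k) w z * f z = ∫ z, w z * cv (sc (reflect Φ) k) f z := by
  have e1 := hw.1.ae_eq_mk
  have e2 := hf.1.ae_eq_mk
  have h := integral_cv_mul_of_measurable Φ k hw.1.stronglyMeasurable_mk.measurable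
    hf.1.stronglyMeasurable_mk.measurable (hw.ae_eq e1) (hf.ae_eq e2)
  calc _ = _ := integral_congr_ae ((cv_congr_ae (sc Φ k) e1).mul e2)
    _ = _ := h
    _ = _ := integral_congr_ae (e1.symm.mul (cv_congr_ae (sc (reflect Φ) k) e2.symm))

/-- The dual of `exists_dual_bound`: a sum of functions `T_l w_l` localized at the frequencies
`2^l` is bounded in `L²(|x| ≤ 2^j)` by the square function of the norms `‖w_l‖_{X_l}`. -/
lemma exists_eLpNorm_cyl_sum_le (hn : 2 ≤ n) {Φ : 𝓢(Space n, ℂ)} (hΦ : Annular Φ) :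
    ∃ C : ℝ≥0, ∀ (j : ℤ) (F : Finset ℤ) (w : ℤ → SpaceTime n → ℂ),
      (∀ l ∈ F, MemLp (w l) 2 volume) →
      eLpNorm (fun z => ∑ l ∈ F, cv (sc Φ l) (w l) z) 2 (volume.restrict (cyl n j)) ≤
        C * (pw (j / 2) * (∑' l, xkNorm l (w l) ^ 2) ^ (1 / 2 : ℝ)) := by
  obtain ⟨C, hC⟩ := exists_dual_bound hn hΦ.reflect
  refine ⟨C, fun j F w hw => ?_⟩
  -- The sum `V` is tested against its own conjugate on `|x| ≤ 2^j`, and `‖V‖ ≤ …` follows from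
  -- `‖V‖² ≤ … ‖V‖`.
  set V : SpaceTime n → ℂ := fun z => ∑ l ∈ F, cv (sc Φ l) (w l) z with hV
  have hVm : MemLp V 2 volume := memLp_finsetSum _ fun l hl => memLp_cv Φ l (hw l hl)
  set f : SpaceTime n → ℂ := (cyl n j).indicator (star V) with hfdef
  have hf : MemLp f 2 volume := hVm.star.indicator (measurableSet_cyl n j)
  obtain ⟨D, hD1, hD2⟩ := hC j f hf fun z hz => Set.indicator_of_notMem hz _
  set A := eLpNorm V 2 (volume.restrict (cyl n j)) with hA
  have hfA : eLpNorm f 2 volume = A := by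
    rw [hfdef, eLpNorm_indicator_eq_eLpNorm_restrict (measurableSet_cyl n j), hA]
    exact eLpNorm_congr_norm_ae (ae_of_all _ fun z => by simp)
  have hAtop : A ≠ ⊤ := ((eLpNorm_mono_measure _ Measure.restrict_le_self).trans_lt hVm.2).ne
  have hVf : ∀ z, V z * f z = ((cyl n j).indicator (fun z => ‖V z‖ ^ 2) z : ℝ) := fun z => by
    by_cases h : z ∈ cyl n j
    · rw [hfdef, Set.indicator_of_mem h, Set.indicator_of_mem h]
      simp only [Pi.star_apply, RCLike.star_def]
      rw [RCLike.mul_conj]; norm_cast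
    · rw [hfdef, Set.indicator_of_notMem h, Set.indicator_of_notMem h]; simp
  have key : A ^ 2 ≤ (C * (pw (j / 2) * A)) * (∑' l, xkNorm l (w l) ^ 2) ^ (1 / 2 : ℝ) := by
    calc A ^ 2 = ‖∫ z, V z * f z‖ₑ := by
          simp_rw [hVf]
          rw [integral_complex_ofReal, integral_indicator (measurableSet_cyl n j), hA,
            eLpNorm_two_sq, ← ofReal_norm, Complex.norm_real, Real.norm_of_nonneg (by positivity),
            ofReal_integral_eq_lintegral_ofReal
              ((hVm.restrict _).integrable_norm_pow (by norm_num)) (ae_of_all _ fun z => by positivity)]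
          congr 1 with z
          rw [ENNReal.ofReal_pow (norm_nonneg _), ofReal_norm]
      _ = ‖∑ l ∈ F, ∫ z, w l z * cv (sc (reflect Φ) l) f z‖ₑ := by
          congr 1
          rw [← Finset.sum_congr rfl fun l hl => integral_cv_mul Φ l (hw l hl) hf,
            ← integral_finsetSum]
          · simp_rw [hV, Finset.sum_mul]
          · intro l hl
            exact (memLp_cv Φ l (hw l hl)).integrable_mul hf
      _ ≤ ∑ l ∈ F, D l * xkNorm l (w l) := by
          refine (enorm_sum_le _ _).trans (Finset.sum_le_sum fun l hl => ?_)
          refine (enorm_integral_le_lintegral_enorm _).trans ?_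
          simp_rw [enorm_mul, mul_comm ‖w l _‖ₑ]
          exact hD1 l _ (hw l hl).1
      _ ≤ ∑' l, D l * xkNorm l (w l) := ENNReal.sum_le_tsum _
      _ ≤ _ := by
          apply le_of_sq_le_sq
          rw [mul_pow _ (_ ^ (1 / 2 : ℝ)), sqrt_sq, ← hfA]
          exact (tsum_mul_sq_le _ _).trans (mul_le_mul' hD2 le_rfl)
  rcases eq_or_ne A 0 with h0 | h0
  · rw [h0]; exact zero_le
  · rw [← ENNReal.mul_le_mul_iff_right h0 hAtop]
    calc A * A = A ^ 2 := (sq A).symm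
      _ ≤ _ := key
      _ = _ := by ring

/-! ### Fourier multipliers -/

lemma fourierInv_fourier (f : 𝓢(Space n, ℂ)) : 𝓕⁻ (𝓕 f : 𝓢(Space n, ℂ)) = f :=
  FourierPair.fourierInv_fourier_eq f

lemma schwartz_ext_fourier {f g : 𝓢(Space n, ℂ)} (h : ∀ ξ, 𝓕 f ξ = 𝓕 g ξ) : f = g := by
  have : 𝓕 f = 𝓕 g := by ext ξ; exact h ξ
  rw [← fourierInv_fourier f, this, fourierInv_fourier]

lemma fourier_deriv (e : Space n) (f : 𝓢(Space n, ℂ)) (ξ : Space n) :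
    𝓕 (∂_{e} f) ξ = 2 * Real.pi * Complex.I * ((inner ℝ ξ e : ℝ) : ℂ) * 𝓕 f ξ := by
  have h : Function.HasTemperateGrowth (fun x : Space n => inner ℝ x e) := by fun_prop
  rw [fourier_lineDerivOp_eq, smul_apply, smulLeftCLM_apply_apply h, smul_eq_mul,
    Complex.real_smul]
  ring

/-- The convolution of two kernels. -/
def conv (K L : 𝓢(Space n, ℂ)) : 𝓢(Space n, ℂ) := convolution (ContinuousLinearMap.mul ℂ ℂ) K L

lemma cv_conv (K L : 𝓢(Space n, ℂ)) {f : SpaceTime n → ℂ} (hf : Tame f) :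
    cv K (cv L f) = cv (conv K L) f := by
  refine cv_cv (fun x => ?_) hf
  rw [conv, convolution_apply, convolution_def]
  rfl

lemma cv_cv_comm_of_fourier {K L K' L' : 𝓢(Space n, ℂ)}
    (h : ∀ ξ, 𝓕 K ξ * 𝓕 L ξ = 𝓕 K' ξ * 𝓕 L' ξ) {f : SpaceTime n → ℂ} (hf : Tame f) :
    cv K (cv L f) = cv K' (cv L' f) := by
  rw [cv_conv _ _ hf, cv_conv _ _ hf]
  congr 2
  refine schwartz_ext_fourier fun ξ => ?_
  rw [conv, conv, fourier_conv, fourier_conv, h]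

lemma tame_schwartz (u : 𝓢(SpaceTime n, ℂ)) : Tame u := by
  refine ⟨u.continuous.measurable, fun t => ?_⟩
  obtain ⟨M, -, hM⟩ := exists_bound (slice t u)
  exact ⟨M, hM⟩

lemma dx_schwartz (e : Space n) (u : 𝓢(SpaceTime n, ℂ)) :
    dx e u = (∂_{((0, e) : SpaceTime n)} u : 𝓢(SpaceTime n, ℂ)) := by
  ext z
  rw [dx_eq_lineDeriv, lineDerivOp_apply]

lemma slice_deriv (t : ℝ) (e : Space n) (u : 𝓢(SpaceTime n, ℂ)) :
    slice t (∂_{((0, e) : SpaceTime n)} u) = ∂_{e} (slice t u) := by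
  ext x
  rw [slice_apply, ← dx_schwartz, lineDerivOp_apply]
  rfl

lemma cv_dx_schwartz (K : 𝓢(Space n, ℂ)) (e : Space n) (u : 𝓢(SpaceTime n, ℂ)) :
    cv K (dx e u) = cv (∂_{e} K : 𝓢(Space n, ℂ)) u := by
  ext z
  rw [dx_schwartz, cv_schwartz, cv_schwartz, slice_deriv]
  congr 1
  refine schwartz_ext_fourier fun ξ => ?_
  rw [fourier_conv, fourier_conv, fourier_deriv, fourier_deriv]
  ring

/-- Differentiating a rescaled kernel produces the factor `2^k`. -/
lemma deriv_sc (Φ : 𝓢(Space n, ℂ)) (k : ℤ) (e : Space n) :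
    ∂_{e} (sc Φ k) = ((2 : ℝ) ^ k) • sc (∂_{e} Φ) k := by
  refine schwartz_ext_fourier fun ξ => ?_
  have h2 : (0 : ℝ) < (2 : ℝ) ^ k := by positivity
  rw [fourier_deriv, fourier_sc]
  have h3 : 𝓕 (((2 : ℝ) ^ k) • sc (∂_{e} Φ) k) = ((2 : ℝ) ^ k) • 𝓕 (sc (∂_{e} Φ) k) :=
    FourierTransform.fourier_smul _ _
  rw [h3, smul_apply, fourier_sc, fourier_deriv, inner_smul_left]
  simp only [Complex.real_smul, conj_trivial]
  push_cast
  have h4 : (2 : ℂ) ^ k * (2 : ℂ) ^ (-k) = 1 := by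
    rw [← zpow_add₀ (by norm_num)]; simp
  linear_combination (-(2 * Real.pi * Complex.I * ((inner ℝ ξ e : ℝ) : ℂ) *
    𝓕 Φ ((2 : ℝ) ^ (-k) • ξ))) * h4

lemma Annular.deriv {Φ : 𝓢(Space n, ℂ)} (h : Annular Φ) (e : Space n) : Annular (∂_{e} Φ) := by
  obtain ⟨R, hR, h⟩ := h
  refine ⟨R, hR, fun ξ hξ => h ξ ?_⟩
  rw [fourier_deriv] at hξ
  exact right_ne_zero_of_mul hξ

/-- A kernel with symbol supported in an annulus is a divergence `∑_i ∂_i ρ_i` of such kernels: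
the symbol of `ρ_i` is `ξ_i / (2πi |ξ|²)` times that of the kernel. -/
lemma Annular.exists_eq_sum_deriv {Φ : 𝓢(Space n, ℂ)} (h : Annular Φ) :
    ∃ ρ : Fin n → 𝓢(Space n, ℂ), (∀ i, Annular (ρ i)) ∧
      Φ = ∑ i, ∂_{(EuclideanSpace.single i (1 : ℝ) : Space n)} (ρ i) := by
  obtain ⟨R, hR, h⟩ := h
  set m : Fin n → Space n → ℂ := fun i ξ =>
    (2 * Real.pi * Complex.I)⁻¹ * ((ξ i / ‖ξ‖ ^ 2 : ℝ) : ℂ) * 𝓕 Φ ξ with hm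
  have hsupp : ∀ ξ, 𝓕 Φ ξ ≠ 0 → ξ ≠ 0 := fun ξ hξ h0 => by
    have := (h ξ hξ).1
    rw [h0, norm_zero] at this
    have : 0 < R⁻¹ := by positivity
    linarith
  have hc : ∀ i, HasCompactSupport (m i) := fun i => by
    refine HasCompactSupport.intro (isCompact_closedBall (0 : Space n) R) fun ξ hξ => ?_
    have : 𝓕 Φ ξ = 0 := by
      by_contra h0
      exact hξ (by simpa using (h ξ h0).2)
    simp [hm, this]
  have hs : ∀ i, ContDiff ℝ ∞ (m i) := fun i => by
    rw [contDiff_iff_contDiffAt]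
    intro ξ
    by_cases h0 : ξ = 0
    · have : m i =ᶠ[𝓝 ξ] fun _ => 0 := by
        rw [h0]
        filter_upwards [Metric.ball_mem_nhds (0 : Space n) (inv_pos.2 hR)] with η hη
        have : 𝓕 Φ η = 0 := by
          by_contra h1
          have h2 := (h η h1).1
          rw [Metric.mem_ball, dist_zero_right] at hη
          linarith
        simp [hm, this]
      exact contDiffAt_const.congr_of_eventuallyEq this
    · have h1 : ContDiffAt ℝ ∞ (fun ξ : Space n => ξ i) ξ :=
        (EuclideanSpace.proj i : Space n →L[ℝ] ℝ).contDiff.contDiffAt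
      have h2 : ContDiffAt ℝ ∞ (fun ξ : Space n => ‖ξ‖ ^ 2) ξ := (contDiff_norm_sq ℝ).contDiffAt
      have h3 : ContDiffAt ℝ ∞ (fun ξ : Space n => ξ i / ‖ξ‖ ^ 2) ξ :=
        h1.div h2 (by simpa using h0)
      exact (contDiffAt_const.mul (Complex.ofRealCLM.contDiff.contDiffAt.comp ξ h3)).mul
        ((𝓕 Φ).smooth ⊤).contDiffAt
  set ρ : Fin n → 𝓢(Space n, ℂ) := fun i => 𝓕⁻ ((hc i).toSchwartzMap (hs i)) with hρ
  have hF : ∀ i ξ, 𝓕 (ρ i) ξ = m i ξ := fun i ξ => by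
    rw [hρ, FourierTransform.fourier_fourierInv_eq]; rfl
  refine ⟨ρ, fun i => ⟨R, hR, fun ξ hξ => h ξ ?_⟩, schwartz_ext_fourier fun ξ => ?_⟩
  · rw [hF] at hξ; exact right_ne_zero_of_mul hξ
  · have e1 : 𝓕 (∑ i, ∂_{(EuclideanSpace.single i (1 : ℝ) : Space n)} (ρ i)) =
        ∑ i, 𝓕 (∂_{(EuclideanSpace.single i (1 : ℝ) : Space n)} (ρ i)) :=
      map_sum (fourierTransformCLM ℂ) _ _
    rw [e1, sum_apply]
    simp_rw [fourier_deriv, hF, hm]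
    by_cases h0 : 𝓕 Φ ξ = 0
    · simp [h0]
    · have hne : ‖ξ‖ ^ 2 ≠ 0 := by simpa using hsupp ξ h0
      have e2 : ∑ i, ((inner ℝ ξ (EuclideanSpace.single i (1 : ℝ)) : ℝ) : ℂ) *
          ((ξ i / ‖ξ‖ ^ 2 : ℝ) : ℂ) = 1 := by
        have h1 : ∑ i, ξ i * (ξ i / ‖ξ‖ ^ 2) = 1 := by
          rw [← div_self hne]
          nth_rewrite 2 [EuclideanSpace.real_norm_sq_eq]
          rw [Finset.sum_div]
          exact Finset.sum_congr rfl fun i _ => by ring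
        have h3 := congrArg (fun r : ℝ => (r : ℂ)) h1
        push_cast at h3
        simpa [EuclideanSpace.inner_single_right] using h3
      have h2 : (2 * Real.pi * Complex.I : ℂ) ≠ 0 := by
        simp [Real.pi_ne_zero]
      calc 𝓕 Φ ξ = (∑ i, ((inner ℝ ξ (EuclideanSpace.single i (1 : ℝ)) : ℝ) : ℂ) *
          ((ξ i / ‖ξ‖ ^ 2 : ℝ) : ℂ)) * 𝓕 Φ ξ := by rw [e2, one_mul]
        _ = _ := by
          rw [Finset.sum_mul]
          refine Finset.sum_congr rfl fun i _ => ?_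
          field_simp

/-! ### The Littlewood–Paley decomposition -/

namespace LittlewoodPaley

variable (S : LittlewoodPaley n)

lemma contDiff_symbol : ContDiff ℝ ∞ fun ξ : Space n => ((S.symbol ((2 * Real.pi) • ξ) : ℝ) : ℂ) :=
  Complex.ofRealCLM.contDiff.comp (S.smooth.comp (contDiff_const_smul _))

lemma bounds_of_ne_zero {ξ : Space n} (h : S.symbol ξ ≠ 0) : 1 / 2 < ‖ξ‖ ∧ ‖ξ‖ < 2 :=
  S.supp (subset_tsupport _ h)

lemma norm_two_pi_smul (ξ : Space n) : ‖(2 * Real.pi) • ξ‖ = 2 * Real.pi * ‖ξ‖ := by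
  rw [norm_smul, Real.norm_of_nonneg (by positivity)]

lemma hasCompactSupport_symbol :
    HasCompactSupport fun ξ : Space n => ((S.symbol ((2 * Real.pi) • ξ) : ℝ) : ℂ) := by
  refine HasCompactSupport.intro (isCompact_closedBall (0 : Space n) 2) fun ξ hξ => ?_
  by_contra h0
  have h1 := (S.bounds_of_ne_zero (by exact_mod_cast h0)).2
  rw [norm_two_pi_smul] at h1
  rw [Metric.mem_closedBall, dist_zero_right, not_le] at hξ
  nlinarith [Real.pi_gt_three]

/-- The convolution kernel of `S_0`, as a Schwartz function. -/
def prof : 𝓢(Space n, ℂ) :=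
  𝓕⁻ (S.hasCompactSupport_symbol.toSchwartzMap S.contDiff_symbol)

lemma fourier_prof (ξ : Space n) : 𝓕 S.prof ξ = ((S.symbol ((2 * Real.pi) • ξ) : ℝ) : ℂ) := by
  rw [prof, FourierTransform.fourier_fourierInv_eq]; rfl

lemma annular_prof : Annular S.prof := by
  refine ⟨4 * Real.pi, by positivity, fun ξ hξ => ?_⟩
  rw [fourier_prof] at hξ
  have h := S.bounds_of_ne_zero (by exact_mod_cast hξ)
  rw [norm_two_pi_smul] at h
  refine ⟨?_, ?_⟩
  · rw [inv_le_iff_one_le_mul₀ (by positivity)]; linarith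
  · nlinarith [Real.pi_gt_three, norm_nonneg ξ]

lemma kernel_eq (k : ℤ) : S.kernel k = sc S.prof k := by
  rw [← fourierInv_fourier (sc S.prof k), fourierInv_coe, kernel]
  congr 1 with ξ
  rw [fourier_sc, fourier_prof, smul_comm]

lemma proj_eq (k : ℤ) (f : SpaceTime n → ℂ) : S.proj k f = cv (sc S.prof k) f := by
  ext z
  simp only [proj, cv, kernel_eq, smul_eq_mul]

/-- The kernel of a multiplier whose symbol equals `1` on the support of that of `S_0`. -/
def wide : 𝓢(Space n, ℂ) := ∑ i ∈ Finset.Icc (-1 : ℤ) 1, sc S.prof i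

lemma fourier_wide (ξ : Space n) :
    𝓕 S.wide ξ = ∑ i ∈ Finset.Icc (-1 : ℤ) 1, 𝓕 S.prof ((2 : ℝ) ^ (-i) • ξ) := by
  have e1 : 𝓕 (∑ i ∈ Finset.Icc (-1 : ℤ) 1, sc S.prof i) =
        ∑ i ∈ Finset.Icc (-1 : ℤ) 1, 𝓕 (sc S.prof i) :=
      map_sum (fourierTransformCLM ℂ) _ _
  rw [wide, e1, sum_apply]
  simp_rw [fourier_sc]

lemma annular_wide : Annular S.wide := by
  obtain ⟨R, hR, h⟩ := S.annular_prof
  refine ⟨2 * R, by positivity, fun ξ hξ => ?_⟩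
  rw [fourier_wide] at hξ
  obtain ⟨i, hi, h0⟩ := Finset.exists_ne_zero_of_sum_ne_zero hξ
  have h1 := h _ h0
  rw [norm_smul, Real.norm_of_nonneg (by positivity)] at h1
  rw [Finset.mem_Icc] at hi
  have h2 : (2 : ℝ) ^ (-i) ≤ 2 := by
    calc (2 : ℝ) ^ (-i) ≤ (2 : ℝ) ^ (1 : ℤ) := zpow_le_zpow_right₀ (by norm_num) (by omega)
      _ = 2 := by norm_num
  have h3 : (2 : ℝ)⁻¹ ≤ (2 : ℝ) ^ (-i) := by
    calc (2 : ℝ)⁻¹ = (2 : ℝ) ^ (-1 : ℤ) := by norm_num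
      _ ≤ _ := zpow_le_zpow_right₀ (by norm_num) (by omega)
  have h4 := norm_nonneg ξ
  constructor
  · rw [mul_inv]
    have : (2 : ℝ) ^ (-i) * ‖ξ‖ ≤ 2 * ‖ξ‖ := by gcongr
    linarith
  · have : (2 : ℝ)⁻¹ * ‖ξ‖ ≤ (2 : ℝ) ^ (-i) * ‖ξ‖ := by gcongr
    linarith

lemma symbol_eq_zero {ξ : Space n} {k : ℤ} (h : 1 / 2 < ‖ξ‖ ∧ ‖ξ‖ < 2)
    (hk : k ∉ Finset.Icc (-1 : ℤ) 1) : S.symbol ((2 : ℝ) ^ (-k) • ξ) = 0 := by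
  by_contra h0
  have h1 := S.bounds_of_ne_zero h0
  rw [norm_smul, Real.norm_of_nonneg (by positivity)] at h1
  have hn := norm_nonneg ξ
  rw [Finset.mem_Icc, not_and_or, not_le, not_le] at hk
  rcases hk with hk | hk
  · have : (2 : ℝ) ^ (2 : ℤ) ≤ (2 : ℝ) ^ (-k) := zpow_le_zpow_right₀ (by norm_num) (by omega)
    rw [show (2 : ℝ) ^ (2 : ℤ) = 4 by norm_num] at this
    nlinarith
  · have : (2 : ℝ) ^ (-k) ≤ (2 : ℝ) ^ (-2 : ℤ) := zpow_le_zpow_right₀ (by norm_num) (by omega)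
    rw [show (2 : ℝ) ^ (-2 : ℤ) = 1 / 4 by norm_num] at this
    nlinarith

lemma fourier_wide_mul (ξ : Space n) : 𝓕 S.wide ξ * 𝓕 S.prof ξ = 𝓕 S.prof ξ := by
  by_cases h0 : 𝓕 S.prof ξ = 0
  · simp [h0]
  · have h1 := h0
    rw [fourier_prof] at h1
    have hb := S.bounds_of_ne_zero (by exact_mod_cast h1)
    have hne : (2 * Real.pi) • ξ ≠ 0 := fun h => by
      rw [h, norm_zero] at hb; linarith [hb.1]
    have hs := S.sum_eq_one _ hne
    rw [tsum_eq_sum fun k hk => S.symbol_eq_zero hb hk] at hs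
    have : 𝓕 S.wide ξ = 1 := by
      rw [fourier_wide, ← Complex.ofReal_one, ← hs]
      push_cast
      refine Finset.sum_congr rfl fun i _ => ?_
      rw [fourier_prof, smul_comm]
    rw [this, one_mul]

lemma wide_proj (k : ℤ) {f : SpaceTime n → ℂ} (hf : Tame f) :
    cv (sc S.wide k) (cv (sc S.prof k) f) = cv (sc S.prof k) f := by
  rw [cv_conv _ _ hf]
  congr 2
  refine schwartz_ext_fourier fun ξ => ?_
  rw [conv, fourier_conv, fourier_sc, fourier_sc, fourier_wide_mul]

lemma hasSum_fourier_prof {ξ : Space n} (hξ : ξ ≠ 0) :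
    HasSum (fun k : ℤ => 𝓕 S.prof ((2 : ℝ) ^ (-k) • ξ)) 1 := by
  have hne : (2 * Real.pi) • ξ ≠ 0 := smul_ne_zero (by positivity) hξ
  have h1 := S.sum_eq_one _ hne
  have h2 : Summable fun k : ℤ => S.symbol ((2 : ℝ) ^ (-k) • (2 * Real.pi) • ξ) := by
    by_contra h
    rw [tsum_eq_zero_of_not_summable h] at h1
    norm_num at h1
  have h3 := h2.hasSum
  rw [h1] at h3
  have h4 := Complex.hasSum_ofReal.2 h3
  simpa only [fourier_prof, smul_comm (2 * Real.pi), Complex.ofReal_one] using h4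

/-- The partial sums `∑_{|l| ≤ N} S_l v`. -/
def partialSum (N : ℕ) (v : SpaceTime n → ℂ) (z : SpaceTime n) : ℂ :=
  ∑ l ∈ Finset.Icc (-N : ℤ) N, cv (sc S.prof l) v z

lemma cv_eq_fourierInv (K : 𝓢(Space n, ℂ)) (v : 𝓢(SpaceTime n, ℂ)) (t : ℝ) (x : Space n) :
    cv K v (t, x) =
      ∫ ξ, Real.fourierChar (inner ℝ ξ x) • (𝓕 K ξ * 𝓕 (slice t v) ξ) := by
  rw [cv_schwartz, ← fourierInv_fourier
    (convolution (ContinuousLinearMap.mul ℂ ℂ) K (slice t v)), fourierInv_coe, Real.fourierInv_eq]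
  simp_rw [fourier_conv]

lemma partialSum_eq (N : ℕ) (v : 𝓢(SpaceTime n, ℂ)) (t : ℝ) (x : Space n) :
    S.partialSum N v (t, x) = ∫ ξ, Real.fourierChar (inner ℝ ξ x) •
      ((∑ l ∈ Finset.Icc (-N : ℤ) N, 𝓕 S.prof ((2 : ℝ) ^ (-l) • ξ)) * 𝓕 (slice t v) ξ) := by
  unfold partialSum
  simp_rw [cv_eq_fourierInv, fourier_sc]
  rw [← integral_finsetSum]
  · congr 1 with ξ
    rw [Finset.sum_mul, Finset.smul_sum]
  · intro l _
    have h1 : Integrable fun ξ => 𝓕 (sc S.prof l) ξ * 𝓕 (slice t v) ξ := by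
      have h := (𝓕 (convolution (ContinuousLinearMap.mul ℂ ℂ) (sc S.prof l)
        (slice t v))).integrable (μ := volume)
      refine h.congr (ae_of_all _ fun ξ => ?_)
      rw [fourier_conv]
    simp_rw [fourier_sc] at h1
    have h2 := (Real.fourierIntegral_convergent_iff' (innerSL ℝ) (-x)).2 h1
    refine h2.congr (ae_of_all _ fun ξ => ?_)
    simp only [map_neg, neg_neg]
    rfl

/-- The partial sums are bounded uniformly in `N`, because their symbols are. -/
lemma exists_norm_partialSum_le (v : 𝓢(SpaceTime n, ℂ)) (t : ℝ) :
    ∃ M : ℝ, ∀ N x, ‖S.partialSum N v (t, x)‖ ≤ M := by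
  obtain ⟨C, hC0, hC⟩ := exists_sum_norm_le S.annular_prof
  refine ⟨∫ ξ, C * ‖𝓕 (slice t v) ξ‖, fun N x => ?_⟩
  rw [partialSum_eq]
  refine norm_integral_le_of_norm_le (((𝓕 (slice t v)).integrable).norm.const_mul C)
    (ae_of_all _ fun ξ => ?_)
  rw [Circle.norm_smul, norm_mul]
  gcongr
  exact (norm_sum_le _ _).trans (hC _ ξ)

/-- The Littlewood–Paley decomposition of a Schwartz function converges pointwise. -/
lemma tendsto_partialSum (hn : n ≠ 0) (v : 𝓢(SpaceTime n, ℂ)) (z : SpaceTime n) :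
    Tendsto (fun N => S.partialSum N v z) atTop (𝓝 (v z)) := by
  obtain ⟨C, hC0, hC⟩ := exists_sum_norm_le S.annular_prof
  obtain ⟨t, x⟩ := z
  have e : v (t, x) = ∫ ξ, Real.fourierChar (inner ℝ ξ x) • 𝓕 (slice t v) ξ := by
    rw [← slice_apply, ← fourierInv_fourier (slice t v), fourierInv_coe,
      Real.fourierInv_eq, fourierInv_fourier]
  rw [e]
  simp_rw [partialSum_eq]
  have hcont : Continuous fun ξ : Space n => Real.fourierChar (inner ℝ ξ x) :=
    Real.continuous_fourierChar.comp (by fun_prop)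
  refine tendsto_integral_of_dominated_convergence (fun ξ => C * ‖𝓕 (slice t v) ξ‖)
    (fun N => ?_) (((𝓕 (slice t v)).integrable).norm.const_mul C) (fun N => ae_of_all _ fun ξ => ?_)
    ?_
  · have h1 := (𝓕 S.prof).continuous
    have h2 := (𝓕 (slice t v)).continuous
    have h3 : ∀ l : ℤ, Continuous fun ξ : Space n => 𝓕 S.prof ((2 : ℝ) ^ (-l) • ξ) := fun l =>
      h1.comp (continuous_const_smul _)
    exact (hcont.smul ((continuous_finsetSum _ fun l _ => h3 l).mul h2)).aestronglyMeasurable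
  · rw [Circle.norm_smul, norm_mul]
    gcongr
    exact (norm_sum_le _ _).trans (hC _ ξ)
  · have : Nonempty (Fin n) := ⟨⟨0, Nat.pos_of_ne_zero hn⟩⟩
    have h : ∀ᵐ ξ : Space n, ξ ≠ 0 := by simp [ae_iff]
    filter_upwards [h] with ξ hξ
    have h1 : Tendsto (fun N : ℕ => Finset.Icc (-N : ℤ) N) atTop atTop := by
      refine tendsto_atTop_finset_of_monotone (fun a b hab => ?_) fun l => ⟨l.natAbs, ?_⟩
      · exact Finset.Icc_subset_Icc (by simpa using hab) (by simpa using hab)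
      · rw [Finset.mem_Icc]; omega
    have h2 := (S.hasSum_fourier_prof hξ).comp h1
    have h3 := (h2.mul_const (𝓕 (slice t v) ξ)).const_smul (Real.fourierChar (inner ℝ ξ x))
    rw [one_mul] at h3
    exact h3

lemma _root_.LocEnergy.sc_eq_sum_deriv {Φ : 𝓢(Space n, ℂ)} {ρ : Fin n → 𝓢(Space n, ℂ)}
    (hρ : Φ = ∑ i, ∂_{(EuclideanSpace.single i (1 : ℝ) : Space n)} (ρ i)) (k : ℤ) :
    sc Φ k = ((2 : ℝ) ^ (-k)) •
      ∑ i, ∂_{(EuclideanSpace.single i (1 : ℝ) : Space n)} (sc (ρ i) k) := by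
  have h2 : (2 : ℝ) ^ (-k) * (2 : ℝ) ^ k = 1 := by rw [← zpow_add₀ (by norm_num)]; simp
  simp_rw [deriv_sc]
  rw [← Finset.smul_sum, smul_smul, h2, one_smul, hρ]
  ext y
  simp only [sc_apply, sum_apply, Finset.smul_sum]

/-- `S_l u = 2^{-l} ∑_i T_i S_l ∂_i u`, with multipliers `T_i` at frequency `2^l`. -/
lemma proj_eq_sum_deriv {ρ : Fin n → 𝓢(Space n, ℂ)}
    (hρ : S.wide = ∑ i, ∂_{(EuclideanSpace.single i (1 : ℝ) : Space n)} (ρ i))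
    (l : ℤ) (u : 𝓢(SpaceTime n, ℂ)) (z : SpaceTime n) :
    cv (sc S.prof l) u z = ((2 : ℝ) ^ (-l) : ℝ) * ∑ i, cv (sc (ρ i) l) (cv (sc S.prof l)
      (dx (EuclideanSpace.single i (1 : ℝ)) u)) z := by
  have hu := tame_schwartz u
  rw [← S.wide_proj l hu, sc_eq_sum_deriv hρ, cv_kernel_smul, cv_kernel_sum (hu.cv _)]
  congr 1
  refine Finset.sum_congr rfl fun i _ => ?_
  rw [cv_dx_schwartz]
  refine congrFun (cv_cv_comm_of_fourier (fun ξ => ?_) hu) z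
  rw [fourier_deriv, fourier_deriv]
  ring

end LittlewoodPaley

/-! ### Dual norms -/

lemma xkNorm_mono {F G : Type*} [NormedAddCommGroup F] [NormedAddCommGroup G] (k : ℤ)
    {u : SpaceTime n → F} {v : SpaceTime n → G} (h : ∀ z, ‖u z‖ ≤ ‖v z‖) :
    xkNorm k u ≤ xkNorm k v := by
  refine add_le_add (mul_le_mul' le_rfl (eLpNorm_mono h)) (iSup₂_mono fun j _ => ?_)
  refine eLpNorm_mono fun z => ?_
  rw [norm_mul, norm_mul, norm_norm, norm_norm]
  gcongr
  exact h z

lemma xkNorm_const_mul (k : ℤ) (c : ℂ) (w : SpaceTime n → ℂ) :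
    xkNorm k (fun z => c * w z) = ‖c‖ₑ * xkNorm k w := by
  have e1 : ∀ A : Set (SpaceTime n), eLpNorm (fun z => c * w z) 2 (volume.restrict A) =
      ‖c‖ₑ * eLpNorm w 2 (volume.restrict A) := fun A => eLpNorm_const_smul c w 2 _
  have e2 : ∀ (a : ℝ) (A : Set (SpaceTime n)), weightedL2 a A (fun z => c * w z) =
      ‖c‖ₑ * weightedL2 a A w := fun a A => by
    unfold weightedL2
    have := eLpNorm_const_smul ‖c‖ (fun z : SpaceTime n => ‖z.2‖ ^ a * ‖w z‖) 2
      (volume.restrict A)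
    rw [enorm_norm] at this
    rw [← this]
    congr 1 with z
    simp only [norm_mul, Pi.smul_apply, smul_eq_mul]
    ring
  unfold xkNorm
  simp_rw [e1, e2, ← ENNReal.mul_iSup]
  ring

lemma xkDualNorm_le {k : ℤ} {f : SpaceTime n → ℂ} {D : ℝ≥0∞}
    (h : ∀ w : SpaceTime n → ℂ, AEStronglyMeasurable w volume →
      ∫⁻ z, ‖f z‖ₑ * ‖w z‖ₑ ≤ D * xkNorm k w) : xkDualNorm k f ≤ D :=
  iSup_le fun w => iSup_le fun hw => iSup_le fun h1 =>
    (h w hw).trans ((mul_le_mul' le_rfl h1).trans_eq (mul_one D))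

lemma xkDualNorm_le_tsum {ι : Type*} [Countable ι] (k : ℤ) {f : SpaceTime n → ℂ}
    {g : ι → SpaceTime n → ℂ} (hg : ∀ i, AEStronglyMeasurable (g i) volume)
    (h : ∀ z, ‖f z‖ₑ ≤ ∑' i, ‖g i z‖ₑ) : xkDualNorm k f ≤ ∑' i, xkDualNorm k (g i) := by
  refine iSup_le fun w => iSup_le fun hw => iSup_le fun h1 => ?_
  calc ∫⁻ z, ‖f z‖ₑ * ‖w z‖ₑ ≤ ∫⁻ z, ∑' i, ‖g i z‖ₑ * ‖w z‖ₑ := by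
        refine lintegral_mono fun z => ?_
        rw [ENNReal.tsum_mul_right]
        exact mul_le_mul' (h z) le_rfl
    _ = ∑' i, ∫⁻ z, ‖g i z‖ₑ * ‖w z‖ₑ := lintegral_tsum fun i => (hg i).enorm.mul hw.enorm
    _ ≤ _ := by
        refine ENNReal.tsum_le_tsum fun i => ?_
        exact le_iSup_of_le w (le_iSup_of_le hw (le_iSup_of_le h1 le_rfl))

lemma xkDualNorm_const_mul_le (k : ℤ) (c : ℂ) (f : SpaceTime n → ℂ) :
    xkDualNorm k (fun z => c * f z) ≤ ‖c‖ₑ * xkDualNorm k f := by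
  refine iSup_le fun w => iSup_le fun hw => iSup_le fun h1 => ?_
  simp_rw [enorm_mul, mul_assoc]
  rw [lintegral_const_mul' _ _ (by finiteness)]
  exact mul_le_mul' le_rfl (le_iSup_of_le w (le_iSup_of_le hw (le_iSup_of_le h1 le_rfl)))

/-- Fatou's lemma for the dual norm. -/
lemma xkDualNorm_le_liminf (k : ℤ) {f : SpaceTime n → ℂ} {g : ℕ → SpaceTime n → ℂ}
    (hg : ∀ N, AEStronglyMeasurable (g N) volume)
    (h : ∀ z, Tendsto (fun N => g N z) atTop (𝓝 (f z))) :
    xkDualNorm k f ≤ liminf (fun N => xkDualNorm k (g N)) atTop := by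
  refine iSup_le fun w => iSup_le fun hw => iSup_le fun h1 => ?_
  have e : ∀ z, ‖f z‖ₑ * ‖w z‖ₑ = liminf (fun N => ‖g N z‖ₑ * ‖w z‖ₑ) atTop := fun z =>
    (ENNReal.Tendsto.mul_const (h z).enorm (Or.inr enorm_ne_top)).liminf_eq.symm
  simp_rw [e]
  refine (lintegral_liminf_le' fun N => (hg N).enorm.mul hw.enorm).trans
    (liminf_le_liminf (Eventually.of_forall fun N => ?_))
  exact le_iSup_of_le w (le_iSup_of_le hw (le_iSup_of_le h1 le_rfl))

/-- Fatou's lemma in `ℓ²`. -/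
lemma tsum_liminf_sq_le (d : ℕ → ℤ → ℝ≥0∞) {B : ℝ≥0∞} (h : ∀ N, ∑' k, d N k ^ 2 ≤ B) :
    ∑' k, liminf (fun N => d N k) atTop ^ 2 ≤ B := by
  have e : ∀ k, liminf (fun N => d N k) atTop ^ 2 = liminf (fun N => d N k ^ 2) atTop := fun k =>
    Monotone.map_liminf_of_continuousAt (f := fun x : ℝ≥0∞ => x ^ 2)
      (fun a b hab => pow_le_pow_left' hab 2) (fun N => d N k)
      (ENNReal.continuous_pow 2).continuousAt
  simp_rw [e]
  let _ : MeasurableSpace ℤ := ⊤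
  rw [← lintegral_count]
  refine (lintegral_liminf_le fun N => measurable_from_top).trans ?_
  simp_rw [lintegral_count]
  exact (liminf_le_liminf (Eventually.of_forall h)).trans_eq (liminf_const B)

/-- The dual Bernstein inequality, for functions supported in a ball. -/
lemma exists_xkDualNorm_cyl_le (Φ : 𝓢(Space n, ℂ)) : ∃ C : ℝ≥0, ∀ (j k : ℤ)
    (f : SpaceTime n → ℂ), AEStronglyMeasurable f volume → (∀ z ∉ cyl n j, f z = 0) →
      xkDualNorm k (cv (sc Φ k) f) ≤ C * (pw (j / 2) * al n (j + k) * eLpNorm f 2 volume) := by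
  obtain ⟨C, hC⟩ := exists_lintegral_cv_cyl_le Φ
  exact ⟨C, fun j k f hf hs => xkDualNorm_le fun w hw => hC j k f w hf hs hw⟩

/-- The dual Bernstein inequality, summed over annuli. -/
lemma exists_xkDualNorm_ann_le (hn : n ≠ 0) (Φ : 𝓢(Space n, ℂ)) : ∃ C : ℝ≥0, ∀ (k : ℤ)
    (f : SpaceTime n → ℂ), AEStronglyMeasurable f volume →
      xkDualNorm k (cv (sc Φ k) f) ≤ C * ∑' j : ℤ, pw (j / 2) * al n (j + k) *
        eLpNorm f 2 (volume.restrict (ann n (j - 1))) := by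
  obtain ⟨C, hC⟩ := exists_lintegral_cv_ann_le hn Φ
  refine ⟨C, fun k f hf => xkDualNorm_le fun w hw => ?_⟩
  refine (hC k f w hf hw).trans_eq ?_
  rw [← (Equiv.addRight (1 : ℤ)).tsum_eq fun j : ℤ => pw (j / 2) * al n (j + k) *
    eLpNorm f 2 (volume.restrict (ann n (j - 1)))]
  simp

/-- The square function of the dual norms of the pieces of a function supported in `|x| ≤ 2^j`; this
is `exists_dual_bound` in terms of the dual norms. -/
lemma exists_tsum_xkDualNorm_le (hn : 2 ≤ n) {Φ : 𝓢(Space n, ℂ)} (hΦ : Annular Φ) :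
    ∃ C : ℝ≥0, ∀ (j : ℤ) (f : SpaceTime n → ℂ), AEStronglyMeasurable f volume →
      (∀ z ∉ cyl n j, f z = 0) →
      (∑' k, xkDualNorm k (cv (sc Φ k) f) ^ 2) ^ (1 / 2 : ℝ) ≤
        C * (pw (j / 2) * eLpNorm f 2 volume) := by
  obtain ⟨C, hC⟩ := exists_dual_bound hn hΦ
  refine ⟨C + 1, fun j f hf hs => ?_⟩
  rcases eq_or_ne (eLpNorm f 2 volume) ⊤ with htop | htop
  · rw [htop, ENNReal.mul_top (pw_ne_zero _), ENNReal.mul_top (by simp)]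
    exact le_top
  · obtain ⟨D, hD1, hD2⟩ := hC j f ⟨hf, lt_top_iff_ne_top.2 htop⟩ hs
    apply sqrt_le_of_le_sq
    refine le_trans (ENNReal.tsum_le_tsum fun k => ?_) (hD2.trans ?_)
    · exact pow_le_pow_left' (xkDualNorm_le fun w hw => hD1 k w hw) 2
    · refine pow_le_pow_left' (mul_le_mul' ?_ le_rfl) 2
      exact_mod_cast le_self_add

lemma tsum_sq_le_sq_tsum {ι : Type*} (x : ι → ℝ≥0∞) : ∑' i, x i ^ 2 ≤ (∑' i, x i) ^ 2 := by
  rw [sq, ← ENNReal.tsum_mul_right]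
  refine ENNReal.tsum_le_tsum fun i => ?_
  rw [sq]
  exact mul_le_mul' le_rfl (ENNReal.le_tsum i)

/-- The kernel `al n m * 2^{tm}` is summable: the power decays as `m → ∞`, and the Bernstein factor
outweighs it as `m → -∞`. -/
lemma tsum_al_pw_ne_top {t : ℝ} (h1 : t < 0) (h2 : 0 < ((n : ℝ) - 1) / 2 + t) :
    ∑' m : ℤ, al n m * pw (t * m) ≠ ⊤ := by
  set δ := min (-t) (((n : ℝ) - 1) / 2 + t) with hδ
  have hδ0 : 0 < δ := lt_min (by linarith) h2
  refine ne_top_of_le_ne_top (tsum_pw_abs_ne_top hδ0) (ENNReal.tsum_le_tsum fun m => ?_)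
  rw [al, ← pw_add]
  apply pw_le_pw
  rcases le_or_gt 0 m with hm | hm
  · have hm' : (0 : ℝ) ≤ m := by exact_mod_cast hm
    rw [min_eq_right hm, abs_of_nonneg hm']
    have : δ ≤ -t := min_le_left _ _
    push_cast
    nlinarith
  · have hm' : (m : ℝ) < 0 := by exact_mod_cast hm
    rw [min_eq_left hm.le, abs_of_neg hm']
    have : δ ≤ ((n : ℝ) - 1) / 2 + t := min_le_right _ _
    nlinarith

/-! ### Partitions of unity in space -/

/-- Convolutions are countably subadditive with respect to partitions of unity in space. -/
lemma enorm_cv_le_tsum {ι : Type*} [Countable ι] (hn : n ≠ 0) {χ : ι → Space n → ℝ}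
    (hm : ∀ i, Measurable (χ i)) (h0 : ∀ i x, 0 ≤ χ i x)
    (h1 : ∀ x, x ≠ 0 → HasSum (fun i => χ i x) 1) (K : Space n → ℂ) (f : SpaceTime n → ℂ)
    (z : SpaceTime n) :
    ‖cv K f z‖ₑ ≤ ∑' i, ‖cv K (fun z => χ i z.2 * f z) z‖ₑ := by
  simp_rw [cv_eq]
  set g : Space n → ℂ := fun y => K (z.2 - y) * f (z.1, y) with hg
  have e0 : ∀ i y, K (z.2 - y) * (χ i y * f (z.1, y)) = χ i y * g y := fun i y => by
    rw [hg]; ring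
  simp_rw [e0]
  by_cases hi : Integrable g
  · have hne : Nonempty (Fin n) := ⟨⟨0, Nat.pos_of_ne_zero hn⟩⟩
    have hx : ∀ᵐ x : Space n, x ≠ 0 := by simp [ae_iff]
    have hen : ∀ i y, ‖(χ i y : ℂ) * g y‖ₑ = ENNReal.ofReal (χ i y) * ‖g y‖ₑ := fun i y => by
      rw [enorm_mul, ← ofReal_norm (χ i y : ℂ), Complex.norm_real, Real.norm_of_nonneg (h0 i y)]
    have hmeas : ∀ i, AEStronglyMeasurable (fun y => (χ i y : ℂ) * g y) volume := fun i =>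
      (Complex.measurable_ofReal.comp (hm i)).aestronglyMeasurable.mul hi.1
    have hfin : ∑' i, ∫⁻ y, ‖(χ i y : ℂ) * g y‖ₑ ≠ ⊤ := by
      rw [← lintegral_tsum fun i => (hmeas i).enorm]
      have : ∫⁻ y, ∑' i, ‖(χ i y : ℂ) * g y‖ₑ = ∫⁻ y, ‖g y‖ₑ := by
        refine lintegral_congr_ae ?_
        filter_upwards [hx] with y hy
        simp_rw [hen]
        rw [ENNReal.tsum_mul_right, ← ENNReal.ofReal_tsum_of_nonneg (fun i => h0 i y)
          (h1 y hy).summable, (h1 y hy).tsum_eq]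
        simp
      rw [this]
      exact hi.2.ne
    have e1 : ∫ y, g y = ∑' i, ∫ y, (χ i y : ℂ) * g y := by
      rw [← integral_tsum hmeas hfin]
      refine integral_congr_ae ?_
      filter_upwards [hx] with y hy
      rw [tsum_mul_right, ← Complex.ofReal_tsum, (h1 y hy).tsum_eq]
      simp
    rw [e1]
    exact enorm_tsum_le_tsum_enorm
  -- the left side is zero by convention
  · rw [integral_undef hi]
    simp

/-- The half-open dyadic shell `2^{J-1} ≤ |x| < 2^J`. -/
def shell (n : ℕ) (J : ℤ) : Set (Space n) := {x | (2 : ℝ) ^ (J - 1) ≤ ‖x‖ ∧ ‖x‖ < (2 : ℝ) ^ J}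

lemma measurableSet_shell (n : ℕ) (J : ℤ) : MeasurableSet (shell n J) :=
  (measurableSet_le measurable_const measurable_norm).inter
    (measurableSet_lt measurable_norm measurable_const)

lemma eq_of_mem_shell {x : Space n} {i j : ℤ} (hi : x ∈ shell n i) (hj : x ∈ shell n j) :
    i = j := by
  have h1 : (2 : ℝ) ^ (i - 1) < (2 : ℝ) ^ j := hi.1.trans_lt hj.2
  have h2 : (2 : ℝ) ^ (j - 1) < (2 : ℝ) ^ i := hj.1.trans_lt hi.2
  rw [zpow_lt_zpow_iff_right₀ (by norm_num)] at h1 h2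
  omega

lemma hasSum_shell {x : Space n} (hx : x ≠ 0) :
    HasSum (fun J => (shell n J).indicator (fun _ => (1 : ℝ)) x) 1 := by
  obtain ⟨i, hi1, hi2⟩ := exists_mem_Ico_zpow (norm_pos_iff.2 hx) (by norm_num : (1 : ℝ) < 2)
  have hmem : x ∈ shell n (i + 1) := ⟨by simpa using hi1, hi2⟩
  have := hasSum_single (f := fun J => (shell n J).indicator (fun _ => (1 : ℝ)) x) (i + 1)
    fun j hj => Set.indicator_of_notMem (fun h => hj (eq_of_mem_shell h hmem)) _
  rwa [Set.indicator_of_mem hmem] at this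

/-- Decomposition of a function into shells, in the dual norms at regularity `0`. -/
lemma exists_tsum_xkDualNorm_le_shell (hn : 2 ≤ n) {Φ : 𝓢(Space n, ℂ)} (hΦ : Annular Φ) :
    ∃ C : ℝ≥0, ∀ f : SpaceTime n → ℂ, AEStronglyMeasurable f volume →
      (∑' k, xkDualNorm k (cv (sc Φ k) f) ^ 2) ^ (1 / 2 : ℝ) ≤
        C * ∑' J : ℤ, pw (J / 2) * eLpNorm f 2 (volume.restrict (Prod.snd ⁻¹' shell n J)) := by
  obtain ⟨C, hC⟩ := exists_tsum_xkDualNorm_le hn hΦ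
  refine ⟨C, fun f hf => ?_⟩
  set χ : ℤ → Space n → ℝ := fun J => (shell n J).indicator fun _ => 1 with hχ
  set fJ : ℤ → SpaceTime n → ℂ := fun J z => χ J z.2 * f z with hfJ
  have hχm : ∀ J, Measurable (χ J) := fun J => measurable_const.indicator (measurableSet_shell n J)
  have hfm : ∀ J, AEStronglyMeasurable (fJ J) volume := fun J =>
    (Complex.measurable_ofReal.comp ((hχm J).comp measurable_snd)).aestronglyMeasurable.mul hf
  have hind : ∀ J, fJ J = (Prod.snd ⁻¹' shell n J).indicator f := fun J => by
    ext z
    by_cases h : z.2 ∈ shell n J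
    · simp [hfJ, hχ, h]
    · simp [hfJ, hχ, h]
  calc (∑' k, xkDualNorm k (cv (sc Φ k) f) ^ 2) ^ (1 / 2 : ℝ)
      ≤ (∑' k, (∑' J, xkDualNorm k (cv (sc Φ k) (fJ J))) ^ 2) ^ (1 / 2 : ℝ) := by
        gcongr with k
        exact xkDualNorm_le_tsum k
          (fun J => aestronglyMeasurable_cv (sc Φ k).continuous.measurable (hfm J))
          (enorm_cv_le_tsum (by omega) hχm
            (fun J x => Set.indicator_nonneg (fun _ _ => zero_le_one) x)
            (fun x hx => hasSum_shell hx) (sc Φ k) f)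
    _ ≤ ∑' J, (∑' k, xkDualNorm k (cv (sc Φ k) (fJ J)) ^ 2) ^ (1 / 2 : ℝ) := l2_tsum_le _
    _ ≤ ∑' J : ℤ, C * (pw (J / 2) * eLpNorm (fJ J) 2 volume) := by
        refine ENNReal.tsum_le_tsum fun J => hC J _ (hfm J) fun z hz => ?_
        rw [hind]
        exact Set.indicator_of_notMem (fun h => hz h.2.le) _
    _ = _ := by
        rw [ENNReal.tsum_mul_left]
        simp_rw [hind, eLpNorm_indicator_eq_eLpNorm_restrict
          (measurable_snd (measurableSet_shell n _))]

/-- Multiplication by a potential of size `γ |x|^{-2}` on an annulus. -/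
lemma eLpNorm_mul_le {J : ℤ} {A : Set (SpaceTime n)} (hA : MeasurableSet A)
    (hAJ : A ⊆ ann n (J - 1)) {γ : ℝ≥0∞} (hγ : γ ≠ ⊤) {c : SpaceTime n → ℂ} (u : SpaceTime n → ℂ)
    (hc : ∀ z ∈ A, ENNReal.ofReal (‖z.2‖ ^ 2 * ‖c z‖) ≤ γ) :
    eLpNorm (fun z => c z * u z) 2 (volume.restrict A) ≤
      4 * (γ * pw (-2 * J) * eLpNorm u 2 (volume.restrict A)) := by
  have key : ∀ z ∈ A, ‖c z * u z‖ₑ ≤ (4 * (γ * pw (-2 * J))) * ‖u z‖ₑ := fun z hz => by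
    rw [enorm_mul]
    refine mul_le_mul' ?_ le_rfl
    have h1 := hc z hz
    have h2 : (2 : ℝ) ^ (J - 1) ≤ ‖z.2‖ := (hAJ hz).1
    rw [ENNReal.ofReal_mul (by positivity), ofReal_norm] at h1
    have h3 : pw (2 * J) ≤ 4 * ENNReal.ofReal (‖z.2‖ ^ 2) := by
      rw [show (2 * J : ℝ) = ((2 * J : ℤ) : ℝ) by push_cast; ring, pw_int,
        show (4 : ℝ≥0∞) = ENNReal.ofReal 4 by simp, ← ENNReal.ofReal_mul (by norm_num)]
      apply ENNReal.ofReal_le_ofReal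
      have h4 : (2 : ℝ) ^ (2 * J) = 4 * ((2 : ℝ) ^ (J - 1)) ^ 2 := by
        rw [← zpow_natCast, ← zpow_mul, show (4 : ℝ) = (2 : ℝ) ^ (2 : ℤ) by norm_num,
          ← zpow_add₀ (by norm_num)]
        congr 1
        push_cast
        ring
      rw [h4]
      gcongr
    calc ‖c z‖ₑ = pw (2 * J) * pw (-(2 * J)) * ‖c z‖ₑ := by rw [pw_mul_neg, one_mul]
      _ ≤ (4 * ENNReal.ofReal (‖z.2‖ ^ 2)) * pw (-(2 * J)) * ‖c z‖ₑ := by gcongr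
      _ = 4 * ((ENNReal.ofReal (‖z.2‖ ^ 2) * ‖c z‖ₑ) * pw (-(2 * J))) := by ring
      _ ≤ 4 * (γ * pw (-(2 * J))) := by gcongr
      _ = _ := by rw [neg_mul]
  apply le_of_sq_le_sq
  rw [eLpNorm_two_sq, ← mul_assoc, mul_pow, eLpNorm_two_sq, ← lintegral_const_mul' _ _ (by
    have := pw_ne_top (-2 * J)
    finiteness)]
  refine setLIntegral_mono' hA fun z hz => ?_
  rw [← mul_pow]
  exact pow_le_pow_left' (key z hz) 2

/-! ### Bounds of a function in terms of its gradient -/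

lemma grad_apply (u : 𝓢(SpaceTime n, ℂ)) (z : SpaceTime n) (α : Fin (n + 1)) :
    grad u z α = (∂_{dir n α} u : 𝓢(SpaceTime n, ℂ)) z := rfl

lemma dx_eq_grad (i : Fin n) (u : 𝓢(SpaceTime n, ℂ)) :
    dx (EuclideanSpace.single i (1 : ℝ)) u = (∂_{dir n i.succ} u : 𝓢(SpaceTime n, ℂ)) :=
  dx_schwartz _ _

lemma memLp_schwartz (u : 𝓢(SpaceTime n, ℂ)) : MemLp u 2 volume := u.memLp 2

lemma continuous_grad (u : 𝓢(SpaceTime n, ℂ)) : Continuous (grad u) :=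
  (PiLp.continuous_toLp 2 _).comp (continuous_pi fun α =>
    (∂_{dir n α} u : 𝓢(SpaceTime n, ℂ)).continuous)

lemma norm_grad_le (u : 𝓢(SpaceTime n, ℂ)) (z : SpaceTime n) :
    ‖grad u z‖ ≤ ∑ α, ‖(∂_{dir n α} u : 𝓢(SpaceTime n, ℂ)) z‖ := by
  rw [EuclideanSpace.norm_eq]
  refine Real.sqrt_le_iff.2 ⟨Finset.sum_nonneg fun _ _ => norm_nonneg _, ?_⟩
  exact Finset.sum_sq_le_sq_sum_of_nonneg fun _ _ => norm_nonneg _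

lemma integrable_grad (K : 𝓢(Space n, ℂ)) (u : 𝓢(SpaceTime n, ℂ)) (z : SpaceTime n) :
    Integrable fun y => K y • grad u (z.1, z.2 - y) := by
  choose M hM using fun α => (tame_schwartz (∂_{dir n α} u : 𝓢(SpaceTime n, ℂ))).bdd z.1
  refine (K.integrable (μ := volume)).smul_bdd (∑ α, M α) ?_ (ae_of_all _ fun y => ?_)
  · exact ((continuous_grad u).comp (by fun_prop)).aestronglyMeasurable
  · exact (norm_grad_le u _).trans (Finset.sum_le_sum fun α _ => hM α _)

namespace LittlewoodPaley

variable (S : LittlewoodPaley n)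

lemma proj_grad_apply (l : ℤ) (u : 𝓢(SpaceTime n, ℂ)) (z : SpaceTime n) (α : Fin (n + 1)) :
    S.proj l (grad u) z α =
      cv (sc S.prof l) (∂_{dir n α} u : 𝓢(SpaceTime n, ℂ)) z := by
  unfold proj cv
  rw [kernel_eq]
  exact ((EuclideanSpace.proj α : Vec n →L[ℂ] ℂ).integral_comp_comm
    (integrable_grad (sc S.prof l) u z)).symm

/-- The size `‖S_l ∇u‖_{X_l}` of the dyadic pieces of the gradient. -/
def gradPiece (u : 𝓢(SpaceTime n, ℂ)) (l : ℤ) : ℝ≥0∞ := xkNorm l (S.proj l (grad u))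

lemma xkNorm_proj_le (l : ℤ) (u : 𝓢(SpaceTime n, ℂ)) (α : Fin (n + 1)) :
    xkNorm l (cv (sc S.prof l) (∂_{dir n α} u : 𝓢(SpaceTime n, ℂ))) ≤ S.gradPiece u l := by
  refine xkNorm_mono l fun z => ?_
  rw [← proj_grad_apply]
  exact PiLp.norm_apply_le _ α

lemma xNorm_eq (s : ℝ) (u : 𝓢(SpaceTime n, ℂ)) :
    xNorm S s (grad u) = (∑' l : ℤ, (pw (s * l) * S.gradPiece u l) ^ 2) ^ (1 / 2 : ℝ) := by
  unfold xNorm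
  congr 2 with l
  rw [mul_pow, pw_sq, ← mul_assoc]
  rfl

lemma yNorm_eq (s : ℝ) (f : SpaceTime n → ℂ) :
    yNorm S s f =
      (∑' k : ℤ, (pw (s * k) * xkDualNorm k (cv (sc S.prof k) f)) ^ 2) ^ (1 / 2 : ℝ) := by
  unfold yNorm
  congr 2 with k
  rw [mul_pow, pw_sq, ← mul_assoc, proj_eq]
  rfl

lemma eLpNorm_le_of_partialSum (hn : n ≠ 0) (v : 𝓢(SpaceTime n, ℂ)) (A : Set (SpaceTime n))
    {B : ℝ≥0∞} (h : ∀ N, eLpNorm (S.partialSum N v) 2 (volume.restrict A) ≤ B) :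
    eLpNorm v 2 (volume.restrict A) ≤ B := by
  refine (Lp.eLpNorm_lim_le_liminf_eLpNorm (f := fun N => S.partialSum N v) (fun N => ?_) v
    (ae_of_all _ fun z => S.tendsto_partialSum hn v z)).trans ?_
  · exact (Tame.sum fun l _ => (tame_schwartz v).cv _).meas.aestronglyMeasurable
  · exact (liminf_le_liminf (Eventually.of_forall h)).trans_eq (liminf_const B)

/-- If the pieces `S_l v` are obtained by localization at the frequency `2^l` from functions with
`X_l` norms at most `D_l`, then Bernstein's inequality bounds `v` on `|x| ≤ 2^J`. -/
lemma exists_cyl_le_tsum (hn : n ≠ 0) {ι : Type*} [Fintype ι] (Ψ : ι → 𝓢(Space n, ℂ)) :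
    ∃ C : ℝ≥0, ∀ (v : 𝓢(SpaceTime n, ℂ)) (g : ι → ℤ → SpaceTime n → ℂ) (D : ℤ → ℝ≥0∞),
      (∀ i l, MemLp (g i l) 2 volume) →
      (∀ l z, cv (sc S.prof l) v z = ∑ i, cv (sc (Ψ i) l) (g i l) z) →
      (∀ i l, xkNorm l (g i l) ≤ D l) → ∀ J : ℤ,
      eLpNorm v 2 (volume.restrict (cyl n J)) ≤
        C * ∑' l : ℤ, pw (J / 2) * al n (J + l) * D l := by
  choose C hC using fun i => exists_eLpNorm_cyl_cv_le (Ψ i)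
  refine ⟨∑ i, C i, fun v g D hg hrep hD J => S.eLpNorm_le_of_partialSum hn v _ fun N => ?_⟩
  have hm : ∀ i l, AEStronglyMeasurable (cv (sc (Ψ i) l) (g i l)) (volume.restrict (cyl n J)) :=
    fun i l => (aestronglyMeasurable_cv (sc (Ψ i) l).continuous.measurable (hg i l).1).restrict
  have e : S.partialSum N v =
      ∑ l ∈ Finset.Icc (-N : ℤ) N, ∑ i, cv (sc (Ψ i) l) (g i l) := by
    ext z
    simp [partialSum, hrep]
  rw [e]
  calc _ ≤ ∑ l ∈ Finset.Icc (-N : ℤ) N, eLpNorm (∑ i, cv (sc (Ψ i) l) (g i l)) 2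
          (volume.restrict (cyl n J)) :=
        eLpNorm_sum_le (fun l _ => Finset.aestronglyMeasurable_sum _ fun i _ => hm i l)
          (by norm_num)
    _ ≤ ∑ l ∈ Finset.Icc (-N : ℤ) N, ((∑ i, C i : ℝ≥0) : ℝ≥0∞) *
          (pw (J / 2) * al n (J + l) * D l) := by
        refine Finset.sum_le_sum fun l _ => ?_
        refine (eLpNorm_sum_le (fun i _ => hm i l) (by norm_num)).trans ?_
        push_cast
        rw [Finset.sum_mul]
        refine Finset.sum_le_sum fun i _ => (hC i J l _ (hg i l).1).trans ?_
        gcongr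
        exact hD i l
    _ ≤ _ := by
        rw [← ENNReal.tsum_mul_left]
        exact ENNReal.sum_le_tsum _

/-- The variant of `exists_cyl_le_tsum` with square summation over the frequencies. -/
lemma exists_cyl_le_sq (hn : 2 ≤ n) {ι : Type*} [Fintype ι] (Ψ : ι → 𝓢(Space n, ℂ))
    (hΨ : ∀ i, Annular (Ψ i)) :
    ∃ C : ℝ≥0, ∀ (v : 𝓢(SpaceTime n, ℂ)) (g : ι → ℤ → SpaceTime n → ℂ) (D : ℤ → ℝ≥0∞),
      (∀ i l, MemLp (g i l) 2 volume) →
      (∀ l z, cv (sc S.prof l) v z = ∑ i, cv (sc (Ψ i) l) (g i l) z) →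
      (∀ i l, xkNorm l (g i l) ≤ D l) → ∀ J : ℤ,
      eLpNorm v 2 (volume.restrict (cyl n J)) ≤
        C * (pw (J / 2) * (∑' l : ℤ, D l ^ 2) ^ (1 / 2 : ℝ)) := by
  choose C hC using fun i => exists_eLpNorm_cyl_sum_le hn (hΨ i)
  refine ⟨∑ i, C i, fun v g D hg hrep hD J =>
    S.eLpNorm_le_of_partialSum (by omega) v _ fun N => ?_⟩
  have hm : ∀ i l, AEStronglyMeasurable (cv (sc (Ψ i) l) (g i l)) (volume.restrict (cyl n J)) :=
    fun i l => (aestronglyMeasurable_cv (sc (Ψ i) l).continuous.measurable (hg i l).1).restrict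
  have e : S.partialSum N v =
      ∑ i, fun z => ∑ l ∈ Finset.Icc (-N : ℤ) N, cv (sc (Ψ i) l) (g i l) z := by
    ext z
    simp only [partialSum, hrep, Finset.sum_apply]
    exact Finset.sum_comm
  rw [e]
  refine (eLpNorm_sum_le (fun i _ => Finset.aestronglyMeasurable_fun_sum _ fun l _ => hm i l)
    (by norm_num)).trans ?_
  push_cast
  rw [Finset.sum_mul]
  refine Finset.sum_le_sum fun i _ => (hC i J _ _ fun l _ => hg i l).trans ?_
  gcongr with l
  exact hD i l

lemma memLp_proj (l : ℤ) (v : 𝓢(SpaceTime n, ℂ)) : MemLp (cv (sc S.prof l) v) 2 volume :=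
  memLp_cv _ _ (memLp_schwartz v)

/-- The bound of a Schwartz function on a ball through its own frequency pieces. -/
lemma exists_cyl_le_tsum_proj (hn : n ≠ 0) : ∃ C : ℝ≥0, ∀ (v : 𝓢(SpaceTime n, ℂ)) (J : ℤ),
    eLpNorm v 2 (volume.restrict (cyl n J)) ≤
      C * ∑' l : ℤ, pw (J / 2) * al n (J + l) * xkNorm l (cv (sc S.prof l) v) := by
  obtain ⟨C, hC⟩ := S.exists_cyl_le_tsum hn fun _ : Unit => S.wide
  refine ⟨C, fun v => hC v (fun _ l => cv (sc S.prof l) v) _ (fun _ l => S.memLp_proj l v)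
    (fun l z => ?_) fun _ l => le_rfl⟩
  simp [S.wide_proj l (tame_schwartz v)]

lemma enorm_two_zpow (l : ℤ) : ‖(((2 : ℝ) ^ l : ℝ) : ℂ)‖ₑ = pw l := by
  rw [pw_int, ← ofReal_norm, Complex.norm_real, Real.norm_of_nonneg (by positivity)]

lemma xkNorm_two_zpow_mul (m l : ℤ) (w : SpaceTime n → ℂ) :
    xkNorm l (fun z => (((2 : ℝ) ^ m : ℝ) : ℂ) * w z) = pw m * xkNorm l w := by
  rw [xkNorm_const_mul, enorm_two_zpow]

lemma proj_eq_sum_grad {ρ : Fin n → 𝓢(Space n, ℂ)}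
    (hρ : S.wide = ∑ i, ∂_{(EuclideanSpace.single i (1 : ℝ) : Space n)} (ρ i))
    (l : ℤ) (u : 𝓢(SpaceTime n, ℂ)) (z : SpaceTime n) :
    cv (sc S.prof l) u z = ∑ i, cv (sc (ρ i) l) (fun z => (((2 : ℝ) ^ (-l) : ℝ) : ℂ) *
      cv (sc S.prof l) (∂_{dir n i.succ} u : 𝓢(SpaceTime n, ℂ)) z) z := by
  rw [S.proj_eq_sum_deriv hρ, Finset.mul_sum]
  refine Finset.sum_congr rfl fun i _ => ?_
  rw [cv_const_mul, dx_eq_grad]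

/-- The bound of a Schwartz function on a ball through the frequency pieces of its gradient: at the
frequency `2^l` a function is `2^{-l}` times a derivative. -/
lemma exists_cyl_le_tsum_grad (hn : n ≠ 0) : ∃ C : ℝ≥0, ∀ (u : 𝓢(SpaceTime n, ℂ)) (J : ℤ),
    eLpNorm u 2 (volume.restrict (cyl n J)) ≤
      C * ∑' l : ℤ, pw (J / 2) * al n (J + l) * (pw ((-l : ℤ)) * S.gradPiece u l) := by
  obtain ⟨ρ, -, hρ⟩ := S.annular_wide.exists_eq_sum_deriv
  obtain ⟨C, hC⟩ := S.exists_cyl_le_tsum hn ρ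
  refine ⟨C, fun u => hC u (fun i l z => (((2 : ℝ) ^ (-l) : ℝ) : ℂ) *
    cv (sc S.prof l) (∂_{dir n i.succ} u : 𝓢(SpaceTime n, ℂ)) z) _
    (fun i l => (S.memLp_proj l _).const_mul _) (S.proj_eq_sum_grad hρ · u) fun i l => ?_⟩
  rw [xkNorm_two_zpow_mul]
  exact mul_le_mul' le_rfl (S.xkNorm_proj_le l u _)

/-- The variant of `exists_cyl_le_tsum_grad` with square summation over the frequencies. -/
lemma exists_cyl_le_sq_grad (hn : 2 ≤ n) : ∃ C : ℝ≥0, ∀ (u : 𝓢(SpaceTime n, ℂ)) (J : ℤ),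
    eLpNorm u 2 (volume.restrict (cyl n J)) ≤
      C * (pw (J / 2) * (∑' l : ℤ, (pw ((-l : ℤ)) * S.gradPiece u l) ^ 2) ^ (1 / 2 : ℝ)) := by
  obtain ⟨ρ, hρa, hρ⟩ := S.annular_wide.exists_eq_sum_deriv
  obtain ⟨C, hC⟩ := S.exists_cyl_le_sq hn ρ hρa
  refine ⟨C, fun u => hC u (fun i l z => (((2 : ℝ) ^ (-l) : ℝ) : ℂ) *
    cv (sc S.prof l) (∂_{dir n i.succ} u : 𝓢(SpaceTime n, ℂ)) z) _
    (fun i l => (S.memLp_proj l _).const_mul _) (S.proj_eq_sum_grad hρ · u) fun i l => ?_⟩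
  rw [xkNorm_two_zpow_mul]
  exact mul_le_mul' le_rfl (S.xkNorm_proj_le l u _)

/-- At the frequency `2^l`, a derivative costs a factor `2^l`. -/
lemma exists_cyl_dx_le_sq (hn : 2 ≤ n) (i : Fin n) : ∃ C : ℝ≥0,
    ∀ (v : 𝓢(SpaceTime n, ℂ)) (J : ℤ),
      eLpNorm (dx (EuclideanSpace.single i (1 : ℝ)) v) 2 (volume.restrict (cyl n J)) ≤
        C * (pw (J / 2) *
          (∑' l : ℤ, (pw l * xkNorm l (cv (sc S.prof l) v)) ^ 2) ^ (1 / 2 : ℝ)) := by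
  set e : Space n := EuclideanSpace.single i (1 : ℝ)
  obtain ⟨C, hC⟩ := S.exists_cyl_le_sq hn (fun _ : Unit => (∂_{e} S.wide : 𝓢(Space n, ℂ)))
    fun _ => S.annular_wide.deriv e
  refine ⟨C, fun v => ?_⟩
  rw [dx_schwartz]
  refine hC _ (fun _ l z => (((2 : ℝ) ^ l : ℝ) : ℂ) * cv (sc S.prof l) v z) _
    (fun _ l => (S.memLp_proj l _).const_mul _) (fun l z => ?_)
    fun _ l => (xkNorm_two_zpow_mul l l _).le
  have hv := tame_schwartz v
  rw [← dx_schwartz, cv_dx_schwartz, Finset.univ_unique, Finset.sum_singleton, cv_const_mul,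
    ← cv_kernel_smul, ← deriv_sc]
  rw [cv_conv _ _ hv]
  congr 2
  refine schwartz_ext_fourier fun ξ => ?_
  rw [conv, fourier_conv, fourier_deriv, fourier_deriv, fourier_sc, fourier_sc]
  linear_combination (-(2 * Real.pi * Complex.I * ((inner ℝ ξ e : ℝ) : ℂ))) *
    S.fourier_wide_mul ((2 : ℝ) ^ (-l) • ξ)

end LittlewoodPaley

/-! ### Potentials -/

lemma CoeffC.le_of_mem {ε : ℝ} {c : SpaceTime n → ℂ} (hc : CoeffC ε c) (z : SpaceTime n) :
    ENNReal.ofReal (‖z.2‖ ^ 2 * ‖c z‖) ≤ ENNReal.ofReal ε :=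
  ENNReal.ofReal_le_ofReal (hc.bound z)

/-- The supremum of `|x|² |c|` over the annulus `2^{J-1} ≤ |x| ≤ 2^J`. -/
def annSup (c : SpaceTime n → ℂ) (J : ℤ) : ℝ≥0∞ :=
  (⨆ z ∈ ann n (J - 1), ENNReal.ofReal (‖z.2‖ ^ 4 * ‖c z‖ ^ 2)) ^ (1 / 2 : ℝ)

lemma le_annSup {c : SpaceTime n → ℂ} {J : ℤ} {z : SpaceTime n} (hz : z ∈ ann n (J - 1)) :
    ENNReal.ofReal (‖z.2‖ ^ 2 * ‖c z‖) ≤ annSup c J := by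
  apply le_of_sq_le_sq
  rw [annSup, sqrt_sq, ← ENNReal.ofReal_pow (by positivity)]
  refine le_trans (le_of_eq ?_) (le_iSup₂_of_le z hz le_rfl)
  congr 1
  ring

lemma CoeffCC.tsum_annSup_le {ε : ℝ} {c : SpaceTime n → ℂ} (hc : CoeffCC ε c) :
    ∑' J, annSup c J ^ 2 ≤ ENNReal.ofReal ε := by
  refine le_trans (le_of_eq ?_) hc.bound
  rw [← (Equiv.subRight (1 : ℤ)).tsum_eq fun j => ⨆ z ∈ ann n j,
    ENNReal.ofReal (‖z.2‖ ^ 4 * ‖c z‖ ^ 2)]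
  simp only [annSup, sqrt_sq, Equiv.subRight_apply]

lemma CoeffCC.annSup_ne_top {ε : ℝ} {c : SpaceTime n → ℂ} (hc : CoeffCC ε c) (J : ℤ) :
    annSup c J ≠ ⊤ := fun h => by
  have h1 := (ENNReal.le_tsum J).trans hc.tsum_annSup_le
  simp [h] at h1

lemma tsum_mul_le_sqrt {ι : Type*} [Countable ι] (f g : ι → ℝ≥0∞) :
    ∑' i, f i * g i ≤ (∑' i, f i ^ 2) ^ (1 / 2 : ℝ) * (∑' i, g i ^ 2) ^ (1 / 2 : ℝ) := by
  apply le_of_sq_le_sq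
  rw [mul_pow, sqrt_sq, sqrt_sq]
  exact tsum_mul_sq_le f g

lemma sqrt_schur_add (A a : ℤ → ℝ≥0∞) :
    (∑' k, (∑' l, A (k + l) * a l) ^ 2) ^ (1 / 2 : ℝ) ≤
      (∑' m, A m) * (∑' l, a l ^ 2) ^ (1 / 2 : ℝ) := by
  apply sqrt_le_of_le_sq
  rw [mul_pow, sqrt_sq]
  exact schur_test_add A a

lemma ann_subset_cyl (J : ℤ) : ann n (J - 1) ⊆ cyl n J := fun z hz => by
  have := hz.2
  rwa [sub_add_cancel] at this

lemma sqrt_tsum_mono {x y : ℤ → ℝ≥0∞} (h : ∀ k, x k ≤ y k) :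
    (∑' k, x k ^ 2) ^ (1 / 2 : ℝ) ≤ (∑' k, y k ^ 2) ^ (1 / 2 : ℝ) :=
  ENNReal.rpow_le_rpow (ENNReal.tsum_le_tsum fun k => pow_le_pow_left' (h k) 2) (by norm_num)

lemma sqrt_mul_sq (C : ℝ≥0∞) (a : ℤ → ℝ≥0∞) :
    (∑' k, (C * a k) ^ 2) ^ (1 / 2 : ℝ) = C * (∑' k, a k ^ 2) ^ (1 / 2 : ℝ) := by
  simp_rw [mul_pow]
  rw [ENNReal.tsum_mul_left, ENNReal.mul_rpow_of_nonneg _ _ (by norm_num), sq_sqrt]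

namespace LittlewoodPaley

variable (S : LittlewoodPaley n)

/-- A potential of size `|x|^{-2}` is handled by Bernstein's inequality at both ends, which
leaves two kernels in the frequency scaled by the position. -/
theorem exists_potential_le (hn : 3 ≤ n) {s : ℝ} (h1 : -1 < s) (h2 : s < 0) : ∃ K : ℝ≥0,
    ∀ (ε : ℝ) (c : SpaceTime n → ℂ) (u : 𝓢(SpaceTime n, ℂ)), CoeffC ε c →
      yNorm S s (fun z => c z * u z) ≤ K * (ENNReal.ofReal ε * xNorm S s (grad u)) := by
  obtain ⟨C₁, hC₁⟩ := exists_xkDualNorm_ann_le (by omega : n ≠ 0) S.prof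
  obtain ⟨C₂, hC₂⟩ := S.exists_cyl_le_tsum_grad (by omega)
  have hn' : (3 : ℝ) ≤ n := by exact_mod_cast hn
  set A₁ : ℤ → ℝ≥0∞ := fun m => al n m * pw (s * m) with hA₁
  set A₂ : ℤ → ℝ≥0∞ := fun m => al n m * pw ((-1 - s) * m) with hA₂
  have hs₁ : ∑' m, A₁ m ≠ ⊤ := tsum_al_pw_ne_top h2 (by linarith)
  have hs₂ : ∑' m, A₂ m ≠ ⊤ := tsum_al_pw_ne_top (by linarith) (by linarith)
  refine ⟨4 * C₁ * C₂ * (∑' m, A₁ m).toNNReal * (∑' m, A₂ m).toNNReal, fun ε c u hc => ?_⟩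
  rw [yNorm_eq, xNorm_eq]
  set a : ℤ → ℝ≥0∞ := fun l => pw (s * l) * S.gradPiece u l with ha
  have hm : AEStronglyMeasurable (fun z => c z * u z) volume :=
    hc.measurable.mul u.continuous.aestronglyMeasurable
  have key : ∀ k : ℤ, pw (s * k) * xkDualNorm k (cv (sc S.prof k) fun z => c z * u z) ≤
      (4 * C₁ * C₂ * ENNReal.ofReal ε) * ∑' J : ℤ, A₁ (k + J) * ∑' l : ℤ, A₂ (J + l) * a l := by
    intro k
    calc _ ≤ pw (s * k) * (C₁ * ∑' J : ℤ, pw (J / 2) * al n (J + k) *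
          (4 * (ENNReal.ofReal ε * pw (-2 * J) * (C₂ * ∑' l : ℤ, pw (J / 2) * al n (J + l) *
            (pw ((-l : ℤ)) * S.gradPiece u l))))) := by
          refine mul_le_mul' le_rfl ((hC₁ k _ hm).trans ?_)
          gcongr with J
          refine (eLpNorm_mul_le (measurableSet_ann n (J - 1)) le_rfl ENNReal.ofReal_ne_top u
            fun z _ => hc.le_of_mem z).trans ?_
          gcongr
          exact (eLpNorm_mono_measure _ (Measure.restrict_mono (ann_subset_cyl J) le_rfl)).trans
            (hC₂ u J)
      _ = _ := by
          simp only [← ENNReal.tsum_mul_left]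
          refine tsum_congr fun J => tsum_congr fun l => ?_
          have e : pw (s * k) * pw (J / 2) * pw (-2 * J) * pw (J / 2) * pw ((-l : ℤ)) =
              pw (s * (k + J : ℤ)) * pw ((-1 - s) * (J + l : ℤ)) * pw (s * l) := by
            simp only [← pw_add]
            congr 1
            push_cast
            ring
          simp only [hA₁, hA₂, ha]
          rw [add_comm J k]
          trans (4 * C₁ * C₂ * ENNReal.ofReal ε * al n (k + J) * al n (J + l) *
            S.gradPiece u l) * (pw (s * k) * pw (J / 2) * pw (-2 * J) * pw (J / 2) * pw ((-l : ℤ)))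
          · ring
          · rw [e]; ring
  calc _ ≤ (∑' k : ℤ, ((4 * C₁ * C₂ * ENNReal.ofReal ε) *
        ∑' J : ℤ, A₁ (k + J) * ∑' l : ℤ, A₂ (J + l) * a l) ^ 2) ^ (1 / 2 : ℝ) := by
        exact sqrt_tsum_mono key
    _ ≤ (4 * C₁ * C₂ * ENNReal.ofReal ε) * ((∑' m, A₁ m) * ((∑' m, A₂ m) *
          (∑' l, a l ^ 2) ^ (1 / 2 : ℝ))) := by
        rw [sqrt_mul_sq]
        gcongr
        exact (sqrt_schur_add A₁ _).trans (by gcongr; exact sqrt_schur_add A₂ a)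
    _ = _ := by
        push_cast
        rw [ENNReal.coe_toNNReal hs₁, ENNReal.coe_toNNReal hs₂]
        ring

/-- At regularity `-1`, the sum over the input frequencies is the square function bound of
`exists_cyl_le_sq_grad`; only the interaction of the output with the position leaves a kernel,
summable since `n ≥ 4`. -/
theorem exists_potential_neg_one_le (hn : 4 ≤ n) : ∃ K : ℝ≥0,
    ∀ (ε : ℝ) (c : SpaceTime n → ℂ) (u : 𝓢(SpaceTime n, ℂ)), CoeffCC ε c →
      yNorm S (-1) (fun z => c z * u z) ≤
        K * (ENNReal.ofReal ε ^ (1 / 2 : ℝ) * xNorm S (-1) (grad u)) := by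
  obtain ⟨C₁, hC₁⟩ := exists_xkDualNorm_ann_le (by omega : n ≠ 0) S.prof
  obtain ⟨C₂, hC₂⟩ := S.exists_cyl_le_sq_grad (by omega)
  have hn' : (4 : ℝ) ≤ n := by exact_mod_cast hn
  set A : ℤ → ℝ≥0∞ := fun m => al n m * pw ((-1) * m) with hA
  have hs : ∑' m, A m ≠ ⊤ := tsum_al_pw_ne_top (by norm_num) (by linarith)
  refine ⟨4 * C₁ * C₂ * (∑' m, A m).toNNReal, fun ε c u hc => ?_⟩
  rw [yNorm_eq, xNorm_eq]
  set X : ℝ≥0∞ := (∑' l : ℤ, (pw (-1 * l) * S.gradPiece u l) ^ 2) ^ (1 / 2 : ℝ) with hX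
  have hX' : (∑' l : ℤ, (pw ((-l : ℤ)) * S.gradPiece u l) ^ 2) ^ (1 / 2 : ℝ) = X := by
    rw [hX]
    congr 2 with l
    push_cast
    rw [neg_one_mul]
  have hm : AEStronglyMeasurable (fun z => c z * u z) volume :=
    hc.measurable.mul u.continuous.aestronglyMeasurable
  have key : ∀ k : ℤ, pw (-1 * k) * xkDualNorm k (cv (sc S.prof k) fun z => c z * u z) ≤
      (4 * C₁ * C₂ * X) * ∑' J : ℤ, A (k + J) * annSup c J := by
    intro k
    calc _ ≤ pw (-1 * k) * (C₁ * ∑' J : ℤ, pw (J / 2) * al n (J + k) *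
          (4 * (annSup c J * pw (-2 * J) * (C₂ * (pw (J / 2) * X))))) := by
          refine mul_le_mul' le_rfl ((hC₁ k _ hm).trans ?_)
          gcongr with J
          refine (eLpNorm_mul_le (measurableSet_ann n (J - 1)) le_rfl (hc.annSup_ne_top J) u
            fun z hz => le_annSup hz).trans ?_
          gcongr
          rw [← hX']
          exact (eLpNorm_mono_measure _ (Measure.restrict_mono (ann_subset_cyl J) le_rfl)).trans
            (hC₂ u J)
      _ = _ := by
          simp only [← ENNReal.tsum_mul_left]
          refine tsum_congr fun J => ?_
          have e : pw (-1 * k) * pw (J / 2) * pw (-2 * J) * pw (J / 2) =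
              pw (-1 * (k + J : ℤ)) := by
            simp only [← pw_add]
            congr 1
            push_cast
            ring
          simp only [hA]
          rw [add_comm J k]
          trans (4 * C₁ * C₂ * X * al n (k + J) * annSup c J) *
            (pw (-1 * k) * pw (J / 2) * pw (-2 * J) * pw (J / 2))
          · ring
          · rw [e]; ring
  calc _ ≤ (∑' k : ℤ, ((4 * C₁ * C₂ * X) *
        ∑' J : ℤ, A (k + J) * annSup c J) ^ 2) ^ (1 / 2 : ℝ) := by
        exact sqrt_tsum_mono key
    _ ≤ (4 * C₁ * C₂ * X) * ((∑' m, A m) * ENNReal.ofReal ε ^ (1 / 2 : ℝ)) := by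
        rw [sqrt_mul_sq]
        gcongr
        refine (sqrt_schur_add A _).trans ?_
        gcongr
        exact hc.tsum_annSup_le
    _ = _ := by
        push_cast
        rw [ENNReal.coe_toNNReal hs]
        ring

/-- At regularity `0`, the shells are summed by means of the Cauchy–Schwarz inequality. -/
lemma exists_yNorm_zero_le (hn : 2 ≤ n) : ∃ K : ℝ≥0, ∀ (ε : ℝ) (c u : SpaceTime n → ℂ),
    CoeffCC ε c → AEStronglyMeasurable u volume →
      yNorm S 0 (fun z => c z * u z) ≤ K * (ENNReal.ofReal ε ^ (1 / 2 : ℝ) *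
        (∑' J : ℤ, (pw (-(3 / 2) * J) * eLpNorm u 2
          (volume.restrict (Prod.snd ⁻¹' shell n J))) ^ 2) ^ (1 / 2 : ℝ)) := by
  obtain ⟨C, hC⟩ := exists_tsum_xkDualNorm_le_shell hn S.annular_prof
  refine ⟨4 * C, fun ε c u hc hu => ?_⟩
  rw [yNorm_eq]
  simp only [zero_mul, pw_zero, one_mul]
  refine (hC _ (hc.measurable.mul hu)).trans ?_
  push_cast
  rw [mul_comm (4 : ℝ≥0∞), mul_assoc]
  gcongr
  calc ∑' J : ℤ, pw (J / 2) *
        eLpNorm (fun z => c z * u z) 2 (volume.restrict (Prod.snd ⁻¹' shell n J))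
      ≤ ∑' J : ℤ, 4 * (annSup c J * (pw (-(3 / 2) * J) *
          eLpNorm u 2 (volume.restrict (Prod.snd ⁻¹' shell n J)))) := by
        refine ENNReal.tsum_le_tsum fun J => ?_
        have hsub : Prod.snd ⁻¹' shell n J ⊆ ann n (J - 1) := fun z hz =>
          ⟨hz.1, by rw [sub_add_cancel]; exact hz.2.le⟩
        refine (mul_le_mul' le_rfl (eLpNorm_mul_le (measurable_snd (measurableSet_shell n J)) hsub
          (hc.annSup_ne_top J) u fun z hz => le_annSup (hsub hz))).trans_eq ?_
        have e : pw (J / 2) * pw (-2 * J) = pw (-(3 / 2) * J) := by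
          rw [← pw_add]
          congr 1
          ring
        rw [← e]
        ring
    _ ≤ _ := by
        rw [ENNReal.tsum_mul_left]
        gcongr
        refine (tsum_mul_le_sqrt _ _).trans ?_
        gcongr
        exact hc.tsum_annSup_le

/-- At regularity `0`, the output is summed by almost orthogonality in `exists_yNorm_zero_le`; only
the interaction of the input with the position leaves a kernel, summable since `n ≥ 4`. -/
theorem exists_potential_zero_le (hn : 4 ≤ n) : ∃ K : ℝ≥0,
    ∀ (ε : ℝ) (c : SpaceTime n → ℂ) (u : 𝓢(SpaceTime n, ℂ)), CoeffCC ε c →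
      yNorm S 0 (fun z => c z * u z) ≤
        K * (ENNReal.ofReal ε ^ (1 / 2 : ℝ) * xNorm S 0 (grad u)) := by
  obtain ⟨C₁, hC₁⟩ := S.exists_yNorm_zero_le (by omega)
  obtain ⟨C₂, hC₂⟩ := S.exists_cyl_le_tsum_grad (by omega)
  have hn' : (4 : ℝ) ≤ n := by exact_mod_cast hn
  set A : ℤ → ℝ≥0∞ := fun m => al n m * pw ((-1) * m) with hA
  have hs : ∑' m, A m ≠ ⊤ := tsum_al_pw_ne_top (by norm_num) (by linarith)
  refine ⟨C₁ * C₂ * (∑' m, A m).toNNReal, fun ε c u hc => ?_⟩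
  rw [xNorm_eq]
  simp only [zero_mul, pw_zero, one_mul]
  refine (hC₁ ε c u hc u.continuous.aestronglyMeasurable).trans ?_
  calc _ ≤ C₁ * (ENNReal.ofReal ε ^ (1 / 2 : ℝ) * (∑' J : ℤ, (C₂ * ∑' l : ℤ, A (J + l) *
        S.gradPiece u l) ^ 2) ^ (1 / 2 : ℝ)) := by
        refine mul_le_mul' le_rfl (mul_le_mul' le_rfl (sqrt_tsum_mono fun J => ?_))
        calc _ ≤ pw (-(3 / 2) * J) * (C₂ * ∑' l : ℤ, pw (J / 2) * al n (J + l) *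
              (pw ((-l : ℤ)) * S.gradPiece u l)) := by
              refine mul_le_mul' le_rfl ?_
              exact (eLpNorm_mono_measure _
                (Measure.restrict_mono (fun z hz => hz.2.le) le_rfl)).trans (hC₂ u J)
          _ = _ := by
              simp only [← ENNReal.tsum_mul_left]
              refine tsum_congr fun l => ?_
              have e : pw (-(3 / 2) * J) * pw (J / 2) * pw ((-l : ℤ)) = pw (-1 * (J + l : ℤ)) := by
                simp only [← pw_add]
                congr 1
                push_cast
                ring
              simp only [hA]
              trans (C₂ * al n (J + l) * S.gradPiece u l) *
                (pw (-(3 / 2) * J) * pw (J / 2) * pw ((-l : ℤ)))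
              · ring
              · rw [e]; ring
    _ ≤ C₁ * (ENNReal.ofReal ε ^ (1 / 2 : ℝ) * (C₂ * ((∑' m, A m) *
          (∑' l, S.gradPiece u l ^ 2) ^ (1 / 2 : ℝ)))) := by
        rw [sqrt_mul_sq]
        gcongr
        exact sqrt_schur_add A _
    _ = _ := by
        push_cast
        rw [ENNReal.coe_toNNReal hs]
        ring

/-- The `L²` norms over the shells are summed to the weighted norm in `X̃^1`. -/
lemma tsum_shell_le (u : SpaceTime n → ℂ) :
    (∑' J : ℤ, (pw (-(3 / 2) * J) * eLpNorm u 2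
      (volume.restrict (Prod.snd ⁻¹' shell n J))) ^ 2) ^ (1 / 2 : ℝ) ≤
        weightedL2 (-(1 / 2) - 1) Set.univ u := by
  apply sqrt_le_of_le_sq
  rw [weightedL2, Measure.restrict_univ, eLpNorm_two_sq]
  have hmeas : ∀ J : ℤ, MeasurableSet (Prod.snd ⁻¹' shell n J : Set (SpaceTime n)) := fun J =>
    measurable_snd (measurableSet_shell n J)
  calc _ ≤ ∑' J : ℤ, ∫⁻ z in Prod.snd ⁻¹' shell n J,
        ‖‖z.2‖ ^ (-(1 / 2) - 1 : ℝ) * ‖u z‖‖ₑ ^ 2 := by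
        refine ENNReal.tsum_le_tsum fun J => ?_
        rw [mul_pow, eLpNorm_two_sq, ← lintegral_const_mul' _ _ (by
          have := pw_ne_top (-(3 / 2) * J)
          finiteness)]
        refine setLIntegral_mono' (hmeas J) fun z hz => ?_
        rw [← mul_pow, enorm_mul, enorm_norm]
        refine pow_le_pow_left' (mul_le_mul' ?_ le_rfl) 2
        have h0 : 0 < ‖z.2‖ := lt_of_lt_of_le (by positivity) hz.1
        rw [← ofReal_norm, Real.norm_of_nonneg (by positivity), pw_eq_ofReal]
        apply ENNReal.ofReal_le_ofReal
        rw [show (-(3 / 2) * J : ℝ) = J * (-(1 / 2) - 1) by ring, Real.rpow_mul (by norm_num),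
          Real.rpow_intCast]
        exact Real.rpow_le_rpow_of_nonpos h0 hz.2.le (by norm_num)
    _ = ∫⁻ z in ⋃ J, Prod.snd ⁻¹' shell n J, ‖‖z.2‖ ^ (-(1 / 2) - 1 : ℝ) * ‖u z‖‖ₑ ^ 2 := by
        rw [lintegral_iUnion hmeas]
        intro i j hij
        exact Set.disjoint_left.2 fun z hi hj => hij (eq_of_mem_shell hi hj)
    _ ≤ _ := setLIntegral_le_lintegral _ _

/-- When the weighted `L²` norm of `u` is part of the right side, no bound of `u` through its gradient
is needed, and the restriction on the dimension is weaker. -/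
theorem exists_potential_tilde_le (hn : 2 ≤ n) : ∃ K : ℝ≥0,
    ∀ (ε : ℝ) (c u : SpaceTime n → ℂ), CoeffCC ε c → AEStronglyMeasurable u volume →
      yNorm S 0 (fun z => c z * u z) ≤
        K * (ENNReal.ofReal ε ^ (1 / 2 : ℝ) * xTildeNorm S 1 u) := by
  obtain ⟨C₁, hC₁⟩ := S.exists_yNorm_zero_le hn
  refine ⟨C₁, fun ε c u hc hu => (hC₁ ε c u hc hu).trans ?_⟩
  gcongr
  refine (tsum_shell_le u).trans ?_
  apply le_of_sq_le_sq
  rw [xTildeNorm, sqrt_sq]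
  exact le_add_self

end LittlewoodPaley

/-! ### Coefficients at one dyadic scale -/

/-- A coefficient at the scale `2^j`: supported in `|x| ≤ 2^j`, Lipschitz in space, with
`2^j |β| + 2^{2j} |∂_x β| ≲ B`. -/
structure ScaledCoeff (j : ℤ) (B : ℝ≥0) (β : SpaceTime n → ℂ) : Prop where
  tame : Tame β
  lip : LipSlices β
  tame_dx : ∀ e, Tame (dx e β)
  supp : ∀ z ∉ cyl n j, β z = 0
  supp_dx : ∀ e, ∀ z ∉ cyl n j, dx e β z = 0
  bound : ∀ z, ‖β z‖ₑ ≤ B * pw (-j)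
  bound_dx : ∀ i : Fin n, ∀ᵐ z, ‖dx (EuclideanSpace.single i (1 : ℝ)) β z‖ₑ ≤ B * pw (-2 * j)

lemma coe_mul_pw_ne_top (B : ℝ≥0) (a : ℝ) : (B : ℝ≥0∞) * pw a ≠ ⊤ :=
  ENNReal.mul_ne_top (by finiteness) (pw_ne_top _)

lemma eLpNorm_mul_le_of_support {j : ℤ} {G : ℝ≥0∞} (hG : G ≠ ⊤) {γ : SpaceTime n → ℂ}
    (w : SpaceTime n → ℂ) (hs : ∀ z ∉ cyl n j, γ z = 0) (hb : ∀ᵐ z, ‖γ z‖ₑ ≤ G) :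
    eLpNorm (fun z => γ z * w z) 2 volume ≤ G * eLpNorm w 2 (volume.restrict (cyl n j)) := by
  apply le_of_sq_le_sq
  rw [mul_pow, eLpNorm_two_sq, eLpNorm_two_sq, lintegral_eq_of_support (measurableSet_cyl n j)
    (fun z hz => by simp [hs z hz]), ← lintegral_const_mul' _ _ (by finiteness)]
  refine lintegral_mono_ae ?_
  filter_upwards [ae_restrict_of_ae hb] with z hz
  rw [enorm_mul, mul_pow]
  gcongr

/-- The frequency interaction of a scaled coefficient, estimated by Bernstein's inequality. -/
lemma exists_interaction_le (Φ Ψ : 𝓢(Space n, ℂ)) : ∃ C : ℝ≥0, ∀ (j k l : ℤ) (G : ℝ≥0∞)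
    (γ v : SpaceTime n → ℂ), G ≠ ⊤ → AEStronglyMeasurable γ volume → (∀ z ∉ cyl n j, γ z = 0) →
      (∀ᵐ z, ‖γ z‖ₑ ≤ G) → AEStronglyMeasurable v volume →
      xkDualNorm k (cv (sc Φ k) fun z => γ z * cv (sc Ψ l) v z) ≤
        C * (G * pw j) * (al n (j + k) * al n (j + l) * xkNorm l v) := by
  obtain ⟨C₁, h₁⟩ := exists_xkDualNorm_cyl_le Φ
  obtain ⟨C₂, h₂⟩ := exists_eLpNorm_cyl_cv_le Ψ
  refine ⟨C₁ * C₂, fun j k l G γ v hG hγ hs hb hv => ?_⟩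
  have hm := aestronglyMeasurable_cv (sc Ψ l).continuous.measurable hv
  refine (h₁ j k _ (hγ.mul hm) fun z hz => by simp [hs z hz]).trans ?_
  calc _ ≤ C₁ * (pw (j / 2) * al n (j + k) *
        (G * (C₂ * (pw (j / 2) * al n (j + l) * xkNorm l v)))) := by
        gcongr
        exact (eLpNorm_mul_le_of_support hG _ hs hb).trans (by gcongr; exact h₂ j l v hv)
    _ = _ := by
        have e : pw j = pw (j / 2) * pw (j / 2) := by rw [← pw_add]; congr 1; ring
        rw [e]
        push_cast
        ring

lemma xkDualNorm_sum_le {ι : Type*} [Fintype ι] (k : ℤ) {g : ι → SpaceTime n → ℂ}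
    (hg : ∀ i, AEStronglyMeasurable (g i) volume) :
    xkDualNorm k (fun z => ∑ i, g i z) ≤ ∑ i, xkDualNorm k (g i) := by
  rw [← tsum_fintype (L := .unconditional ι)]
  refine xkDualNorm_le_tsum k hg fun z => ?_
  rw [tsum_fintype]
  exact enorm_sum_le _ _

lemma xkDualNorm_add_le (k : ℤ) {f g : SpaceTime n → ℂ} (hf : AEStronglyMeasurable f volume)
    (hg : AEStronglyMeasurable g volume) :
    xkDualNorm k (fun z => f z + g z) ≤ xkDualNorm k f + xkDualNorm k g := by
  have := xkDualNorm_sum_le k (g := fun b : Bool => bif b then f else g) (by simp [hf, hg])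
  simpa using this

lemma l2_add_le (x y : ℤ → ℝ≥0∞) : (∑' k, (x k + y k) ^ 2) ^ (1 / 2 : ℝ) ≤
    (∑' k, x k ^ 2) ^ (1 / 2 : ℝ) + (∑' k, y k ^ 2) ^ (1 / 2 : ℝ) := by
  simpa [tsum_fintype] using l2_tsum_le fun (b : Bool) k => bif b then x k else y k

lemma l2_sum_le {ι : Type*} [Fintype ι] (x : ι → ℤ → ℝ≥0∞) :
    (∑' k, (∑ i, x i k) ^ 2) ^ (1 / 2 : ℝ) ≤ ∑ i, (∑' k, x i k ^ 2) ^ (1 / 2 : ℝ) := by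
  simpa [tsum_fintype] using l2_tsum_le x

lemma lipSlices_schwartz (v : 𝓢(SpaceTime n, ℂ)) : LipSlices v := fun t =>
  schwartz_lipschitz (slice t v)

namespace ScaledCoeff

variable {j : ℤ} {B : ℝ≥0} {β : SpaceTime n → ℂ}

lemma lipSlices_mul (hβ : ScaledCoeff j B β) {W : SpaceTime n → ℂ} (hW : Tame W)
    (hL : LipSlices W) : LipSlices fun z => β z * W z := fun t => by
  obtain ⟨A, hA⟩ := hβ.lip t
  obtain ⟨A', hA'⟩ := hL t
  obtain ⟨M, hM⟩ := hβ.tame.bdd t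
  obtain ⟨M', hM'⟩ := hW.bdd t
  exact lipschitz_mul hA hA' hM hM'

lemma hasCompactSupport_mul (hβ : ScaledCoeff j B β) (W : SpaceTime n → ℂ) (t : ℝ) :
    HasCompactSupport fun x => β (t, x) * W (t, x) :=
  HasCompactSupport.intro (isCompact_closedBall (0 : Space n) ((2 : ℝ) ^ j)) fun x hx => by
    rw [hβ.supp (t, x) (fun h => hx (by simpa [cyl] using h)), zero_mul]

lemma cv_deriv_mul (hβ : ScaledCoeff j B β) (K : 𝓢(Space n, ℂ)) (e : Space n)
    {W : SpaceTime n → ℂ} (hW : Tame W) (hL : LipSlices W) (hd : Tame (dx e W))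
    (z : SpaceTime n) :
    cv (∂_{e} K : 𝓢(Space n, ℂ)) (fun z => β z * W z) z =
      cv K (fun z => dx e β z * W z) z + cv K (fun z => β z * dx e W z) z := by
  rw [← cv_dx K e (hβ.lipSlices_mul hW hL) (hβ.hasCompactSupport_mul W)]
  exact cv_dx_mul K e hβ.lip hβ.tame (hβ.tame_dx e) hL hW hd z

/-- Integration by parts for a high frequency output. -/
lemma cv_mul_eq_of_output (hβ : ScaledCoeff j B β) {Φ : 𝓢(Space n, ℂ)} {ρ : Fin n → 𝓢(Space n, ℂ)}
    (hρ : Φ = ∑ i, ∂_{(EuclideanSpace.single i (1 : ℝ) : Space n)} (ρ i)) (k : ℤ)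
    {W : SpaceTime n → ℂ} (hW : Tame W) (hL : LipSlices W) (hd : ∀ e, Tame (dx e W))
    (z : SpaceTime n) :
    cv (sc Φ k) (fun z => β z * W z) z = (((2 : ℝ) ^ (-k) : ℝ) : ℂ) *
      ∑ i, (cv (sc (ρ i) k) (fun z => dx (EuclideanSpace.single i (1 : ℝ)) β z * W z) z +
        cv (sc (ρ i) k) (fun z => β z * dx (EuclideanSpace.single i (1 : ℝ)) W z) z) := by
  rw [sc_eq_sum_deriv hρ, cv_kernel_smul, cv_kernel_sum (hβ.tame.mul hW)]
  congr 1
  exact Finset.sum_congr rfl fun i _ => hβ.cv_deriv_mul _ _ hW hL (hd _) z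

lemma tame_dx_cv {v : SpaceTime n → ℂ} (hv : Tame v) (K : 𝓢(Space n, ℂ)) (e : Space n) :
    Tame (dx e (cv K v)) := by
  rw [dx_cv K hv]
  exact hv.cv _

/-- Integration by parts for a high frequency input. -/
lemma cv_mul_eq_of_input (hβ : ScaledCoeff j B β) {Ψ : 𝓢(Space n, ℂ)} {ρ : Fin n → 𝓢(Space n, ℂ)}
    (hρ : Ψ = ∑ i, ∂_{(EuclideanSpace.single i (1 : ℝ) : Space n)} (ρ i)) (K : 𝓢(Space n, ℂ))
    (l : ℤ) {v : SpaceTime n → ℂ} (hv : Tame v) (z : SpaceTime n) :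
    cv K (fun z => β z * cv (sc Ψ l) v z) z = (((2 : ℝ) ^ (-l) : ℝ) : ℂ) *
      ∑ i, (cv (∂_{(EuclideanSpace.single i (1 : ℝ) : Space n)} K : 𝓢(Space n, ℂ))
          (fun z => β z * cv (sc (ρ i) l) v z) z -
        cv K (fun z => dx (EuclideanSpace.single i (1 : ℝ)) β z * cv (sc (ρ i) l) v z) z) := by
  have e1 : ∀ z, β z * cv (sc Ψ l) v z = (((2 : ℝ) ^ (-l) : ℝ) : ℂ) *
      ∑ i, β z * dx (EuclideanSpace.single i (1 : ℝ)) (cv (sc (ρ i) l) v) z := fun z => by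
    rw [sc_eq_sum_deriv hρ, cv_kernel_smul, cv_kernel_sum hv, Finset.mul_sum, Finset.mul_sum,
      Finset.mul_sum]
    refine Finset.sum_congr rfl fun i _ => ?_
    rw [dx_cv _ hv]
    ring
  simp_rw [e1]
  rw [cv_const_mul, cv_sum fun i _ => hβ.tame.mul (tame_dx_cv hv _ _)]
  congr 1
  refine Finset.sum_congr rfl fun i _ => ?_
  rw [hβ.cv_deriv_mul K _ (hv.cv _) (lipSlices_cv _ hv) (tame_dx_cv hv _ _)]
  ring

/-- The interaction gains a factor when the output frequency dominates. -/
lemma exists_output_le {Φ : 𝓢(Space n, ℂ)} (hΦ : Annular Φ) (Ψ : 𝓢(Space n, ℂ)) :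
    ∃ C : ℝ≥0, ∀ (j k l : ℤ) (B : ℝ≥0) (β v : SpaceTime n → ℂ), ScaledCoeff j B β → Tame v →
      xkDualNorm k (cv (sc Φ k) fun z => β z * cv (sc Ψ l) v z) ≤
        (C * B) * (al n (j + k) * al n (j + l) * xkNorm l v) *
          (pw (-(j + k : ℤ)) + pw ((l - k : ℤ))) := by
  obtain ⟨ρ, -, hρ⟩ := hΦ.exists_eq_sum_deriv
  choose C₁ h₁ using fun i => exists_interaction_le (ρ i) Ψ
  choose C₂ h₂ using fun i : Fin n => exists_interaction_le (ρ i)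
    (∂_{(EuclideanSpace.single i (1 : ℝ) : Space n)} Ψ)
  refine ⟨∑ i, (C₁ i + C₂ i), fun j k l B β v hβ hv => ?_⟩
  set X := al n (j + k) * al n (j + l) * xkNorm l v
  have hW := hv.cv (sc Ψ l)
  rw [funext (hβ.cv_mul_eq_of_output hρ k hW (lipSlices_cv _ hv) (tame_dx_cv hv _))]
  refine (xkDualNorm_const_mul_le _ _ _).trans ?_
  rw [LittlewoodPaley.enorm_two_zpow]
  have ht1 : ∀ i, Tame (cv (sc (ρ i) k) fun z =>
      dx (EuclideanSpace.single i (1 : ℝ)) β z * cv (sc Ψ l) v z) := fun i =>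
    ((hβ.tame_dx _).mul hW).cv _
  have ht2 : ∀ i, Tame (cv (sc (ρ i) k) fun z =>
      β z * dx (EuclideanSpace.single i (1 : ℝ)) (cv (sc Ψ l) v) z) := fun i =>
    (hβ.tame.mul (tame_dx_cv hv _ _)).cv _
  have hj : pw (-2 * j) * pw j * pw ((-k : ℤ)) = pw (-(j + k : ℤ)) := by
    simp only [← pw_add]; congr 1; push_cast; ring
  have hj2 : pw (-j) * pw j * pw ((-k : ℤ)) * pw l = pw ((l - k : ℤ)) := by
    simp only [← pw_add]; congr 1; push_cast; ring
  calc _ ≤ pw ((-k : ℤ)) * ∑ i, (C₁ i * (B * pw (-2 * j) * pw j) * X +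
        pw l * (C₂ i * (B * pw (-j) * pw j) * X)) := by
        refine mul_le_mul' le_rfl ((xkDualNorm_sum_le k fun i => Tame.aesm ((ht1 i).add (ht2 i))).trans
          (Finset.sum_le_sum fun i _ => (xkDualNorm_add_le k (Tame.aesm (ht1 i)) (Tame.aesm (ht2 i))).trans
            (add_le_add ?_ ?_)))
        · exact h₁ i j k l _ _ v (coe_mul_pw_ne_top _ _) (Tame.aesm (hβ.tame_dx _)) (hβ.supp_dx _)
            (hβ.bound_dx i) (Tame.aesm hv)
        · have e : (cv (sc (ρ i) k) fun z =>
              β z * dx (EuclideanSpace.single i (1 : ℝ)) (cv (sc Ψ l) v) z) = fun z =>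
              (((2 : ℝ) ^ l : ℝ) : ℂ) * cv (sc (ρ i) k) (fun z => β z *
                cv (sc (∂_{(EuclideanSpace.single i (1 : ℝ) : Space n)} Ψ) l) v z) z := by
            ext z
            rw [← cv_const_mul]
            congr 1 with z
            rw [dx_cv _ hv, deriv_sc, cv_kernel_smul]
            ring
          rw [e]
          refine (xkDualNorm_const_mul_le _ _ _).trans ?_
          rw [LittlewoodPaley.enorm_two_zpow]
          gcongr
          exact h₂ i j k l _ _ v (coe_mul_pw_ne_top _ _) (Tame.aesm hβ.tame) hβ.supp
            (ae_of_all _ hβ.bound) (Tame.aesm hv)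
    _ = ∑ i, (C₁ i * B * X * pw (-(j + k : ℤ)) + C₂ i * B * X * pw ((l - k : ℤ))) := by
        rw [Finset.mul_sum, ← hj, ← hj2]
        refine Finset.sum_congr rfl fun i _ => ?_
        ring
    _ ≤ ∑ i, ((C₁ i + C₂ i) * B * X * (pw (-(j + k : ℤ)) + pw ((l - k : ℤ)))) := by
        refine Finset.sum_le_sum fun i _ => ?_
        rw [mul_add (_ * X)]
        gcongr
        · exact le_self_add
        · exact le_add_self
    _ = _ := by
        push_cast
        rw [Finset.sum_mul, Finset.sum_mul, Finset.sum_mul]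

/-- The interaction gains a factor when the input frequency dominates. -/
lemma exists_input_le (Φ : 𝓢(Space n, ℂ)) {Ψ : 𝓢(Space n, ℂ)} (hΨ : Annular Ψ) :
    ∃ C : ℝ≥0, ∀ (j k l : ℤ) (B : ℝ≥0) (β v : SpaceTime n → ℂ), ScaledCoeff j B β → Tame v →
      xkDualNorm k (cv (sc Φ k) fun z => β z * cv (sc Ψ l) v z) ≤
        (C * B) * (al n (j + k) * al n (j + l) * xkNorm l v) *
          (pw (-(j + l : ℤ)) + pw ((k - l : ℤ))) := by
  obtain ⟨ρ, -, hρ⟩ := hΨ.exists_eq_sum_deriv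
  choose C₁ h₁ using fun i => exists_interaction_le Φ (ρ i)
  choose C₂ h₂ using fun i : Fin n => exists_interaction_le
    (∂_{(EuclideanSpace.single i (1 : ℝ) : Space n)} Φ) (ρ i)
  refine ⟨∑ i, (C₁ i + C₂ i), fun j k l B β v hβ hv => ?_⟩
  set X := al n (j + k) * al n (j + l) * xkNorm l v
  rw [funext (hβ.cv_mul_eq_of_input hρ (sc Φ k) l hv)]
  refine (xkDualNorm_const_mul_le _ _ _).trans ?_
  rw [LittlewoodPaley.enorm_two_zpow]
  have ht1 : ∀ i, Tame (cv (sc Φ k) fun z =>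
      dx (EuclideanSpace.single i (1 : ℝ)) β z * cv (sc (ρ i) l) v z) := fun i =>
    ((hβ.tame_dx _).mul (hv.cv _)).cv _
  have ht2 : ∀ i, Tame (cv (∂_{(EuclideanSpace.single i (1 : ℝ) : Space n)} (sc Φ k) :
      𝓢(Space n, ℂ)) fun z => β z * cv (sc (ρ i) l) v z) := fun i =>
    (hβ.tame.mul (hv.cv _)).cv _
  have hj : pw (-2 * j) * pw j * pw ((-l : ℤ)) = pw (-(j + l : ℤ)) := by
    simp only [← pw_add]; congr 1; push_cast; ring
  have hj2 : pw (-j) * pw j * pw ((-l : ℤ)) * pw k = pw ((k - l : ℤ)) := by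
    simp only [← pw_add]; congr 1; push_cast; ring
  have hsub : ∀ i z, cv (∂_{(EuclideanSpace.single i (1 : ℝ) : Space n)} (sc Φ k) :
      𝓢(Space n, ℂ)) (fun z => β z * cv (sc (ρ i) l) v z) z -
        cv (sc Φ k) (fun z => dx (EuclideanSpace.single i (1 : ℝ)) β z * cv (sc (ρ i) l) v z) z =
      cv (∂_{(EuclideanSpace.single i (1 : ℝ) : Space n)} (sc Φ k) :
      𝓢(Space n, ℂ)) (fun z => β z * cv (sc (ρ i) l) v z) z + (-1) *
        cv (sc Φ k) (fun z => dx (EuclideanSpace.single i (1 : ℝ)) β z * cv (sc (ρ i) l) v z) z :=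
    fun i z => by ring
  simp_rw [hsub]
  calc _ ≤ pw ((-l : ℤ)) * ∑ i, (pw k * (C₂ i * (B * pw (-j) * pw j) * X) +
        C₁ i * (B * pw (-2 * j) * pw j) * X) := by
        refine mul_le_mul' le_rfl ((xkDualNorm_sum_le k fun i =>
          Tame.aesm ((ht2 i).add ((ht1 i).const_mul _))).trans
          (Finset.sum_le_sum fun i _ => (xkDualNorm_add_le k (Tame.aesm (ht2 i))
            (Tame.aesm ((ht1 i).const_mul _))).trans (add_le_add ?_ ?_)))
        · have e : (cv (∂_{(EuclideanSpace.single i (1 : ℝ) : Space n)} (sc Φ k) :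
              𝓢(Space n, ℂ)) fun z => β z * cv (sc (ρ i) l) v z) = fun z =>
              (((2 : ℝ) ^ k : ℝ) : ℂ) *
                cv (sc (∂_{(EuclideanSpace.single i (1 : ℝ) : Space n)} Φ) k)
                  (fun z => β z * cv (sc (ρ i) l) v z) z := by
            ext z
            rw [deriv_sc, cv_kernel_smul]
          rw [e]
          refine (xkDualNorm_const_mul_le _ _ _).trans ?_
          rw [LittlewoodPaley.enorm_two_zpow]
          gcongr
          exact h₂ i j k l _ _ v (coe_mul_pw_ne_top _ _) (Tame.aesm hβ.tame) hβ.supp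
            (ae_of_all _ hβ.bound) (Tame.aesm hv)
        · refine (xkDualNorm_const_mul_le _ _ _).trans ?_
          rw [enorm_neg, enorm_one, one_mul]
          exact h₁ i j k l _ _ v (coe_mul_pw_ne_top _ _) (Tame.aesm (hβ.tame_dx _)) (hβ.supp_dx _)
            (hβ.bound_dx i) (Tame.aesm hv)
    _ = ∑ i, (C₁ i * B * X * pw (-(j + l : ℤ)) + C₂ i * B * X * pw ((k - l : ℤ))) := by
        rw [Finset.mul_sum, ← hj, ← hj2]
        refine Finset.sum_congr rfl fun i _ => ?_
        ring
    _ ≤ ∑ i, ((C₁ i + C₂ i) * B * X * (pw (-(j + l : ℤ)) + pw ((k - l : ℤ)))) := by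
        refine Finset.sum_le_sum fun i _ => ?_
        rw [mul_add (_ * X)]
        gcongr
        · exact le_self_add
        · exact le_add_self
    _ = _ := by
        push_cast
        rw [Finset.sum_mul, Finset.sum_mul, Finset.sum_mul]

end ScaledCoeff

/-! ### Multiplication by a scaled coefficient, for `|s| < 1` -/

lemma al_eq_one {m : ℤ} (hm : 0 ≤ m) : al n m = 1 := by
  rw [al, min_eq_right hm, Int.cast_zero, mul_zero, pw_zero]

lemma al_eq_pw {m : ℤ} (hm : m ≤ 0) : al n m = pw (((n : ℝ) - 1) / 2 * m) := by
  rw [al, min_eq_left hm]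

/-- The decay away from the diagonal of the interaction between the frequencies `2^m` and `2^q`
(relative to the position): the Bernstein factors give it when both are small, the integration
by parts when the larger one is large. -/
lemma pw_mul_le_of_interaction {t δ : ℝ} (h1 : δ + t ≤ 1) (h2 : δ + t ≤ ((n : ℝ) - 1) / 2)
    (h3 : 0 ≤ δ + t + ((n : ℝ) - 1) / 2) {m q : ℤ} (hqm : q ≤ m) {X P : ℝ≥0∞}
    (hX : X ≤ P * (al n m * al n q))
    (hX' : X ≤ P * (al n m * al n q) * (pw (-m) + pw (q - m))) :
    pw (t * (m - q)) * X ≤ 2 * P * pw (-(δ * (m - q))) := by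
  have hqm' : (q : ℝ) ≤ m := by exact_mod_cast hqm
  suffices h : X ≤ 2 * P * pw (-((δ + t) * (m - q))) by
    calc _ ≤ pw (t * (m - q)) * (2 * P * pw (-((δ + t) * (m - q)))) := by gcongr
      _ = 2 * P * (pw (t * (m - q)) * pw (-((δ + t) * (m - q)))) := by ring
      _ = _ := by rw [← pw_add]; congr 2; ring
  have h12 : P ≤ 2 * P := by rw [two_mul]; exact le_self_add
  rcases lt_or_ge m 0 with hm | hm
  · refine hX.trans ?_
    rw [al_eq_pw hm.le, al_eq_pw (hqm.trans hm.le), ← pw_add]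
    gcongr
    apply pw_le_pw
    have hm' : (m : ℝ) ≤ 0 := by exact_mod_cast hm.le
    have hq' : (q : ℝ) ≤ 0 := hqm'.trans hm'
    nlinarith [mul_nonneg h3 (neg_nonneg.2 hm'), mul_nonneg (sub_nonneg.2 h2) (neg_nonneg.2 hq')]
  · have hm' : (0 : ℝ) ≤ m := by exact_mod_cast hm
    refine hX'.trans ?_
    rw [al_eq_one hm, one_mul]
    rcases le_or_gt 0 q with hq | hq
    · have hq' : (0 : ℝ) ≤ q := by exact_mod_cast hq
      rw [al_eq_one hq, mul_one, mul_comm 2 P, mul_assoc, two_mul]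
      gcongr
      · apply pw_le_pw
        nlinarith [mul_nonneg (sub_nonneg.2 h1) (sub_nonneg.2 hqm')]
      · apply pw_le_pw
        nlinarith [mul_nonneg (sub_nonneg.2 h1) (sub_nonneg.2 hqm')]
    · have hq' : (q : ℝ) ≤ 0 := by exact_mod_cast hq.le
      rw [al_eq_pw hq.le, mul_assoc, mul_comm 2 P, mul_assoc, two_mul, mul_add]
      have h : ((n : ℝ) - 1) / 2 * q + -m ≤ -((δ + t) * (m - q)) := by
        nlinarith [mul_nonneg (sub_nonneg.2 h1) hm', mul_nonneg (sub_nonneg.2 h2)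
          (neg_nonneg.2 hq')]
      gcongr
      · rw [← pw_add]
        exact pw_le_pw h
      · rw [← pw_add]
        exact pw_le_pw (le_trans (by linarith) h)

lemma sqrt_schur_sub (A a : ℤ → ℝ≥0∞) :
    (∑' k, (∑' l, A (k - l) * a l) ^ 2) ^ (1 / 2 : ℝ) ≤
      (∑' m, A m) * (∑' l, a l ^ 2) ^ (1 / 2 : ℝ) := by
  apply sqrt_le_of_le_sq
  rw [mul_pow, sqrt_sq]
  exact schur_test_sub A a

namespace LittlewoodPaley

variable (S : LittlewoodPaley n)

lemma tendsto_cv_mul_partialSum (hn : n ≠ 0) {β : SpaceTime n → ℂ} (hβ : Tame β)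
    (K : 𝓢(Space n, ℂ)) (v : 𝓢(SpaceTime n, ℂ)) (z : SpaceTime n) :
    Tendsto (fun N => cv K (fun z => β z * S.partialSum N v z) z) atTop
      (𝓝 (cv K (fun z => β z * v z) z)) := by
  obtain ⟨t, x⟩ := z
  obtain ⟨M, hM⟩ := hβ.bdd t
  obtain ⟨M', hM'⟩ := S.exists_norm_partialSum_le v t
  have ht : ∀ N, Tame (fun z => β z * S.partialSum N v z) := fun N =>
    hβ.mul (Tame.sum fun l _ => (tame_schwartz v).cv _)
  refine tendsto_integral_of_dominated_convergence (fun y => ‖K y‖ * (M * M'))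
    (fun N => ((ht N).integrable K.integrable (t, x)).1) (K.integrable.norm.mul_const _)
    (fun N => ae_of_all _ fun y => ?_) (ae_of_all _ fun y => ?_)
  · rw [norm_mul, norm_mul]
    gcongr
    · exact (norm_nonneg _).trans (hM (x - y))
    · exact hM _
    · exact hM' _ _
  · exact ((S.tendsto_partialSum hn v _).const_mul _).const_mul _

lemma cv_mul_partialSum {β : SpaceTime n → ℂ} (hβ : Tame β)
    (K : 𝓢(Space n, ℂ)) (v : 𝓢(SpaceTime n, ℂ)) (N : ℕ) (z : SpaceTime n) :
    cv K (fun z => β z * S.partialSum N v z) z =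
      ∑ l ∈ Finset.Icc (-N : ℤ) N, cv K (fun z => β z * cv (sc S.prof l) v z) z := by
  simp_rw [partialSum, Finset.mul_sum]
  exact cv_sum (fun l _ => hβ.mul ((tame_schwartz v).cv _)) K z

/-- The Littlewood–Paley decomposition of the second factor of a product. -/
lemma enorm_cv_mul_le_tsum (hn : n ≠ 0) {β : SpaceTime n → ℂ} (hβ : Tame β)
    (K : 𝓢(Space n, ℂ)) (v : 𝓢(SpaceTime n, ℂ)) (z : SpaceTime n) :
    ‖cv K (fun z => β z * v z) z‖ₑ ≤
      ∑' l : ℤ, ‖cv K (fun z => β z * cv (sc S.prof l) v z) z‖ₑ := by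
  refine le_of_tendsto (S.tendsto_cv_mul_partialSum hn hβ K v z).enorm
    (Eventually.of_forall fun N => ?_)
  rw [cv_mul_partialSum S hβ]
  exact (enorm_sum_le _ _).trans (ENNReal.sum_le_tsum _)

/-- The interior range of exponents: the interaction of the frequencies `2^k` and `2^l` decays
away from the diagonal. -/
theorem exists_mul_le (hn : 1 ≤ n) {s : ℝ} (h1 : |s| < 1) (h2 : |s| < ((n : ℝ) - 1) / 2) :
    ∃ C : ℝ≥0, ∀ (j : ℤ) (B : ℝ≥0) (β : SpaceTime n → ℂ) (v : 𝓢(SpaceTime n, ℂ)),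
      ScaledCoeff j B β →
      (∑' k : ℤ, (pw (s * k) * xkDualNorm k (cv (sc S.prof k) fun z => β z * v z)) ^ 2) ^
          (1 / 2 : ℝ) ≤
        C * (B * (∑' l : ℤ, (pw (s * l) * xkNorm l (cv (sc S.prof l) v)) ^ 2) ^ (1 / 2 : ℝ)) := by
  obtain ⟨C₀, hC₀⟩ := exists_interaction_le S.prof S.wide
  obtain ⟨C₁, hC₁⟩ := ScaledCoeff.exists_output_le S.annular_prof S.wide
  obtain ⟨C₂, hC₂⟩ := ScaledCoeff.exists_input_le S.prof S.annular_wide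
  -- the gain of one derivative and that of Bernstein's inequality, less the loss from the weights
  set δ := min (1 - |s|) (((n : ℝ) - 1) / 2 - |s|) with hδ
  have hδ0 : 0 < δ := lt_min (by linarith) (by linarith)
  have hδ1 : δ ≤ 1 - |s| := min_le_left _ _
  have hδ2 : δ ≤ ((n : ℝ) - 1) / 2 - |s| := min_le_right _ _
  have hs1 := le_abs_self s
  have hs2 := neg_abs_le s
  set A : ℤ → ℝ≥0∞ := fun m => pw (-(δ * |(m : ℝ)|)) with hA
  have hsum : ∑' m, A m ≠ ⊤ := tsum_pw_abs_ne_top hδ0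
  refine ⟨2 * (C₀ + C₁ + C₂) * (∑' m, A m).toNNReal, fun j B β v hβ => ?_⟩
  have hv := tame_schwartz v
  set D : ℤ → ℝ≥0∞ := fun l => xkNorm l (cv (sc S.prof l) v) with hD
  have key : ∀ k l : ℤ,
      pw (s * k) * xkDualNorm k (cv (sc S.prof k) fun z => β z * cv (sc S.prof l) v z) ≤
        (2 * (C₀ + C₁ + C₂ : ℝ≥0) * B) * (A (k - l) * (pw (s * l) * D l)) := by
    intro k l
    set X := xkDualNorm k (cv (sc S.prof k) fun z => β z * cv (sc S.prof l) v z) with hX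
    have hX₀ : X ≤ (C₀ * B) * (al n (j + k) * al n (j + l) * D l) := by
      have := hC₀ j k l (B * pw (-j)) β (cv (sc S.prof l) v) (coe_mul_pw_ne_top _ _)
        (Tame.aesm hβ.tame) hβ.supp (ae_of_all _ hβ.bound) (Tame.aesm (hv.cv _))
      rw [S.wide_proj l hv] at this
      refine this.trans (le_of_eq ?_)
      rw [mul_assoc (B : ℝ≥0∞), ← pw_add, neg_add_cancel, pw_zero, mul_one]
    have hX₁ := hC₁ j k l B β (cv (sc S.prof l) v) hβ (hv.cv _)
    have hX₂ := hC₂ j k l B β (cv (sc S.prof l) v) hβ (hv.cv _)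
    rw [S.wide_proj l hv] at hX₁ hX₂
    set P : ℝ≥0∞ := ((C₀ + C₁ + C₂ : ℝ≥0) : ℝ≥0∞) * B * D l with hP
    have hc₀ : (C₀ : ℝ≥0∞) * B * D l ≤ P := by
      rw [hP]
      gcongr
      rw [add_assoc]
      exact le_self_add
    have hc₁ : (C₁ : ℝ≥0∞) * B * D l ≤ P := by
      rw [hP]
      gcongr
      rw [add_comm C₀, add_assoc]
      exact le_self_add
    have hc₂ : (C₂ : ℝ≥0∞) * B * D l ≤ P := by
      rw [hP]
      gcongr
      exact le_add_self
    have fin : ∀ Q : ℝ≥0∞, pw (s * (k - l)) * X ≤ 2 * P * Q →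
        pw (s * k) * X ≤ (2 * (C₀ + C₁ + C₂ : ℝ≥0) * B) * (Q * (pw (s * l) * D l)) := by
      intro Q h
      calc pw (s * k) * X = pw (s * l) * (pw (s * (k - l)) * X) := by
            rw [← mul_assoc, ← pw_add]; congr 2; ring
        _ ≤ pw (s * l) * (2 * P * Q) := by gcongr
        _ = _ := by rw [hP]; ring
    apply fin
    have hA' : A (k - l) = pw (-(δ * |((k : ℝ) - l)|)) := by simp only [hA]; push_cast; rfl
    rw [hA']
    rcases le_total l k with hlk | hkl
    · have hlk' : (l : ℝ) ≤ k := by exact_mod_cast hlk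
      have := pw_mul_le_of_interaction (n := n) (t := s) (δ := δ) (by linarith) (by linarith)
        (by linarith) (m := j + k) (q := j + l) (by lia) (X := X) (P := P)
        (hX₀.trans ?_) (hX₁.trans ?_)
      · rw [abs_of_nonneg (by linarith)]
        push_cast at this
        convert this using 3 <;> ring
      · calc _ = (C₀ : ℝ≥0∞) * B * D l * (al n (j + k) * al n (j + l)) := by ring
          _ ≤ _ := by gcongr
      · calc _ = (C₁ : ℝ≥0∞) * B * D l * (al n (j + k) * al n (j + l)) *
              (pw (-(j + k : ℤ)) + pw ((l - k : ℤ))) := by ring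
          _ ≤ P * (al n (j + k) * al n (j + l)) *
              (pw (-(j + k : ℤ)) + pw ((l - k : ℤ))) := by gcongr
          _ = _ := by congr 3; push_cast; ring
    · have hkl' : (k : ℝ) ≤ l := by exact_mod_cast hkl
      have := pw_mul_le_of_interaction (n := n) (t := -s) (δ := δ) (by linarith) (by linarith)
        (by linarith) (m := j + l) (q := j + k) (by lia) (X := X) (P := P)
        (hX₀.trans ?_) (hX₂.trans ?_)
      · rw [abs_of_nonpos (by linarith)]
        push_cast at this
        convert this using 3 <;> ring
      · calc _ = (C₀ : ℝ≥0∞) * B * D l * (al n (j + l) * al n (j + k)) := by ring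
          _ ≤ _ := by gcongr
      · calc _ = (C₂ : ℝ≥0∞) * B * D l * (al n (j + l) * al n (j + k)) *
              (pw (-(j + l : ℤ)) + pw ((k - l : ℤ))) := by ring
          _ ≤ P * (al n (j + l) * al n (j + k)) *
              (pw (-(j + l : ℤ)) + pw ((k - l : ℤ))) := by gcongr
          _ = _ := by congr 3; push_cast; ring
  have hrow : ∀ k : ℤ, pw (s * k) * xkDualNorm k (cv (sc S.prof k) fun z => β z * v z) ≤
      (2 * (C₀ + C₁ + C₂ : ℝ≥0) * B) * ∑' l : ℤ, A (k - l) * (pw (s * l) * D l) := by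
    intro k
    calc _ ≤ pw (s * k) * ∑' l : ℤ,
          xkDualNorm k (cv (sc S.prof k) fun z => β z * cv (sc S.prof l) v z) := by
          gcongr
          exact xkDualNorm_le_tsum k
            (fun l => Tame.aesm ((hβ.tame.mul (hv.cv (sc S.prof l))).cv _))
            (S.enorm_cv_mul_le_tsum (by omega) hβ.tame _ v)
      _ ≤ _ := by
          rw [← ENNReal.tsum_mul_left, ← ENNReal.tsum_mul_left]
          exact ENNReal.tsum_le_tsum (key k)
  calc _ ≤ (2 * (C₀ + C₁ + C₂ : ℝ≥0) * B) * ((∑' m, A m) *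
        (∑' l : ℤ, (pw (s * l) * D l) ^ 2) ^ (1 / 2 : ℝ)) := by
        refine (sqrt_tsum_mono hrow).trans ?_
        rw [sqrt_mul_sq]
        gcongr
        exact sqrt_schur_sub A _
    _ = _ := by
        rw [ENNReal.coe_mul, ENNReal.coe_toNNReal hsum]
        push_cast
        ring

end LittlewoodPaley

/-! ### Multiplication by a scaled coefficient, for `s = ±1` -/

lemma sqrt_tsum_shift_le (A : ℤ → ℝ≥0∞) (j : ℤ) :
    (∑' l, A (j + l) ^ 2) ^ (1 / 2 : ℝ) ≤ ∑' m, A m := by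
  apply sqrt_le_of_le_sq
  rw [← (Equiv.addLeft j).tsum_eq A]
  exact tsum_sq_le_sq_tsum _

namespace LittlewoodPaley

variable (S : LittlewoodPaley n)

/-- A Hardy inequality. The kernel `al n m * 2^{-m}` is summable because `(n-1)/2 > 1`. -/
lemma exists_cyl_le_sq_pw (hn : 4 ≤ n) : ∃ C : ℝ≥0, ∀ (v : 𝓢(SpaceTime n, ℂ)) (j : ℤ),
    eLpNorm v 2 (volume.restrict (cyl n j)) ≤ C * (pw (3 * j / 2) *
      (∑' l : ℤ, (pw l * xkNorm l (cv (sc S.prof l) v)) ^ 2) ^ (1 / 2 : ℝ)) := by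
  obtain ⟨C, hC⟩ := S.exists_cyl_le_tsum_proj (by omega)
  have hn' : (4 : ℝ) ≤ n := by exact_mod_cast hn
  set A : ℤ → ℝ≥0∞ := fun m => al n m * pw (-1 * m) with hA
  have hs : ∑' m, A m ≠ ⊤ := tsum_al_pw_ne_top (by norm_num) (by linarith)
  refine ⟨C * (∑' m, A m).toNNReal, fun v j => (hC v j).trans ?_⟩
  set D : ℤ → ℝ≥0∞ := fun l => xkNorm l (cv (sc S.prof l) v)
  have e : ∀ l : ℤ, pw (j / 2) * al n (j + l) * D l =
      pw (3 * j / 2) * (A (j + l) * (pw l * D l)) := by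
    intro l
    have : pw ((j : ℝ) / 2) = pw (3 * j / 2) * pw (-1 * (j + l : ℤ)) * pw l := by
      simp only [← pw_add]
      congr 1
      push_cast
      ring
    simp only [hA]
    rw [this]
    ring
  calc _ = C * (pw (3 * j / 2) * ∑' l : ℤ, A (j + l) * (pw l * D l)) := by
        rw [← ENNReal.tsum_mul_left (a := pw _), ← tsum_congr e]
    _ ≤ C * (pw (3 * j / 2) * ((∑' m, A m) * (∑' l : ℤ, (pw l * D l) ^ 2) ^ (1 / 2 : ℝ))) := by
        refine mul_le_mul' le_rfl (mul_le_mul' le_rfl ((tsum_mul_le_sqrt _ _).trans ?_))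
        exact mul_le_mul' (sqrt_tsum_shift_le A j) le_rfl
    _ = _ := by
        rw [ENNReal.coe_mul, ENNReal.coe_toNNReal hs]
        ring

/-- The endpoint `s = 1`, where one derivative is moved from the frequency projection to the
product. -/
theorem exists_mul_one_le (hn : 4 ≤ n) :
    ∃ C : ℝ≥0, ∀ (j : ℤ) (B : ℝ≥0) (β : SpaceTime n → ℂ) (v : 𝓢(SpaceTime n, ℂ)),
      ScaledCoeff j B β →
      (∑' k : ℤ, (pw k * xkDualNorm k (cv (sc S.prof k) fun z => β z * v z)) ^ 2) ^
          (1 / 2 : ℝ) ≤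
        C * (B * (∑' l : ℤ, (pw l * xkNorm l (cv (sc S.prof l) v)) ^ 2) ^ (1 / 2 : ℝ)) := by
  obtain ⟨ρ, hρa, hρ⟩ := S.annular_prof.exists_eq_sum_deriv
  choose C₁ hC₁ using fun i => exists_tsum_xkDualNorm_le (by omega) (hρa i)
  obtain ⟨C₂, hC₂⟩ := S.exists_cyl_le_sq_pw hn
  choose C₃ hC₃ using S.exists_cyl_dx_le_sq (by omega)
  refine ⟨∑ i, (C₁ i * C₂ + C₁ i * C₃ i), fun j B β v hβ => ?_⟩
  have hv := tame_schwartz v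
  set X : ℝ≥0∞ := (∑' l : ℤ, (pw l * xkNorm l (cv (sc S.prof l) v)) ^ 2) ^ (1 / 2 : ℝ)
  have hdv : ∀ e, Tame (dx e v) := fun e => by
    rw [dx_schwartz]
    exact tame_schwartz _
  set f : Fin n → SpaceTime n → ℂ := fun i z => dx (EuclideanSpace.single i (1 : ℝ)) β z * v z
    with hf
  set g : Fin n → SpaceTime n → ℂ := fun i z => β z * dx (EuclideanSpace.single i (1 : ℝ)) v z
    with hg
  have tf : ∀ i, Tame (f i) := fun i => (hβ.tame_dx _).mul hv
  have tg : ∀ i, Tame (g i) := fun i => hβ.tame.mul (hdv _)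
  have sf : ∀ i, ∀ z ∉ cyl n j, f i z = 0 := fun i z hz => by simp [hf, hβ.supp_dx _ z hz]
  have sg : ∀ i, ∀ z ∉ cyl n j, g i z = 0 := fun i z hz => by simp [hg, hβ.supp z hz]
  have hrow : ∀ k : ℤ, pw k * xkDualNorm k (cv (sc S.prof k) fun z => β z * v z) ≤
      ∑ i, (xkDualNorm k (cv (sc (ρ i) k) (f i)) + xkDualNorm k (cv (sc (ρ i) k) (g i))) := by
    intro k
    rw [funext (hβ.cv_mul_eq_of_output hρ k hv (lipSlices_schwartz v) hdv)]
    calc _ ≤ pw k * (pw ((-k : ℤ)) * ∑ i, (xkDualNorm k (cv (sc (ρ i) k) (f i)) +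
          xkDualNorm k (cv (sc (ρ i) k) (g i)))) := by
          refine mul_le_mul' le_rfl ((xkDualNorm_const_mul_le _ _ _).trans ?_)
          rw [enorm_two_zpow]
          refine mul_le_mul' le_rfl ((xkDualNorm_sum_le k fun i => Tame.aesm
            (((tf i).cv _).add ((tg i).cv _))).trans (Finset.sum_le_sum fun i _ => ?_))
          exact xkDualNorm_add_le k (Tame.aesm ((tf i).cv _))
            (Tame.aesm ((tg i).cv _))
      _ = _ := by
          rw [← mul_assoc, ← pw_add]
          simp
  have bf : ∀ i, C₁ i * (pw ((j : ℝ) / 2) * eLpNorm (f i) 2 volume) ≤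
      C₁ i * C₂ * (B * X) := fun i => by
    calc _ ≤ C₁ i * (pw ((j : ℝ) / 2) * (B * pw (-2 * j) * (C₂ * (pw (3 * j / 2) * X)))) := by
          refine mul_le_mul' le_rfl (mul_le_mul' le_rfl ?_)
          exact (eLpNorm_mul_le_of_support (coe_mul_pw_ne_top _ _) _ (hβ.supp_dx _)
            (hβ.bound_dx i)).trans (mul_le_mul' le_rfl (hC₂ v j))
      _ = C₁ i * C₂ * (B * X) * (pw ((j : ℝ) / 2) * pw (-2 * j) * pw (3 * j / 2)) := by ring
      _ = _ := by
          simp only [← pw_add]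
          rw [show (j : ℝ) / 2 + -2 * j + 3 * j / 2 = 0 by ring, pw_zero, mul_one]
  have bg : ∀ i, C₁ i * (pw ((j : ℝ) / 2) * eLpNorm (g i) 2 volume) ≤
      C₁ i * C₃ i * (B * X) := fun i => by
    calc _ ≤ C₁ i * (pw ((j : ℝ) / 2) * (B * pw (-j) * (C₃ i * (pw (j / 2) * X)))) := by
          refine mul_le_mul' le_rfl (mul_le_mul' le_rfl ?_)
          exact (eLpNorm_mul_le_of_support (coe_mul_pw_ne_top _ _) _ hβ.supp
            (ae_of_all _ hβ.bound)).trans (mul_le_mul' le_rfl (hC₃ i v j))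
      _ = C₁ i * C₃ i * (B * X) * (pw ((j : ℝ) / 2) * pw (-j) * pw (j / 2)) := by ring
      _ = _ := by
          simp only [← pw_add]
          rw [show (j : ℝ) / 2 + -j + j / 2 = 0 by ring, pw_zero, mul_one]
  calc _ ≤ ∑ i, (C₁ i * (pw ((j : ℝ) / 2) * eLpNorm (f i) 2 volume) +
        C₁ i * (pw ((j : ℝ) / 2) * eLpNorm (g i) 2 volume)) := by
        refine (sqrt_tsum_mono hrow).trans ((l2_sum_le _).trans (Finset.sum_le_sum fun i _ => ?_))
        refine (l2_add_le _ _).trans (add_le_add ?_ ?_)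
        · exact hC₁ i j _ (Tame.aesm (tf i)) (sf i)
        · exact hC₁ i j _ (Tame.aesm (tg i)) (sg i)
    _ ≤ ∑ i, ((C₁ i * C₂ : ℝ≥0∞) * (B * X) + C₁ i * C₃ i * (B * X)) :=
        Finset.sum_le_sum fun i _ => add_le_add (bf i) (bg i)
    _ = _ := by
        push_cast
        rw [Finset.sum_mul]
        simp_rw [add_mul]

/-- The endpoint `s = -1`, where one derivative is moved from the second factor to the frequency
projection and to the coefficient. -/
theorem exists_mul_neg_one_le (hn : 4 ≤ n) :
    ∃ C : ℝ≥0, ∀ (j : ℤ) (B : ℝ≥0) (β : SpaceTime n → ℂ) (v : 𝓢(SpaceTime n, ℂ)),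
      ScaledCoeff j B β →
      (∑' k : ℤ, (pw (-k) * xkDualNorm k (cv (sc S.prof k) fun z => β z * v z)) ^ 2) ^
          (1 / 2 : ℝ) ≤
        C * (B * (∑' l : ℤ, (pw (-l) * xkNorm l (cv (sc S.prof l) v)) ^ 2) ^ (1 / 2 : ℝ)) := by
  have hn' : (4 : ℝ) ≤ n := by exact_mod_cast hn
  obtain ⟨ρ, hρa, hρ⟩ := S.annular_wide.exists_eq_sum_deriv
  choose C₁ hC₁ using fun i : Fin n => exists_tsum_xkDualNorm_le (by omega)
    (S.annular_prof.deriv (EuclideanSpace.single i (1 : ℝ)))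
  obtain ⟨C₂, hC₂⟩ := exists_xkDualNorm_cyl_le S.prof
  choose C₃ hC₃ using fun i => exists_eLpNorm_cyl_sum_le (by omega) (hρa i)
  set A : ℤ → ℝ≥0∞ := fun m => al n m * pw (-1 * m) with hA
  have hs : ∑' m, A m ≠ ⊤ := tsum_al_pw_ne_top (by norm_num) (by linarith)
  refine ⟨∑ i, (C₁ i + C₂ * (∑' m, A m).toNNReal) * C₃ i, fun j B β v hβ => ?_⟩
  have hv := tame_schwartz v
  set X : ℝ≥0∞ := (∑' l : ℤ, (pw (-l) * xkNorm l (cv (sc S.prof l) v)) ^ 2) ^ (1 / 2 : ℝ) with hX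
  set W : ℤ → SpaceTime n → ℂ := fun l z => (((2 : ℝ) ^ (-l) : ℝ) : ℂ) * cv (sc S.prof l) v z
    with hW
  have tW : ∀ l, Tame (W l) := fun l => (hv.cv _).const_mul _
  set w : Fin n → ℕ → SpaceTime n → ℂ := fun i N z =>
    ∑ l ∈ Finset.Icc (-N : ℤ) N, cv (sc (ρ i) l) (W l) z with hw
  have tw : ∀ i N, Tame (w i N) := fun i N => Tame.sum fun l _ => (tW l).cv _
  set f : Fin n → ℕ → SpaceTime n → ℂ := fun i N z => β z * w i N z with hf
  set g : Fin n → ℕ → SpaceTime n → ℂ := fun i N z =>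
    dx (EuclideanSpace.single i (1 : ℝ)) β z * w i N z with hg
  have tf : ∀ i N, Tame (f i N) := fun i N => hβ.tame.mul (tw i N)
  have tg : ∀ i N, Tame (g i N) := fun i N => (hβ.tame_dx _).mul (tw i N)
  have bw : ∀ i N, eLpNorm (w i N) 2 (volume.restrict (cyl n j)) ≤
      C₃ i * (pw (j / 2) * X) := fun i N => by
    refine (hC₃ i j _ W fun l _ => (S.memLp_proj l v).const_mul _).trans (le_of_eq ?_)
    simp only [hX, hW, xkNorm_two_zpow_mul]
    push_cast
    rfl
  have bf : ∀ i N, pw ((j : ℝ) / 2) * eLpNorm (f i N) 2 volume ≤ C₃ i * (B * X) := fun i N => by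
    calc _ ≤ pw ((j : ℝ) / 2) * (B * pw (-j) * (C₃ i * (pw (j / 2) * X))) := by
          refine mul_le_mul' le_rfl ((eLpNorm_mul_le_of_support (coe_mul_pw_ne_top _ _) _ hβ.supp
            (ae_of_all _ hβ.bound)).trans (mul_le_mul' le_rfl (bw i N)))
      _ = C₃ i * (B * X) * (pw ((j : ℝ) / 2) * pw (-j) * pw (j / 2)) := by ring
      _ = _ := by
          simp only [← pw_add]
          rw [show (j : ℝ) / 2 + -j + j / 2 = 0 by ring, pw_zero, mul_one]
  have bg : ∀ i N, eLpNorm (g i N) 2 volume ≤ C₃ i * (B * X) * pw (-(3 * j / 2)) := fun i N => by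
    calc _ ≤ B * pw (-2 * j) * (C₃ i * (pw (j / 2) * X)) := by
          refine ((eLpNorm_mul_le_of_support (coe_mul_pw_ne_top _ _) _ (hβ.supp_dx _)
            (hβ.bound_dx i)).trans (mul_le_mul' le_rfl (bw i N)))
      _ = C₃ i * (B * X) * (pw (-2 * j) * pw (j / 2)) := by ring
      _ = _ := by
          rw [← pw_add]
          congr 2
          ring
  -- the truncated sum over the input frequencies, with the derivative moved away from the input
  have hcv : ∀ N (k : ℤ) z, cv (sc S.prof k) (fun z => β z * S.partialSum N v z) z =
      ∑ i, ((((2 : ℝ) ^ k : ℝ) : ℂ) *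
          cv (sc (∂_{(EuclideanSpace.single i (1 : ℝ) : Space n)} S.prof) k) (f i N) z +
        (-1) * cv (sc S.prof k) (g i N) z) := by
    intro N k z
    rw [S.cv_mul_partialSum hβ.tame]
    have e1 : ∀ l : ℤ, cv (sc S.prof k) (fun z => β z * cv (sc S.prof l) v z) z =
        ∑ i, ((((2 : ℝ) ^ k : ℝ) : ℂ) *
          cv (sc (∂_{(EuclideanSpace.single i (1 : ℝ) : Space n)} S.prof) k)
            (fun z => β z * cv (sc (ρ i) l) (W l) z) z +
        (-1) * cv (sc S.prof k)
          (fun z => dx (EuclideanSpace.single i (1 : ℝ)) β z * cv (sc (ρ i) l) (W l) z) z) := by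
      intro l
      have := hβ.cv_mul_eq_of_input hρ (sc S.prof k) l (hv.cv (sc S.prof l)) z
      rw [S.wide_proj l hv] at this
      rw [this, Finset.mul_sum]
      refine Finset.sum_congr rfl fun i _ => ?_
      have e2 : ∀ z, cv (sc (ρ i) l) (W l) z =
          (((2 : ℝ) ^ (-l) : ℝ) : ℂ) * cv (sc (ρ i) l) (cv (sc S.prof l) v) z := fun z =>
        cv_const_mul _ _ _ z
      simp_rw [e2, mul_left_comm _ (((2 : ℝ) ^ (-l) : ℝ) : ℂ)]
      rw [cv_const_mul, cv_const_mul, deriv_sc, cv_kernel_smul]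
      ring
    simp_rw [e1]
    rw [Finset.sum_comm]
    refine Finset.sum_congr rfl fun i _ => ?_
    rw [Finset.sum_add_distrib, ← Finset.mul_sum, ← Finset.mul_sum]
    simp only [hf, hg, hw, Finset.mul_sum]
    rw [cv_sum fun l _ => hβ.tame.mul ((tW l).cv _),
      cv_sum fun l _ => (hβ.tame_dx _).mul ((tW l).cv _)]
    simp only [Finset.mul_sum]
  have hrow : ∀ N (k : ℤ),
      pw (-k) * xkDualNorm k (cv (sc S.prof k) fun z => β z * S.partialSum N v z) ≤
      ∑ i, (xkDualNorm k
          (cv (sc (∂_{(EuclideanSpace.single i (1 : ℝ) : Space n)} S.prof) k) (f i N)) +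
        C₂ * (C₃ i * (B * X)) * A (j + k)) := by
    intro N k
    rw [funext (hcv N k)]
    have tF := fun i => ((tf i N).cv
      (sc (∂_{(EuclideanSpace.single i (1 : ℝ) : Space n)} S.prof) k)).const_mul
        (((2 : ℝ) ^ k : ℝ) : ℂ)
    have tG := fun i => ((tg i N).cv (sc S.prof k)).const_mul (-1)
    refine (mul_le_mul' le_rfl (xkDualNorm_sum_le k fun i =>
      Tame.aesm ((tF i).add (tG i)))).trans ?_
    rw [Finset.mul_sum]
    refine Finset.sum_le_sum fun i _ => (mul_le_mul' le_rfl (xkDualNorm_add_le k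
      (Tame.aesm (tF i)) (Tame.aesm (tG i)))).trans ?_
    rw [mul_add]
    refine add_le_add ?_ ?_
    · refine (mul_le_mul' le_rfl (xkDualNorm_const_mul_le _ _ _)).trans (le_of_eq ?_)
      rw [enorm_two_zpow, ← mul_assoc, ← pw_add, neg_add_cancel, pw_zero, one_mul]
    · calc _ ≤ pw (-k) * (C₂ * (pw (j / 2) * al n (j + k) *
            (C₃ i * (B * X) * pw (-(3 * j / 2))))) := by
            refine mul_le_mul' le_rfl ((xkDualNorm_const_mul_le _ _ _).trans ?_)
            rw [enorm_neg, enorm_one, one_mul]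
            refine (hC₂ j k _ (Tame.aesm (tg i N)) fun z hz => ?_).trans ?_
            · simp [hg, hβ.supp_dx _ z hz]
            · exact mul_le_mul' le_rfl (mul_le_mul' le_rfl (bg i N))
        _ = C₂ * (C₃ i * (B * X)) * (al n (j + k) *
            (pw (-k) * pw (j / 2) * pw (-(3 * j / 2)))) := by ring
        _ = _ := by
            simp only [hA, ← pw_add]
            congr 3
            push_cast
            ring
  have hN : ∀ N, (∑' k : ℤ, (pw (-k) *
      xkDualNorm k (cv (sc S.prof k) fun z => β z * S.partialSum N v z)) ^ 2) ^ (1 / 2 : ℝ) ≤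
        ∑ i, (C₁ i + C₂ * ∑' m, A m) * C₃ i * (B * X) := by
    intro N
    refine (sqrt_tsum_mono (hrow N)).trans ((l2_sum_le _).trans (Finset.sum_le_sum fun i _ => ?_))
    rw [mul_assoc, add_mul]
    refine (l2_add_le _ _).trans (add_le_add ?_ ?_)
    · refine (hC₁ i j _ (Tame.aesm (tf i N)) fun z hz => ?_).trans
        (mul_le_mul' le_rfl (bf i N))
      simp [hf, hβ.supp z hz]
    · rw [sqrt_mul_sq]
      calc _ ≤ C₂ * (C₃ i * (B * X)) * ∑' m, A m := mul_le_mul' le_rfl (sqrt_tsum_shift_le A j)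
        _ = _ := by ring
  calc _ ≤ ∑ i, (C₁ i + C₂ * ∑' m, A m) * C₃ i * (B * X) := by
        apply sqrt_le_of_le_sq
        refine le_trans (ENNReal.tsum_le_tsum fun k => ?_) (tsum_liminf_sq_le (fun N k => pw (-k) *
          xkDualNorm k (cv (sc S.prof k) fun z => β z * S.partialSum N v z)) fun N => ?_)
        · gcongr
          rw [ENNReal.liminf_const_mul_of_ne_top (pw_ne_top _)]
          refine mul_le_mul' le_rfl (xkDualNorm_le_liminf k (fun N => ?_)
            (S.tendsto_cv_mul_partialSum (by omega) hβ.tame _ v))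
          exact Tame.aesm ((hβ.tame.mul (Tame.sum fun l _ => hv.cv _)).cv _)
        · have := pow_le_pow_left' (hN N) 2
          rwa [sqrt_sq] at this
    _ = _ := by
        rw [← Finset.sum_mul]
        push_cast
        rw [ENNReal.coe_toNNReal hs]

end LittlewoodPaley

/-! ### Dyadic decomposition of a Lipschitz coefficient -/

/-- The continuous piecewise linear function which is `0` for `|x| ≤ 2^{j-1}` and `1` for
`|x| ≥ 2^j`. -/
def ramp (j : ℤ) (x : Space n) : ℝ := max 0 (min 1 (‖x‖ / 2 ^ (j - 1) - 1))

lemma ramp_eq_zero {j : ℤ} {x : Space n} (h : ‖x‖ ≤ 2 ^ (j - 1)) : ramp j x = 0 := by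
  have : ‖x‖ / 2 ^ (j - 1) ≤ 1 := (div_le_one (by positivity)).2 h
  exact max_eq_left ((min_le_right _ _).trans (by linarith))

lemma ramp_eq_one {j : ℤ} {x : Space n} (h : 2 ^ j ≤ ‖x‖) : ramp j x = 1 := by
  have : 2 ≤ ‖x‖ / 2 ^ (j - 1) := by
    rw [le_div_iff₀ (by positivity), mul_comm, ← zpow_add_one₀ (by norm_num), sub_add_cancel]
    exact h
  rw [ramp, min_eq_left (by linarith), max_eq_right (by norm_num)]

lemma ramp_nonneg (j : ℤ) (x : Space n) : 0 ≤ ramp j x := le_max_left _ _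

lemma ramp_le_one (j : ℤ) (x : Space n) : ramp j x ≤ 1 :=
  max_le zero_le_one (min_le_left _ _)

lemma lipschitz_ramp (j : ℤ) : LipschitzWith (2 * 2 ^ (-j)) (ramp j : Space n → ℝ) := by
  have h1 : LipschitzWith (2 * 2 ^ (-j)) fun x : Space n => ‖x‖ / 2 ^ (j - 1) - 1 := by
    refine LipschitzWith.of_dist_le_mul fun x y => ?_
    have e : ((2 * 2 ^ (-j) : ℝ≥0) : ℝ) = (2 ^ (j - 1))⁻¹ := by
      push_cast
      rw [zpow_sub_one₀ (by norm_num), zpow_neg, mul_inv, inv_inv, mul_comm]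
    rw [e, Real.dist_eq, dist_eq_norm, sub_sub_sub_cancel_right, ← sub_div, abs_div,
      abs_of_pos (by positivity : (0 : ℝ) < 2 ^ (j - 1)), div_eq_inv_mul]
    gcongr
    exact abs_norm_sub_norm_le x y
  exact (h1.const_min 1).const_max 0

/-- The Lipschitz partition of unity `1 = ∑_j χ_j(x)`, `x ≠ 0`, with `χ_j` supported in
`2^{j-1} ≤ |x| ≤ 2^{j+1}`. -/
def tent (j : ℤ) (x : Space n) : ℝ := ramp j x - ramp (j + 1) x

lemma tent_eq_zero_of_le {j : ℤ} {x : Space n} (h : ‖x‖ ≤ 2 ^ (j - 1)) : tent j x = 0 := by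
  have h2 : ‖x‖ ≤ 2 ^ (j + 1 - 1) := h.trans (zpow_le_zpow_right₀ (by norm_num) (by lia))
  rw [tent, ramp_eq_zero h, ramp_eq_zero h2, sub_zero]

lemma tent_eq_zero_of_ge {j : ℤ} {x : Space n} (h : 2 ^ (j + 1) ≤ ‖x‖) : tent j x = 0 := by
  have h2 : (2 : ℝ) ^ j ≤ ‖x‖ := le_trans (zpow_le_zpow_right₀ (by norm_num) (by lia)) h
  rw [tent, ramp_eq_one h, ramp_eq_one h2, sub_self]

lemma tent_nonneg (j : ℤ) (x : Space n) : 0 ≤ tent j x := by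
  rcases le_total ‖x‖ (2 ^ j) with h | h
  · rw [tent, ramp_eq_zero (j := j + 1) (by simpa using h), sub_zero]
    exact ramp_nonneg _ _
  · rw [tent, ramp_eq_one h, sub_nonneg]
    exact ramp_le_one _ _

lemma tent_le_one (j : ℤ) (x : Space n) : tent j x ≤ 1 := by
  have := ramp_le_one j x
  have := ramp_nonneg (j + 1) x
  rw [tent]
  linarith

lemma norm_tent_le_one (j : ℤ) (x : Space n) : ‖(tent j x : ℂ)‖ ≤ 1 := by
  rw [Complex.norm_real, Real.norm_of_nonneg (tent_nonneg j x)]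
  exact tent_le_one j x

lemma lipschitz_tent (j : ℤ) : LipschitzWith (3 * 2 ^ (-j)) (tent j : Space n → ℝ) := by
  have h := (lipschitz_ramp j).sub (lipschitz_ramp (n := n) (j + 1))
  have e : (2 * 2 ^ (-j) + 2 * 2 ^ (-(j + 1)) : ℝ≥0) = 3 * 2 ^ (-j) := by
    rw [neg_add, zpow_add₀ (by norm_num), zpow_neg_one]
    field_simp
    norm_num
  rwa [e] at h

lemma hasSum_tent {x : Space n} (hx : x ≠ 0) : HasSum (fun j => tent j x) 1 := by
  obtain ⟨i, hi⟩ := exists_mem_Ico_zpow (norm_pos_iff.2 hx) (by norm_num : (1 : ℝ) < 2)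
  have h : ∑ j ∈ ({i, i + 1} : Finset ℤ), tent j x = 1 := by
    rw [Finset.sum_pair (by lia), tent, tent, ramp_eq_one hi.1, ramp_eq_zero (j := i + 1 + 1)]
    · ring
    · simpa using hi.2.le
  rw [← h]
  refine hasSum_sum_of_ne_finset_zero fun j hj => ?_
  simp only [Finset.mem_insert, Finset.mem_singleton, not_or] at hj
  rcases lt_or_ge j i with hji | hji
  · exact tent_eq_zero_of_ge (le_trans (zpow_le_zpow_right₀ (by norm_num) (by lia)) hi.1)
  · exact tent_eq_zero_of_le (hi.2.le.trans (zpow_le_zpow_right₀ (by norm_num) (by lia)))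

/-- A locally Lipschitz function supported in a ball is Lipschitz. A point of the ball is compared
to a far one through the origin, where `f` vanishes too. -/
lemma lipschitzWith_of_locallyLipschitz {f : Space n → ℂ} (hf : LocallyLipschitz f) (h0 : f 0 = 0)
    {R : ℝ} (hR : ∀ x, R ≤ ‖x‖ → f x = 0) : ∃ K, LipschitzWith K f := by
  obtain ⟨K, hK⟩ := (hf.locallyLipschitzOn (s := Metric.closedBall 0 (2 * R)))
    |>.exists_lipschitzOnWith_of_compact (isCompact_closedBall _ _)
  have key : ∀ x y, ‖x‖ < R → dist (f x) (f y) ≤ K * dist x y := by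
    intro x y hx
    have hx' : x ∈ Metric.closedBall (0 : Space n) (2 * R) := by
      rw [mem_closedBall_zero_iff]; linarith [norm_nonneg x]
    by_cases hy : ‖y‖ ≤ 2 * R
    · exact hK.dist_le_mul x hx' y (by simpa using hy)
    · have := hK.dist_le_mul x hx' 0 (by
        rw [mem_closedBall_zero_iff, norm_zero]; linarith [norm_nonneg x])
      rw [hR y (by linarith [norm_nonneg x]), ← h0]
      refine this.trans ?_
      gcongr
      rw [dist_zero_right, dist_comm, dist_eq_norm]
      linarith [norm_sub_norm_le y x]
  refine ⟨K, LipschitzWith.of_dist_le_mul fun x y => ?_⟩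
  rcases lt_or_ge ‖x‖ R with hx | hx
  · exact key x y hx
  rcases lt_or_ge ‖y‖ R with hy | hy
  · rw [dist_comm, dist_comm x]
    exact key y x hy
  · rw [hR x hx, hR y hy, dist_self]
    positivity

lemma dx_eq_zero {g : SpaceTime n → ℂ} {z : SpaceTime n} (h : g =ᶠ[𝓝 z] 0) (e : Space n) :
    dx e g z = 0 := by
  rw [dx_eq_lineDeriv, h.lineDeriv_eq]
  simp [lineDeriv]

section Coefficient

variable {b : SpaceTime n → Vec n}

/-- The coefficient `b^α`, localised to `|x| ≈ 2^j`. -/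
def locCoeff (b : SpaceTime n → Vec n) (α : Fin (n + 1)) (j : ℤ) (z : SpaceTime n) : ℂ :=
  tent j z.2 * b z α

lemma locCoeff_eq_zero_of_lt {α : Fin (n + 1)} {j : ℤ} {z : SpaceTime n}
    (hz : ‖z.2‖ < 2 ^ (j - 1)) : locCoeff b α j =ᶠ[𝓝 z] 0 := by
  have : IsOpen {z : SpaceTime n | ‖z.2‖ < 2 ^ (j - 1)} :=
    isOpen_lt (by fun_prop) continuous_const
  filter_upwards [this.mem_nhds hz] with w hw
  simp [locCoeff, tent_eq_zero_of_le (le_of_lt hw)]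

lemma locCoeff_eq_zero_of_gt {α : Fin (n + 1)} {j : ℤ} {z : SpaceTime n}
    (hz : 2 ^ (j + 1) < ‖z.2‖) : locCoeff b α j =ᶠ[𝓝 z] 0 := by
  have : IsOpen {z : SpaceTime n | (2 : ℝ) ^ (j + 1) < ‖z.2‖} :=
    isOpen_lt continuous_const (by fun_prop)
  filter_upwards [this.mem_nhds hz] with w hw
  simp [locCoeff, tent_eq_zero_of_ge (le_of_lt hw)]

lemma lipschitz_tent_snd (j : ℤ) :
    LipschitzWith (3 * 2 ^ (-j)) fun z : SpaceTime n => tent j z.2 := by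
  have := (lipschitz_tent (n := n) j).comp (LipschitzWith.prod_snd (α := ℝ) (β := Space n))
  rwa [mul_one] at this

lemma isOpen_snd_ne_zero : IsOpen {z : SpaceTime n | z.2 ≠ 0} :=
  isOpen_ne_fun continuous_snd continuous_const

lemma locallyLipschitz_locCoeff (hb : LocallyLipschitzOn {z : SpaceTime n | z.2 ≠ 0} b)
    (α : Fin (n + 1)) (j : ℤ) : LocallyLipschitz (locCoeff b α j) := by
  intro z
  by_cases hz : z.2 = 0
  · refine ⟨0, _, locCoeff_eq_zero_of_lt (b := b) (α := α) (j := j) (z := z) ?_, ?_⟩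
    · rw [hz, norm_zero]; positivity
    · intro x hx y hy
      simp only [Set.mem_ofPred_eq, Pi.zero_apply] at hx hy
      simp [hx, hy]
  · obtain ⟨K, t, ht, hK⟩ := hb (x := z) hz
    rw [isOpen_snd_ne_zero.nhdsWithin_eq hz] at ht
    have hc : ContinuousAt b z := hK.continuousOn.continuousAt ht
    have hM : ∀ᶠ w in 𝓝 z, ‖b w‖ < ‖b z‖ + 1 :=
      hc.norm.eventually (gt_mem_nhds (by linarith))
    refine ⟨K + 3 * 2 ^ (-j) * (‖b z‖₊ + 1), _, inter_mem ht hM,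
      LipschitzOnWith.of_dist_le_mul fun x hx y hy => ?_⟩
    have h1 : ‖b x α - b y α‖ ≤ K * dist x y := by
      have := hK.dist_le_mul x hx.1 y hy.1
      rw [dist_eq_norm] at this
      exact (PiLp.norm_apply_le (b x - b y) α).trans this
    have h2 : ‖((tent j x.2 : ℝ) : ℂ) - (tent j y.2 : ℝ)‖ ≤ (3 * 2 ^ (-j) : ℝ≥0) * dist x y := by
      have := (lipschitz_tent_snd j).dist_le_mul x y
      rwa [← Complex.ofReal_sub, Complex.norm_real, ← dist_eq_norm]
    have h3 : ‖b y α‖ ≤ ‖b z‖ + 1 := (PiLp.norm_apply_le _ α).trans (le_of_lt hy.2)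
    calc dist (locCoeff b α j x) (locCoeff b α j y)
        = ‖tent j x.2 * (b x α - b y α) + ((tent j x.2 : ℝ) - (tent j y.2 : ℝ)) * b y α‖ := by
          rw [dist_eq_norm, locCoeff, locCoeff]
          congr 1
          ring
      _ ≤ 1 * (K * dist x y) + (3 * 2 ^ (-j) : ℝ≥0) * dist x y * (‖b z‖ + 1) := by
          refine (norm_add_le _ _).trans ?_
          rw [norm_mul, norm_mul]
          gcongr
          exact norm_tent_le_one _ _
      _ = _ := by
          push_cast
          ring

lemma ae_differentiableAt (hb : LocallyLipschitzOn {z : SpaceTime n | z.2 ≠ 0} b) :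
    ∀ᵐ z : SpaceTime n, z.2 ≠ 0 → DifferentiableAt ℝ b z := by
  rw [ae_iff]
  refine measure_null_of_locally_null _ fun z hz => ?_
  simp only [Set.mem_ofPred_eq, Classical.not_imp] at hz
  obtain ⟨K, t, ht, hK⟩ := hb (x := z) hz.1
  rw [isOpen_snd_ne_zero.nhdsWithin_eq hz.1] at ht
  have h := (hK.mono interior_subset).ae_differentiableWithinAt_of_mem (μ := volume)
  refine ⟨_, inter_mem_nhdsWithin _ (interior_mem_nhds.2 ht), measure_mono_null ?_ (ae_iff.1 h)⟩
  rintro w ⟨hw, hwt⟩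
  simp only [Set.mem_ofPred_eq, Classical.not_imp] at hw ⊢
  exact ⟨hwt, fun hd => hw.2 (hd.differentiableAt (isOpen_interior.mem_nhds hwt))⟩

/-- The supremum of `|x|² |∇b| + |x| |b|` over `A_i`. -/
def coeffSup (b : SpaceTime n → Vec n) (i : ℤ) : ℝ≥0∞ :=
  ⨆ z ∈ ann n i, ENNReal.ofReal (‖z.2‖ ^ 2 * gradAbs b z + ‖z.2‖ * ‖b z‖)

lemma le_coeffSup {i : ℤ} {z : SpaceTime n} (hz : z ∈ ann n i) (h : coeffSup b i ≠ ⊤) :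
    ‖z.2‖ ^ 2 * gradAbs b z + ‖z.2‖ * ‖b z‖ ≤ (coeffSup b i).toReal :=
  (ENNReal.ofReal_le_iff_le_toReal h).1
    (le_iSup₂ (f := fun z (_ : z ∈ ann n i) =>
      ENNReal.ofReal (‖z.2‖ ^ 2 * gradAbs b z + ‖z.2‖ * ‖b z‖)) z hz)

/-- The size of `b` near `|x| ≈ 2^j`. -/
def coeffSize (b : SpaceTime n → Vec n) (j : ℤ) : ℝ≥0 :=
  (coeffSup b (j - 1)).toNNReal + (coeffSup b j).toNNReal

lemma le_coeffSize (h : ∀ i, coeffSup b i ≠ ⊤) {j : ℤ} {z : SpaceTime n}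
    (h1 : 2 ^ (j - 1) ≤ ‖z.2‖) (h2 : ‖z.2‖ ≤ 2 ^ (j + 1)) :
    ‖z.2‖ ^ 2 * gradAbs b z + ‖z.2‖ * ‖b z‖ ≤ coeffSize b j := by
  rw [coeffSize, NNReal.coe_add]
  rcases le_total ‖z.2‖ (2 ^ j) with h3 | h3
  · exact (le_coeffSup ⟨h1, by simpa using h3⟩ (h (j - 1))).trans
      (le_add_of_nonneg_right NNReal.zero_le_coe)
  · exact (le_coeffSup ⟨h3, h2⟩ (h j)).trans (le_add_of_nonneg_left NNReal.zero_le_coe)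

lemma gradAbs_nonneg (b : SpaceTime n → Vec n) (z : SpaceTime n) : 0 ≤ gradAbs b z :=
  Real.sqrt_nonneg _

lemma norm_le_coeffSize (h : ∀ i, coeffSup b i ≠ ⊤) {j : ℤ} {z : SpaceTime n}
    (h1 : 2 ^ (j - 1) ≤ ‖z.2‖) (h2 : ‖z.2‖ ≤ 2 ^ (j + 1)) :
    ‖b z‖ ≤ 2 * coeffSize b j * 2 ^ (-j) := by
  have h3 := le_coeffSize h h1 h2
  have h4 := mul_nonneg (sq_nonneg ‖z.2‖) (gradAbs_nonneg b z)
  have h5 : (2 : ℝ) ^ (j - 1) * ‖b z‖ ≤ coeffSize b j :=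
    (mul_le_mul_of_nonneg_right h1 (norm_nonneg _)).trans (by linarith)
  rw [zpow_sub_one₀ (by norm_num)] at h5
  calc ‖b z‖ = 2 * (2 ^ j * 2⁻¹ * ‖b z‖) * 2 ^ (-j) := by
        rw [zpow_neg]
        field_simp
    _ ≤ _ := by gcongr

lemma gradAbs_le_coeffSize (h : ∀ i, coeffSup b i ≠ ⊤) {j : ℤ} {z : SpaceTime n}
    (h1 : 2 ^ (j - 1) ≤ ‖z.2‖) (h2 : ‖z.2‖ ≤ 2 ^ (j + 1)) :
    gradAbs b z ≤ 4 * coeffSize b j * (2 ^ (-j)) ^ 2 := by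
  have h3 := le_coeffSize h h1 h2
  have h4 := mul_nonneg (norm_nonneg z.2) (norm_nonneg (b z))
  have h5 : ((2 : ℝ) ^ (j - 1)) ^ 2 * gradAbs b z ≤ coeffSize b j := by
    refine le_trans ?_ (le_trans (le_add_of_nonneg_right h4) h3)
    have := gradAbs_nonneg b z
    gcongr
  rw [zpow_sub_one₀ (by norm_num)] at h5
  calc gradAbs b z = 4 * ((2 ^ j * 2⁻¹) ^ 2 * gradAbs b z) * (2 ^ (-j)) ^ 2 := by
        rw [zpow_neg]
        field_simp
        norm_num
    _ ≤ _ := by gcongr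

lemma norm_fderiv_apply_le (b : SpaceTime n → Vec n) (z : SpaceTime n) (α β : Fin (n + 1)) :
    ‖fderiv ℝ b z (dir n β) α‖ ≤ gradAbs b z := by
  refine (PiLp.norm_apply_le _ α).trans (Real.le_sqrt_of_sq_le ?_)
  exact Finset.single_le_sum (f := fun β => ‖fderiv ℝ b z (dir n β)‖ ^ 2)
    (fun _ _ => sq_nonneg _) (Finset.mem_univ β)

lemma norm_locCoeff_le (h : ∀ i, coeffSup b i ≠ ⊤) (α : Fin (n + 1)) (j : ℤ) (z : SpaceTime n) :
    ‖locCoeff b α j z‖ ≤ 2 * coeffSize b j * 2 ^ (-j) := by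
  have h0 : (0 : ℝ) ≤ 2 * coeffSize b j * 2 ^ (-j) := by positivity
  rcases lt_or_ge ‖z.2‖ (2 ^ (j - 1)) with h1 | h1
  · rwa [(locCoeff_eq_zero_of_lt h1).eq_of_nhds, Pi.zero_apply, norm_zero]
  rcases lt_or_ge (2 ^ (j + 1)) ‖z.2‖ with h2 | h2
  · rwa [(locCoeff_eq_zero_of_gt h2).eq_of_nhds, Pi.zero_apply, norm_zero]
  rw [locCoeff, norm_mul]
  calc _ ≤ 1 * ‖b z‖ := by
        gcongr
        · exact norm_tent_le_one _ _
        · exact PiLp.norm_apply_le _ _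
    _ ≤ _ := by
        rw [one_mul]
        exact norm_le_coeffSize h h1 h2

lemma norm_dx_locCoeff_le (hb : LocallyLipschitzOn {z : SpaceTime n | z.2 ≠ 0} b)
    (h : ∀ i, coeffSup b i ≠ ⊤) (α : Fin (n + 1)) (j : ℤ) (i : Fin n) :
    ∀ᵐ z : SpaceTime n, ‖dx (EuclideanSpace.single i (1 : ℝ)) (locCoeff b α j) z‖ ≤
      10 * coeffSize b j * (2 ^ (-j)) ^ 2 := by
  have h0 : (0 : ℝ) ≤ 10 * coeffSize b j * (2 ^ (-j)) ^ 2 := by positivity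
  filter_upwards [ae_differentiableAt hb, (lipschitz_tent_snd (n := n) j).ae_differentiableAt
    (μ := volume)] with z hz1 hz2
  rcases lt_or_ge ‖z.2‖ (2 ^ (j - 1)) with h1 | h1
  · rwa [dx_eq_zero (locCoeff_eq_zero_of_lt h1), norm_zero]
  rcases lt_or_ge (2 ^ (j + 1)) ‖z.2‖ with h2 | h2
  · rwa [dx_eq_zero (locCoeff_eq_zero_of_gt h2), norm_zero]
  have hz0 : z.2 ≠ 0 := by
    rw [← norm_pos_iff]
    exact lt_of_lt_of_le (by positivity) h1
  set e : SpaceTime n := (0, EuclideanSpace.single i (1 : ℝ)) with he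
  have hf : HasFDerivAt (fun z : SpaceTime n => ((tent j z.2 : ℝ) : ℂ))
      (Complex.ofRealCLM.comp (fderiv ℝ (fun z : SpaceTime n => tent j z.2) z)) z :=
    Complex.ofRealCLM.hasFDerivAt.comp z hz2.hasFDerivAt
  have hg : HasFDerivAt (fun z : SpaceTime n => b z α)
      (((EuclideanSpace.proj (𝕜 := ℂ) α).restrictScalars ℝ).comp (fderiv ℝ b z)) z :=
    ((EuclideanSpace.proj (𝕜 := ℂ) α).restrictScalars ℝ).hasFDerivAt.comp z
      (hz1 hz0).hasFDerivAt
  have hd : dx (EuclideanSpace.single i (1 : ℝ)) (locCoeff b α j) z =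
      tent j z.2 * fderiv ℝ b z (dir n i.succ) α +
        b z α * (fderiv ℝ (fun z : SpaceTime n => tent j z.2) z e : ℝ) := by
    rw [dx_eq_lineDeriv]
    exact ((hf.mul hg).hasLineDerivAt e).lineDeriv
  have hT : ‖((fderiv ℝ (fun z : SpaceTime n => tent j z.2) z e : ℝ) : ℂ)‖ ≤ 3 * 2 ^ (-j) := by
    rw [Complex.norm_real]
    refine (ContinuousLinearMap.le_opNorm _ _).trans ?_
    have h1 := norm_fderiv_le_of_lipschitz ℝ (x₀ := z) (lipschitz_tent_snd (n := n) j)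
    have h2 : ‖e‖ = 1 := by simp [he, Prod.norm_def]
    rw [h2, mul_one]
    simpa using h1
  rw [hd]
  calc _ ≤ (1 : ℝ) * (4 * coeffSize b j * (2 ^ (-j)) ^ 2) +
        2 * coeffSize b j * 2 ^ (-j) * (3 * 2 ^ (-j)) := by
        refine (norm_add_le _ _).trans ?_
        rw [norm_mul, norm_mul]
        gcongr
        · exact norm_tent_le_one _ _
        · exact (norm_fderiv_apply_le b z α i.succ).trans (gradAbs_le_coeffSize h h1 h2)
        · exact (PiLp.norm_apply_le (b z) α).trans (norm_le_coeffSize h h1 h2)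
    _ = 10 * coeffSize b j * (2 ^ (-j)) ^ 2 := by ring

lemma enorm_le_coe_mul_pw {x : ℂ} {B : ℝ≥0} {a : ℤ} (h : ‖x‖ ≤ B * 2 ^ a) :
    ‖x‖ₑ ≤ B * pw a := by
  rw [pw_int, ← ENNReal.ofReal_coe_nnreal, ← ENNReal.ofReal_mul NNReal.zero_le_coe, ← ofReal_norm]
  exact ENNReal.ofReal_le_ofReal h

/-- The support of the localised coefficient makes its scale `2^{j+1}`. The constant is `10` from the
bound of the derivative, times the ratio `2²` between the scales `2^j` and `2^{j+1}`. -/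
lemma scaledCoeff_locCoeff (hb : LocallyLipschitzOn {z : SpaceTime n | z.2 ≠ 0} b)
    (h : ∀ i, coeffSup b i ≠ ⊤) (α : Fin (n + 1)) (j : ℤ) :
    ScaledCoeff (j + 1) (40 * coeffSize b j) (locCoeff b α j) := by
  have hl := locallyLipschitz_locCoeff hb α j
  have hL : LipSlices (locCoeff b α j) := fun t => by
    refine lipschitzWith_of_locallyLipschitz (R := 2 ^ (j + 1))
      (hl.comp (LocallyLipschitz.prodMk_left t)) ?_ fun x hx => ?_
    · simp [locCoeff, tent_eq_zero_of_le (x := (0 : Space n)) (j := j) (by simp; positivity)]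
    · simp [locCoeff, tent_eq_zero_of_ge hx]
  have h4 : (2 : ℝ) ^ (-j) = 2 * 2 ^ (-(j + 1)) := by
    rw [neg_add, zpow_add₀ (by norm_num), zpow_neg_one]
    ring
  refine ⟨⟨hl.continuous.measurable, fun t => ⟨_, fun x => norm_locCoeff_le h α j (t, x)⟩⟩, hL,
    fun e => tame_dx e hl.continuous hL, fun z hz => ?_, fun e z hz => ?_, fun z => ?_, fun i => ?_⟩
  · rw [(locCoeff_eq_zero_of_gt (by simpa [cyl] using hz)).eq_of_nhds, Pi.zero_apply]
  · exact dx_eq_zero (locCoeff_eq_zero_of_gt (by simpa [cyl] using hz)) e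
  · have := enorm_le_coe_mul_pw (B := 40 * coeffSize b j) (a := -(j + 1))
      ((norm_locCoeff_le h α j z).trans ?_)
    · simpa using this
    · rw [h4]
      push_cast
      have : (0 : ℝ) ≤ coeffSize b j * 2 ^ (-(j + 1)) := by positivity
      linarith
  · filter_upwards [norm_dx_locCoeff_le hb h α j i] with z hz
    have := enorm_le_coe_mul_pw (B := 40 * coeffSize b j) (a := -2 * (j + 1))
      (hz.trans (le_of_eq ?_))
    · simpa using this
    · have e2 : (2 : ℝ) ^ (-2 * (j + 1)) = (2 ^ (-(j + 1))) ^ 2 := by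
        rw [← zpow_natCast, ← zpow_mul]
        congr 1
        push_cast
        ring
      rw [h4, e2]
      push_cast
      ring

end Coefficient

/-! ### The first order term -/

lemma CoeffB.coeffSup_ne_top {ε : ℝ} {b : SpaceTime n → Vec n} (hb : CoeffB ε b) (i : ℤ) :
    coeffSup b i ≠ ⊤ := fun h => by
  have h1 := (ENNReal.le_tsum (f := coeffSup b) i).trans hb.bound
  simp [h] at h1

lemma CoeffB.tsum_coeffSize_le {ε : ℝ} {b : SpaceTime n → Vec n} (hb : CoeffB ε b) :
    ∑' j, (coeffSize b j : ℝ≥0∞) ≤ 2 * ENNReal.ofReal ε := by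
  have e : ∀ j, (coeffSize b j : ℝ≥0∞) = coeffSup b (j - 1) + coeffSup b j := fun j => by
    rw [coeffSize, ENNReal.coe_add, ENNReal.coe_toNNReal (hb.coeffSup_ne_top _),
      ENNReal.coe_toNNReal (hb.coeffSup_ne_top _)]
  simp_rw [e]
  have h : ∑' j, coeffSup b (j - 1) = ∑' j, coeffSup b j :=
    (Equiv.subRight (1 : ℤ)).tsum_eq (coeffSup b)
  rw [ENNReal.tsum_add, h, ← two_mul]
  exact mul_le_mul' le_rfl hb.bound

namespace LittlewoodPaley

variable (S : LittlewoodPaley n)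

/-- Multiplication by a scaled coefficient. The endpoints `|s| = 1` only occur for `n ≥ 4`. -/
lemma exists_scaledCoeff_mul_le {s : ℝ} (h1 : |s| ≤ 1) (h2 : |s| < ((n : ℝ) - 1) / 2) :
    ∃ C : ℝ≥0, ∀ (j : ℤ) (B : ℝ≥0) (β : SpaceTime n → ℂ) (v : 𝓢(SpaceTime n, ℂ)),
      ScaledCoeff j B β →
      (∑' k : ℤ, (pw (s * k) * xkDualNorm k (cv (sc S.prof k) fun z => β z * v z)) ^ 2) ^
          (1 / 2 : ℝ) ≤
        C * (B * (∑' l : ℤ, (pw (s * l) * xkNorm l (cv (sc S.prof l) v)) ^ 2) ^ (1 / 2 : ℝ)) := by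
  rcases h1.lt_or_eq with h | h
  · refine S.exists_mul_le ?_ h h2
    have : (1 : ℝ) < n := by linarith [abs_nonneg s]
    exact_mod_cast this.le
  · have hn : 4 ≤ n := by
      have : (3 : ℝ) < n := by linarith
      exact_mod_cast this
    rcases (abs_eq zero_le_one).1 h with rfl | rfl
    · simpa only [one_mul] using S.exists_mul_one_le hn
    · simpa only [neg_one_mul] using S.exists_mul_neg_one_le hn

/-- The coefficients are decomposed dyadically, each piece is estimated on its own, and `CoeffB`
sums the pieces. -/
theorem exists_bGrad_le {s : ℝ} (h1 : |s| ≤ 1) (h2 : |s| < ((n : ℝ) - 1) / 2) : ∃ K : ℝ≥0,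
    ∀ (ε : ℝ) (b : SpaceTime n → Vec n) (u : 𝓢(SpaceTime n, ℂ)), CoeffB ε b →
      yNorm S s (bGrad b u) ≤ K * (ENNReal.ofReal ε * xNorm S s (grad u)) := by
  obtain ⟨C, hC⟩ := S.exists_scaledCoeff_mul_le h1 h2
  have hn : n ≠ 0 := by
    rintro rfl
    norm_num at h2
    linarith [abs_nonneg s]
  refine ⟨80 * (n + 1) * C, fun ε b u hb => ?_⟩
  have hβ : ∀ α j, ScaledCoeff (j + 1) (40 * coeffSize b j) (locCoeff b α j) :=
    scaledCoeff_locCoeff hb.locallyLipschitz hb.coeffSup_ne_top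
  set v : Fin (n + 1) → 𝓢(SpaceTime n, ℂ) := fun α => ∂_{dir n α} u with hv
  have ht : ∀ α j, Tame fun z => locCoeff b α j z * v α z := fun α j =>
    (hβ α j).tame.mul (tame_schwartz _)
  rw [yNorm_eq]
  set X := xNorm S s (grad u) with hX
  set y : ℤ → Fin (n + 1) → ℤ → ℝ≥0∞ := fun j α k => pw (s * k) *
    xkDualNorm k (cv (sc S.prof k) fun z => locCoeff b α j z * v α z) with hy
  have hloc : ∀ j (z : SpaceTime n), (tent j z.2 : ℂ) * bGrad b u z =
      ∑ α, locCoeff b α j z * v α z := fun j z => by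
    rw [bGrad, Finset.mul_sum]
    refine Finset.sum_congr rfl fun α _ => ?_
    rw [locCoeff, grad_apply, mul_assoc]
  have hrow : ∀ k : ℤ, pw (s * k) * xkDualNorm k (cv (sc S.prof k) (bGrad b u)) ≤
      ∑' j, ∑ α, y j α k := by
    intro k
    have e : ∀ j, (cv (sc S.prof k) fun z : SpaceTime n => (tent j z.2 : ℂ) * bGrad b u z) =
        fun z => ∑ α, cv (sc S.prof k) (fun z => locCoeff b α j z * v α z) z := fun j => by
      ext z
      simp_rw [hloc]
      exact cv_sum (fun α _ => ht α j) _ z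
    calc _ ≤ pw (s * k) * ∑' j, ∑ α,
          xkDualNorm k (cv (sc S.prof k) fun z => locCoeff b α j z * v α z) := by
          refine mul_le_mul' le_rfl ((xkDualNorm_le_tsum k (g := fun j =>
            cv (sc S.prof k) fun z : SpaceTime n => (tent j z.2 : ℂ) * bGrad b u z)
              (fun j => ?_) fun z => ?_).trans (ENNReal.tsum_le_tsum fun j => ?_))
          · rw [e]
            exact Tame.aesm (Tame.sum fun α _ => (ht α j).cv _)
          · exact enorm_cv_le_tsum hn (fun j => (lipschitz_tent j).continuous.measurable)
              tent_nonneg (fun x hx => hasSum_tent hx) _ _ z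
          · rw [e]
            exact xkDualNorm_sum_le k fun α => Tame.aesm ((ht α j).cv _)
      _ = _ := by
          rw [← ENNReal.tsum_mul_left]
          simp only [hy, Finset.mul_sum]
  calc _ ≤ ∑' j, ∑ α, (∑' k, y j α k ^ 2) ^ (1 / 2 : ℝ) :=
        (sqrt_tsum_mono hrow).trans ((l2_tsum_le _).trans
          (ENNReal.tsum_le_tsum fun j => l2_sum_le _))
    _ ≤ ∑' j, ∑ _α : Fin (n + 1), C * ((40 * coeffSize b j : ℝ≥0) * X) := by
        refine ENNReal.tsum_le_tsum fun j => Finset.sum_le_sum fun α _ => ?_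
        refine (hC _ _ _ (v α) (hβ α j)).trans ?_
        rw [hX, xNorm_eq]
        refine mul_le_mul' le_rfl (mul_le_mul' le_rfl (sqrt_tsum_mono fun l => ?_))
        exact mul_le_mul' le_rfl (S.xkNorm_proj_le l u α)
    _ = (40 * (n + 1) * C * X) * ∑' j, (coeffSize b j : ℝ≥0∞) := by
        rw [← ENNReal.tsum_mul_left]
        refine tsum_congr fun j => ?_
        rw [Finset.sum_const, Finset.card_univ, Fintype.card_fin, nsmul_eq_mul]
        push_cast
        ring
    _ ≤ (40 * (n + 1) * C * X) * (2 * ENNReal.ofReal ε) := by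
        gcongr
        exact hb.tsum_coeffSize_le
    _ = _ := by
        push_cast
        ring

end LittlewoodPaley

lemma ofReal_coe_add_one_mul (K : ℝ≥0) (ε : ℝ) (x : ℝ≥0∞) :
    K * (ENNReal.ofReal ε * x) ≤ ENNReal.ofReal ((K + 1) * ε) * x := by
  rw [ENNReal.ofReal_mul (by positivity), ← mul_assoc]
  gcongr
  rw [← ENNReal.ofReal_coe_nnreal]
  exact ENNReal.ofReal_le_ofReal (by linarith)

lemma ofReal_rpow_half {ε : ℝ} (hε : 0 < ε) :
    ENNReal.ofReal ε ^ (1 / 2 : ℝ) = ENNReal.ofReal (Real.sqrt ε) := by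
  rw [Real.sqrt_eq_rpow, ENNReal.ofReal_rpow_of_pos hε]

end LocEnergy

end

open LocEnergy in
theorem lemma3 (n : ℕ) (S : LittlewoodPaley n) :
    (∀ s : ℝ, |s| ≤ 1 → |s| < ((n : ℝ) - 1) / 2 →
      ∃ C : ℝ, 0 < C ∧ ∀ ε : ℝ, 0 < ε → ∀ b : SpaceTime n → Vec n, CoeffB ε b →
        ∀ u : 𝓢(SpaceTime n, ℂ),
          yNorm S s (bGrad b u) ≤ ENNReal.ofReal (C * ε) * xNorm S s (grad u)) ∧
    (3 ≤ n → ∀ s : ℝ, -1 < s → s < 0 →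
      ∃ C : ℝ, 0 < C ∧ ∀ ε : ℝ, 0 < ε → ∀ c : SpaceTime n → ℂ, CoeffC ε c →
        ∀ u : 𝓢(SpaceTime n, ℂ),
          yNorm S s (fun z => c z * u z) ≤ ENNReal.ofReal (C * ε) * xNorm S s (grad u)) ∧
    (4 ≤ n → ∀ s : ℝ, (s = -1 ∨ s = 0) →
      ∃ C : ℝ, 0 < C ∧ ∀ ε : ℝ, 0 < ε → ∀ c : SpaceTime n → ℂ, CoeffCC ε c →
        ∀ u : 𝓢(SpaceTime n, ℂ),
          yNorm S s (fun z => c z * u z) ≤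
            ENNReal.ofReal (C * Real.sqrt ε) * xNorm S s (grad u)) ∧
    (n = 3 →
      ∃ C : ℝ, 0 < C ∧ ∀ ε : ℝ, 0 < ε → ∀ c : SpaceTime n → ℂ, CoeffCC ε c →
        ∀ u : SpaceTime n → ℂ, AEStronglyMeasurable u volume →
          yNorm S 0 (fun z => c z * u z) ≤
            ENNReal.ofReal (C * Real.sqrt ε) * xTildeNorm S 1 u) := by
  refine ⟨fun s h1 h2 => ?_, fun hn s h1 h2 => ?_, fun hn s hs => ?_, fun hn => ?_⟩
  · obtain ⟨K, hK⟩ := S.exists_bGrad_le h1 h2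
    exact ⟨K + 1, by positivity, fun ε _ b hb u =>
      (hK ε b u hb).trans (ofReal_coe_add_one_mul K _ _)⟩
  · obtain ⟨K, hK⟩ := S.exists_potential_le hn h1 h2
    exact ⟨K + 1, by positivity, fun ε _ c hc u =>
      (hK ε c u hc).trans (ofReal_coe_add_one_mul K _ _)⟩
  · rcases hs with rfl | rfl
    · obtain ⟨K, hK⟩ := S.exists_potential_neg_one_le hn
      refine ⟨K + 1, by positivity, fun ε hε c hc u => (hK ε c u hc).trans ?_⟩
      rw [ofReal_rpow_half hε]
      exact ofReal_coe_add_one_mul K _ _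
    · obtain ⟨K, hK⟩ := S.exists_potential_zero_le hn
      refine ⟨K + 1, by positivity, fun ε hε c hc u => (hK ε c u hc).trans ?_⟩
      rw [ofReal_rpow_half hε]
      exact ofReal_coe_add_one_mul K _ _
  · obtain ⟨K, hK⟩ := S.exists_potential_tilde_le (by omega)
    refine ⟨K + 1, by positivity, fun ε hε c hc u hu => (hK ε c u hc hu).trans ?_⟩
    rw [ofReal_rpow_half hε]
    exact ofReal_coe_add_one_mul K _ _
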